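/- **Common-message capacity.** Let $\mathcal S,\mathcal X_1,\mathcal X_2$ be finite non-empty alphabets and $\mathcal Y$ a discrete alphabet, let $Q_S$ be a probability mass function on $\mathcal S$ and let $W_{Y|X_1,X_2,S}$ be a channel, that is, a probability mass function on $\mathcal Y$ for each $(x_1,x_2,s)$. The states $S_1,S_2,\dots$ are i.i.d. with law $Q_S$ and the channel is memoryless given the inputs and the states. For positive integers $n,M_c,M_1$, an $(M_c,M_1,n,\epsilon)$ code consists of an encoder $\phi_1:\{1,\dots,M_c\}\times\{1,\dots,M_1\}\times\mathcal S^n\to\mathcal X_1^n$ (Encoder 1 knows both messages, and the states non-causally), encoders $\phi_{2,i}:\{1,\dots,M_c\}\times\mathcal S^{i-1}\to\mathcal X_2$, $i=1,\dots,n$ (Encoder 2 knows the common message, and the states strictly causally), and a decoder $\psi:\mathcal Y^n\to\{1,\dots,M_c\}\times\{1,\dots,M_1\}$, such that for independent uniformly distributed messages $(W_c,W_1)$ the average probability of error $\Pr(\psi(Y^n)\ne(W_c,W_1))$ is at most $\epsilon$. A pair $(R_c,R_1)$ of nonnegative rates is achievable if for every $\epsilon>0$ there are an $n\ge1$ and a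 $(\lceil 2^{nR_c}\rceil,\lceil 2^{nR_1}\rceil,n,\epsilon)$ code; the capacity region is the closure of the set of achievable pairs. The common-message capacity $\mathcal C$ is the largest $R_c$ such that $(R_c,0)$ lies in the capacity region; it is also the supremum of the $R_c$ for which $(R_c,0)$ is achievable. Then $$\mathcal C=\max\big[\,I(U,X_2;Y)-I(U;S|X_2)\,\big],$$ with mutual informations in bits, where the maximum, which is attained, is over all finite alphabets of the auxiliary variable $U$ and all joint laws of the form $$P_{S,U,X_1,X_2,Y}=Q_S\,P_{X_2}\,P_{U,X_1|S,X_2}\,W_{Y|X_1,X_2,S}.$$ Moreover, strictly causal knowledge of the states at Encoder 2 does not increase this capacity: the common-message capacity of the model in which Encoder 2 knows only the common message and no states (all $\phi_{2,i}$ depend on the common message only) is also $\mathcal C$. -/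

import Mathlib

open scoped ENNReal

noncomputable section

namespace StateMAC

/-- A block code of length `n` for the two-user multiple access channel with states known
non-causally at Encoder 1 and strictly causally at Encoder 2, with `Mc` common messages and `M₁`
individual messages. At (0-based) time `i`, Encoder 2 sees the states of the times `0, …, i - 1`
only. -/
structure Code (S X₁ X₂ Y : Type*) (Mc M₁ n : ℕ) where
  /-- the map `W_c × W_1 × S^n → X_1^n` at Encoder 1 -/
  enc₁ : Fin Mc → Fin M₁ → (Fin n → S) → (Fin n → X₁)
  /-- the maps `W_c × S^{i-1} → X_2` at Encoder 2 -/
  enc₂ : (i : Fin n) → Fin Mc → (Fin (i : ℕ) → S) → X₂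
  /-- the decoder `Y^n → W_c × W_1` -/
  dec : (Fin n → Y) → Fin Mc × Fin M₁

section Coding

variable {S X₁ X₂ Y : Type*} {Mc M₁ n : ℕ}

/-- The letter sent by Encoder 2 at time `i` for the common message `w` and the state
sequence `s`. -/
def Code.input₂ (c : Code S X₁ X₂ Y Mc M₁ n) (w : Fin Mc) (s : Fin n → S) (i : Fin n) : X₂ :=
  c.enc₂ i w fun j : Fin (i : ℕ) => s (Fin.castLE i.isLt.le j)

/-- Encoder 2 makes no use of the states: this is a code for the model in which Encoder 2 knows
only the common message. -/
def Code.StateFree₂ (c : Code S X₁ X₂ Y Mc M₁ n) : Prop :=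
  ∀ (i : Fin n) (w : Fin Mc) (s s' : Fin (i : ℕ) → S), c.enc₂ i w s = c.enc₂ i w s'

/-- The joint probability mass function of messages, states and channel outputs that a code
induces: independent uniform messages, i.i.d. states with law `Q`, memoryless channel `W`. -/
def Code.jointProb (c : Code S X₁ X₂ Y Mc M₁ n) (Q : PMF S) (W : X₁ → X₂ → S → PMF Y)
    (w : Fin Mc × Fin M₁) (s : Fin n → S) (y : Fin n → Y) : ℝ≥0∞ :=
  (Mc : ℝ≥0∞)⁻¹ * (M₁ : ℝ≥0∞)⁻¹ *
    ∏ i, (Q (s i) * W (c.enc₁ w.1 w.2 s i) (c.input₂ w.1 s i) (s i) (y i))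

/-- The average probability of error of a code. -/
def Code.errorProb (c : Code S X₁ X₂ Y Mc M₁ n) (Q : PMF S) (W : X₁ → X₂ → S → PMF Y) : ℝ≥0∞ :=
  ∑' (w : Fin Mc × Fin M₁) (s : Fin n → S) (y : Fin n → Y),
    if c.dec y = w then 0 else c.jointProb Q W w s y

/-- The pair `R = (R_c, R_1)` of rates (in bits per channel use) is achievable: for every `ε > 0`
there is a `(2^{n R_c}, 2^{n R_1}, n, ε)` code, where the numbers of messages are rounded up to
integers. -/
def IsAchievable (Q : PMF S) (W : X₁ → X₂ → S → PMF Y) (R : ℝ × ℝ) : Prop :=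
  0 ≤ R.1 ∧ 0 ≤ R.2 ∧ ∀ ε : ℝ, 0 < ε → ∃ n : ℕ, 0 < n ∧
    ∃ c : Code S X₁ X₂ Y ⌈(2 : ℝ) ^ ((n : ℝ) * R.1)⌉₊ ⌈(2 : ℝ) ^ ((n : ℝ) * R.2)⌉₊ n,
      c.errorProb Q W ≤ ENNReal.ofReal ε

/-- Achievability of a pair of rates in the model in which Encoder 2 does not know the states at
all. -/
def IsAchievableNoState₂ (Q : PMF S) (W : X₁ → X₂ → S → PMF Y) (R : ℝ × ℝ) : Prop :=
  0 ≤ R.1 ∧ 0 ≤ R.2 ∧ ∀ ε : ℝ, 0 < ε → ∃ n : ℕ, 0 < n ∧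
    ∃ c : Code S X₁ X₂ Y ⌈(2 : ℝ) ^ ((n : ℝ) * R.1)⌉₊ ⌈(2 : ℝ) ^ ((n : ℝ) * R.2)⌉₊ n,
      c.StateFree₂ ∧ c.errorProb Q W ≤ ENNReal.ofReal ε

/-- The capacity region: the closure of the set of achievable pairs of rates. -/
def capacityRegion (Q : PMF S) (W : X₁ → X₂ → S → PMF Y) : Set (ℝ × ℝ) :=
  closure {R | IsAchievable Q W R}

/-- The capacity region of the model in which Encoder 2 does not know the states at all. -/
def capacityRegionNoState₂ (Q : PMF S) (W : X₁ → X₂ → S → PMF Y) : Set (ℝ × ℝ) :=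
  closure {R | IsAchievableNoState₂ Q W R}

/-- The common-message capacity: the supremum of the common rates `R_c` in the capacity region
when the individual rate is `R_1 = 0`. -/
def commonMessageCapacity (Q : PMF S) (W : X₁ → X₂ → S → PMF Y) : ℝ :=
  sSup {R | (R, 0) ∈ capacityRegion Q W}

end Coding

section Information

variable {A B C : Type*}

/-- The mutual information `I(A;B)`, in bits, of a pair with joint law `p`. The series converges
absolutely as soon as one of the two alphabets is finite. -/
def mutualInfo (p : PMF (A × B)) : ℝ :=
  ∑' z : A × B, (p z).toReal * Real.logb 2
    ((p z).toReal / ((p.map Prod.fst z.1).toReal * (p.map Prod.snd z.2).toReal))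

/-- The conditional mutual information `I(A;B|C)`, in bits, of a triple with joint law `p`. -/
def condMutualInfo (p : PMF (A × B × C)) : ℝ :=
  ∑' z : A × B × C, (p z).toReal * Real.logb 2
    ((p z).toReal * (p.map (fun t => t.2.2) z.2.2).toReal /
      ((p.map (fun t => (t.1, t.2.2)) (z.1, z.2.2)).toReal * (p.map Prod.snd z.2).toReal))

variable {S U X₁ X₂ Y : Type*}

/-- The joint law `Q_S P_{X₂} P_{U,X₁|S,X₂} W_{Y|X₁,X₂,S}` of `(S, U, X₁, X₂, Y)`. -/
def jointLaw (Q : PMF S) (W : X₁ → X₂ → S → PMF Y) (P₂ : PMF X₂) (K : S → X₂ → PMF (U × X₁)) :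
    PMF (S × U × X₁ × X₂ × Y) :=
  Q.bind fun s => P₂.bind fun x₂ => (K s x₂).bind fun ux =>
    (W ux.2 x₂ s).map fun y => (s, ux.1, ux.2, x₂, y)

/-- The quantity `I(U,X₂;Y) - I(U;S|X₂)` for a law of `(S, U, X₁, X₂, Y)`. -/
def rateFunctional (P : PMF (S × U × X₁ × X₂ × Y)) : ℝ :=
  mutualInfo (P.map fun (_, u, _, x₂, y) => ((u, x₂), y)) -
    condMutualInfo (P.map fun (s, u, _, x₂, _) => (u, s, x₂))

end Information

end StateMAC

end

set_option linter.unusedSectionVars false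

noncomputable section

namespace StateMAC

/-! Write V = (U, X₂). Since X₂ is independent of S, I(U;S|X₂) = I(V;S), and the target becomes the
Gelfand–Pinsker quantity I(V;Y) - I(V;S) (`rate`, in nats), under the constraint that X₂ is a
function of V independent of S (`IsTestLaw`). The converse is proved for strictly causal states at
Encoder 2 and the direct part without states there, so both models get the same value.

Converse (`block_converse`): take V_i to be the message, the states before time i and the outputs
after time i. Encoder 2's letter is a function of V_i, and strict causality makes it independent of
S_i. Fano's inequality, subadditivity of entropy and Csiszár's sum identity, here a telescoping sum
over `hybrid` sequences, bound the message information by the sum of I(V_i;Y_i) - I(V_i;S_i). An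
individual message is fixed at its best value.

Direct part (`exists_one_shot_code`, `exists_block_code`): each message receives a word of second
inputs and, given that word, J auxiliary words. Encoder 1 picks one of them at random with weights
given by its likelihood ratio with the state; the decoder picks a message with weights given by
likelihood ratios with the output. Jensen's inequality bounds the expected success from below by an
average of two shares under the true joint law. Power bounds on the shares factor over letters, and
a Chernoff argument makes the error vanish when log J / n exceeds I(V;S) and the total rate stays
below I(V;Y).

Maximum (`exists_max_rateFunctional`): conditioning on V = v writes the rate as an output entropy of
the input law plus an average of a function of the conditional laws. It is therefore a continuous
function on the compact convex hull of a graph in finite dimension, cut by the closed independence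
constraint; no bound on the alphabet of U is fixed beforehand.

An infinite output alphabet is quantized to a finite one, with arbitrarily little loss of rate
(`exists_rate_quantize_gt`) or of success probability (`Code.exists_quantize`). -/

/-! ### Log-sum inequality, product sums and compact convex hulls -/

/-- This is log x ≥ 1 - 1/x at x = a / (b c), linear in a and b so that it can be summed. -/
theorem mul_log_div_lower {a b c : ℝ} (ha : 0 ≤ a) (hb : 0 ≤ b) (hab : b = 0 → a = 0)
    (hc : 0 < c) : a * Real.log c + a - b * c ≤ a * Real.log (a / b) := by
  rcases ha.eq_or_lt with rfl | ha
  · have := mul_nonneg hb hc.le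
    simp; linarith
  have hb : 0 < b := hb.lt_of_ne fun h => ha.ne' (hab h.symm)
  have h1 := Real.one_sub_inv_le_log_of_pos (show 0 < a / b / c by positivity)
  rw [Real.log_div (by positivity) hc.ne'] at h1
  have h2 := mul_le_mul_of_nonneg_left h1 ha.le
  have h3 : a * (1 - (a / b / c)⁻¹) = a - b * c := by field_simp
  linarith

/-- The log-sum inequality for series. -/
theorem tsum_mul_log_div_ge {ι : Type*} {a b : ι → ℝ} (ha : ∀ i, 0 ≤ a i) (hb : ∀ i, 0 ≤ b i)
    (hab : ∀ i, b i = 0 → a i = 0) (sa : Summable a) (sb : Summable b)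
    (sl : Summable fun i => a i * Real.log (a i / b i)) :
    (∑' i, a i) * Real.log ((∑' i, a i) / ∑' i, b i) ≤ ∑' i, a i * Real.log (a i / b i) := by
  rcases (tsum_nonneg ha).eq_or_lt with h0 | hA
  · have : ∀ i, a i = 0 := fun i =>
      le_antisymm (h0 ▸ sa.le_tsum i fun j _ => ha j) (ha i)
    simp [this]
  have hB : 0 < ∑' i, b i := by
    refine (tsum_nonneg hb).lt_of_ne fun h => hA.ne' ?_
    have : ∀ i, a i = 0 := fun i =>
      hab i (le_antisymm (h ▸ sb.le_tsum i fun j _ => hb j) (hb i))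
    simp [this]
  -- With the ratio of the totals as c, the linear terms cancel after summation.
  set c := (∑' i, a i) / ∑' i, b i with hc
  have hcp : 0 < c := by positivity
  have key : ∑' i, (a i * Real.log c + a i - b i * c) ≤ ∑' i, a i * Real.log (a i / b i) :=
    Summable.tsum_le_tsum (fun i => mul_log_div_lower (ha i) (hb i) (hab i) hcp)
      (((sa.mul_right _).add sa).sub (sb.mul_right _)) sl
  rw [((sa.mul_right _).add sa).tsum_sub (sb.mul_right _), (sa.mul_right _).tsum_add sa,
    tsum_mul_right, tsum_mul_right] at key
  have : (∑' i, b i) * c = ∑' i, a i := by rw [hc]; field_simp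
  linarith

/-- The log-sum inequality for finite sums. -/
theorem sum_mul_log_div_ge {ι : Type*} (s : Finset ι) {a b : ι → ℝ} (ha : ∀ i, 0 ≤ a i)
    (hb : ∀ i, 0 ≤ b i) (hab : ∀ i, b i = 0 → a i = 0) :
    (∑ i ∈ s, a i) * Real.log ((∑ i ∈ s, a i) / ∑ i ∈ s, b i) ≤
      ∑ i ∈ s, a i * Real.log (a i / b i) := by
  have := tsum_mul_log_div_ge (a := fun i : s => a i) (b := fun i : s => b i) (fun i => ha i)
    (fun i => hb i) (fun i => hab i) Summable.of_finite Summable.of_finite Summable.of_finite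
  simpa only [Finset.tsum_subtype, tsum_fintype, Finset.sum_coe_sort s a, Finset.sum_coe_sort s b,
    Finset.sum_coe_sort s fun i => a i * Real.log (a i / b i)] using this

/-- The logarithm is nonpositive, and the tangent bound with c = 1 gives at least a - b. -/
theorem abs_mul_log_div_le {a b : ℝ} (ha : 0 ≤ a) (hab : a ≤ b) :
    |a * Real.log (a / b)| ≤ b := by
  rcases ha.eq_or_lt with rfl | ha
  · simpa using hab
  have hb : 0 < b := ha.trans_le hab
  have h1 : a * Real.log (a / b) ≤ 0 :=
    mul_nonpos_of_nonneg_of_nonpos ha.le (Real.log_nonpos (by positivity) (by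
      rw [div_le_one hb]; exact hab))
  have h2 := mul_log_div_lower ha.le hb.le (fun h => absurd h hb.ne') one_pos
  rw [abs_of_nonpos h1]
  simp at h2
  linarith

/-- The constant splits off as a multiple of the summable a; the rest is dominated by b. In the
application c is the probability of an auxiliary letter and b the output law. -/
theorem summable_mul_log_div {ι : Type*} {a b : ι → ℝ} {c : ℝ} (hc : 0 < c)
    (ha : ∀ i, 0 ≤ a i) (hab : ∀ i, a i ≤ b i) (sb : Summable b) :
    Summable fun i => a i * Real.log (a i / (c * b i)) := by
  have sa : Summable a := sb.of_nonneg_of_le ha hab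
  have h1 : Summable fun i => a i * Real.log (a i / b i) :=
    Summable.of_abs (sb.of_nonneg_of_le (fun i => abs_nonneg _)
      fun i => abs_mul_log_div_le (ha i) (hab i))
  refine (h1.sub (sa.mul_right (Real.log c))).congr fun i => ?_
  rcases (ha i).eq_or_lt with h | h
  · simp [← h]
  have hb := h.trans_le (hab i)
  simp only [Real.log_div h.ne' (mul_pos hc hb).ne', Real.log_div h.ne' hb.ne',
    Real.log_mul hc.ne' hb.ne']
  ring

theorem tsum_pi_prod {Y : Type*} : ∀ {n : ℕ} (F : Fin n → Y → ℝ≥0∞),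
    ∑' y : Fin n → Y, ∏ i, F i (y i) = ∏ i, ∑' t, F i t
  | 0, F => by simp
  | n + 1, F => by
    rw [← (Fin.consEquiv fun _ => Y).tsum_eq, ENNReal.tsum_prod']
    simp only [Fin.consEquiv_apply, Fin.prod_univ_succ, Fin.cons_zero, Fin.cons_succ,
      ENNReal.tsum_mul_left, ENNReal.tsum_mul_right]
    rw [tsum_pi_prod fun i => F i.succ]

theorem sum_pi_prod {ι Y : Type*} [Fintype ι] [DecidableEq ι] [Fintype Y] (F : ι → Y → ℝ) :
    ∑ y : ι → Y, ∏ i, F i (y i) = ∏ i, ∑ t, F i t := by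
  rw [Finset.prod_univ_sum, Fintype.piFinset_univ]

/-- The derandomization principle. Subprobability weights suffice because the values are
nonnegative, which allows for weights of the form 0 / 0 = 0. -/
theorem exists_ge_weighted_sum {ι : Type*} [Fintype ι] [Nonempty ι] {k c : ι → ℝ}
    (hk : ∀ i, 0 ≤ k i) (hk1 : ∑ i, k i ≤ 1) (hc : ∀ i, 0 ≤ c i) :
    ∃ i, ∑ j, k j * c j ≤ c i := by
  obtain ⟨i, hi⟩ := Finite.exists_max c
  refine ⟨i, ?_⟩
  calc ∑ j, k j * c j ≤ ∑ j, k j * c i :=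
        Finset.sum_le_sum fun j _ => mul_le_mul_of_nonneg_left (hi j) (hk j)
    _ = (∑ j, k j) * c i := by rw [Finset.sum_mul]
    _ ≤ c i := mul_le_of_le_one_left (hc i) hk1

/-- By Carathéodory, dim + 1 points always suffice, so the hull is a continuous image of a simplex
times a power of s. -/
theorem isCompact_convexHull_of_isCompact {E : Type*} [NormedAddCommGroup E] [NormedSpace ℝ E]
    [FiniteDimensional ℝ E] {s : Set E} (hs : IsCompact s) : IsCompact (convexHull ℝ s) := by
  classical
  set d := Module.finrank ℝ E + 1 with hd
  have hc : IsCompact ((fun p : (Fin d → ℝ) × (Fin d → E) => ∑ i, p.1 i • p.2 i) ''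
      (stdSimplex ℝ (Fin d) ×ˢ Set.univ.pi fun _ => s)) := by
    refine ((isCompact_stdSimplex ℝ (Fin d)).prod (isCompact_univ_pi fun _ => hs)).image ?_
    fun_prop
  convert hc using 1
  ext x
  constructor
  · intro hx
    obtain ⟨ι, _, z, w, hz, hi, hw, hw1, hwx⟩ := eq_pos_convex_span_of_mem_convexHull hx
    have hcard : Fintype.card ι ≤ Fintype.card (Fin d) := by
      rw [Fintype.card_fin, hd]
      have := hi.card_le_finrank_succ
      have h2 := Submodule.finrank_le (vectorSpan ℝ (Set.range z))
      omega
    obtain ⟨e⟩ := Function.Embedding.nonempty_of_card_le hcard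
    have hne : Nonempty ι := by
      by_contra h
      rw [not_nonempty_iff] at h
      simp at hw1
    have hd : ∀ i, (if h : ∃ i', e i' = e i then w h.choose else 0) = w i := fun i => by
      have h : ∃ i', e i' = e i := ⟨i, rfl⟩
      rw [dif_pos h, e.injective h.choose_spec]
    -- Shorter combinations are padded with weight zero; the padding points are values of z, hence
    -- still in s.
    refine ⟨(fun j => if h : ∃ i, e i = j then w h.choose else 0,
      fun j => z (Function.invFun e j)), ⟨⟨fun j => ?_, ?_⟩, fun j _ => ?_⟩, ?_⟩
    · dsimp only
      split_ifs with h
      exacts [(hw _).le, le_rfl]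
    · rw [← hw1]
      exact (Fintype.sum_of_injective e e.injective _ _ (fun j hj => dif_neg hj)
        fun i => (hd i).symm).symm
    · exact hz ⟨_, rfl⟩
    · rw [← hwx]
      refine (Fintype.sum_of_injective e e.injective _ _ (fun j hj => ?_) fun i => ?_).symm
      · dsimp only
        rw [dif_neg (show ¬∃ i, e i = j from hj), zero_smul]
      · dsimp only
        rw [hd, Function.leftInverse_invFun e.injective]
  · rintro ⟨⟨w, z⟩, ⟨⟨hw, hw1⟩, hz⟩, rfl⟩
    exact (convex_convexHull ℝ s).sum_mem (fun i _ => hw i) hw1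
      fun i _ => subset_convexHull ℝ s (hz i trivial)

/-! ### The rate I(V;Y) - I(V;S) and its test laws -/

section Rate

variable {S X₁ X₂ Y V : Type*} [Fintype S] [Fintype X₁]

/-- Joint probability of the auxiliary letter `v` and the channel output `y`, for a law `r` of
state, auxiliary letter and first input, where the second input is the function `ξ` of the
auxiliary letter. -/
def outProb (W : X₁ → X₂ → S → PMF Y) (ξ : V → X₂) (r : S → V → X₁ → ℝ) (v : V) (y : Y) : ℝ :=
  ∑ s, ∑ x, r s v x * (W x (ξ v) s y).toReal

/-- Probability of an auxiliary letter. -/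
def auxProb (r : S → V → X₁ → ℝ) (v : V) : ℝ := ∑ s, ∑ x, r s v x

/-- The information quantity `I(V;Y) - I(V;S)`, in nats. -/
def rate [Fintype V] (Q : PMF S) (W : X₁ → X₂ → S → PMF Y) (ξ : V → X₂) (r : S → V → X₁ → ℝ) :
    ℝ :=
  ∑ v, (∑' y, outProb W ξ r v y *
      Real.log (outProb W ξ r v y / (auxProb r v * ∑ v', outProb W ξ r v' y))) -
    ∑ v, ∑ s, (∑ x, r s v x) * Real.log ((∑ x, r s v x) / (auxProb r v * (Q s).toReal))

/-- `r` is a law of state, auxiliary letter and first input such that the second input, the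
function `ξ` of the auxiliary letter, is independent of the state, which has law `Q`. -/
structure IsTestLaw [Fintype V] [DecidableEq X₂] (Q : PMF S) (ξ : V → X₂)
    (r : S → V → X₁ → ℝ) : Prop where
  nonneg : ∀ s v x, 0 ≤ r s v x
  total : ∑ s, ∑ v, ∑ x, r s v x = 1
  indep : ∀ s x₂, (∑ v, if ξ v = x₂ then ∑ x, r s v x else 0) =
    (Q s).toReal * ∑ s', ∑ v, if ξ v = x₂ then ∑ x, r s' v x else 0

theorem PMF.sum_toReal {A : Type*} [Fintype A] (p : PMF A) : ∑ a, (p a).toReal = 1 := by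
  rw [← ENNReal.toReal_sum fun a _ => p.apply_ne_top a, ← tsum_fintype (L := .unconditional A),
    p.tsum_coe, ENNReal.toReal_one]

theorem PMF.hasSum_toReal {A : Type*} (p : PMF A) : HasSum (fun a => (p a).toReal) 1 := by
  have := ENNReal.hasSum_toReal (f := p) (by rw [p.tsum_coe]; exact ENNReal.one_ne_top)
  rwa [← ENNReal.tsum_toReal_eq fun a => p.apply_ne_top a, p.tsum_coe, ENNReal.toReal_one] at this

theorem hasSum_outProb (W : X₁ → X₂ → S → PMF Y) (ξ : V → X₂) (r : S → V → X₁ → ℝ) (v : V) :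
    HasSum (outProb W ξ r v) (auxProb r v) := by
  refine hasSum_sum fun s _ => hasSum_sum fun x _ => ?_
  simpa using (PMF.hasSum_toReal (W x (ξ v) s)).mul_left (r s v x)

theorem outProb_nonneg {W : X₁ → X₂ → S → PMF Y} {ξ : V → X₂} {r : S → V → X₁ → ℝ}
    (hr : ∀ s v x, 0 ≤ r s v x) (v : V) (y : Y) : 0 ≤ outProb W ξ r v y :=
  Finset.sum_nonneg fun s _ => Finset.sum_nonneg fun x _ =>
    mul_nonneg (hr s v x) ENNReal.toReal_nonneg

theorem auxProb_nonneg {r : S → V → X₁ → ℝ} (hr : ∀ s v x, 0 ≤ r s v x) (v : V) :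
    0 ≤ auxProb r v :=
  Finset.sum_nonneg fun s _ => Finset.sum_nonneg fun x _ => hr s v x

theorem outProb_eq_zero {W : X₁ → X₂ → S → PMF Y} {ξ : V → X₂} {r : S → V → X₁ → ℝ}
    (hr : ∀ s v x, 0 ≤ r s v x) {v : V} (hv : auxProb r v = 0) (y : Y) :
    outProb W ξ r v y = 0 := by
  refine Finset.sum_eq_zero fun s _ => Finset.sum_eq_zero fun x _ => ?_
  have h1 := (Finset.sum_eq_zero_iff_of_nonneg
    fun s _ => Finset.sum_nonneg fun x _ => hr s v x).1 hv s (Finset.mem_univ s)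
  rw [(Finset.sum_eq_zero_iff_of_nonneg fun x _ => hr s v x).1 h1 x (Finset.mem_univ x), zero_mul]

variable [Fintype V]

theorem outProb_le_sum {W : X₁ → X₂ → S → PMF Y} {ξ : V → X₂} {r : S → V → X₁ → ℝ}
    (hr : ∀ s v x, 0 ≤ r s v x) (v : V) (y : Y) :
    outProb W ξ r v y ≤ ∑ v', outProb W ξ r v' y :=
  Finset.single_le_sum (f := fun v => outProb W ξ r v y)
    (fun v _ => outProb_nonneg hr v y) (Finset.mem_univ v)

theorem summable_sum_outProb (W : X₁ → X₂ → S → PMF Y) (ξ : V → X₂) (r : S → V → X₁ → ℝ) :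
    Summable fun y => ∑ v, outProb W ξ r v y :=
  summable_sum fun v _ => (hasSum_outProb W ξ r v).summable

theorem summable_outProb_mul_log (W : X₁ → X₂ → S → PMF Y) (ξ : V → X₂) {r : S → V → X₁ → ℝ}
    (hr : ∀ s v x, 0 ≤ r s v x) (v : V) : Summable fun y => outProb W ξ r v y *
      Real.log (outProb W ξ r v y / (auxProb r v * ∑ v', outProb W ξ r v' y)) := by
  rcases (auxProb_nonneg hr v).eq_or_lt with h | h
  · simp [outProb_eq_zero hr h.symm]
  · exact summable_mul_log_div h (outProb_nonneg hr v) (outProb_le_sum hr v)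
      (summable_sum_outProb W ξ r)

/-- The rate does not change under an embedding of the auxiliary alphabet into a larger one. -/
theorem rate_of_injective {V' : Type*} [Fintype V'] (Q : PMF S) (W : X₁ → X₂ → S → PMF Y)
    {ξ : V → X₂} {r : S → V → X₁ → ℝ} {ξ' : V' → X₂} {r' : S → V' → X₁ → ℝ} {e : V → V'}
    (he : Function.Injective e) (hξ : ∀ v, ξ' (e v) = ξ v) (hr : ∀ s v x, r' s (e v) x = r s v x)
    (h0 : ∀ s v' x, v' ∉ Set.range e → r' s v' x = 0) : rate Q W ξ' r' = rate Q W ξ r := by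
  have ho : ∀ v y, outProb W ξ r v y = outProb W ξ' r' (e v) y := fun v y => by
    simp [outProb, hξ, hr]
  have ho0 : ∀ v' ∉ Set.range e, ∀ y, outProb W ξ' r' v' y = 0 := fun v' hv y => by
    simp [outProb, h0 _ _ _ hv]
  have ha : ∀ v, auxProb r v = auxProb r' (e v) := fun v => by simp [auxProb, hr]
  have hs : ∀ y, ∑ v, outProb W ξ r v y = ∑ v', outProb W ξ' r' v' y := fun y =>
    Fintype.sum_of_injective e he _ _ (fun v' hv => ho0 v' hv y) fun v => ho v y
  unfold rate
  congr 1
  · refine (Fintype.sum_of_injective e he _ _ (fun v' hv => ?_) fun v => ?_).symm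
    · simp [ho0 v' hv]
    · simp only [ho, ha, ← hs]
  · refine (Fintype.sum_of_injective e he _ _ (fun v' hv => ?_) fun v => ?_).symm
    · simp [h0 _ _ _ hv]
    · simp only [ha, hr]

end Rate

/-! ### Agreement of the rate with I(U,X₂;Y) - I(U;S|X₂) -/

section Bridge

theorem PMF.map_toReal_eq_sum {A B : Type*} [Fintype A] [DecidableEq B] (p : PMF A) (f : A → B)
    (b : B) : (p.map f b).toReal = ∑ a, if b = f a then (p a).toReal else 0 := by
  rw [PMF.map_apply, tsum_fintype, ENNReal.toReal_sum]
  · refine Finset.sum_congr rfl fun a _ => ?_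
    by_cases h : b = f a <;> simp [h]
  · intro a _
    split_ifs
    exacts [p.apply_ne_top a, ENNReal.zero_ne_top]

theorem PMF.map_fst_toReal {A B : Type*} (p : PMF (A × B)) (a : A) :
    (p.map Prod.fst a).toReal = ∑' b, (p (a, b)).toReal := by
  classical
  rw [PMF.map_apply, ENNReal.tsum_prod', ← ENNReal.tsum_toReal_eq fun b => p.apply_ne_top _]
  congr 1
  rw [tsum_eq_single a]
  · simp
  · intro a' h
    simp [h.symm]

theorem PMF.map_snd_toReal {A B : Type*} [Fintype A] (p : PMF (A × B)) (b : B) :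
    (p.map Prod.snd b).toReal = ∑ a, (p (a, b)).toReal := by
  classical
  rw [PMF.map_apply, ENNReal.tsum_prod', tsum_fintype, ← ENNReal.toReal_sum
    fun a _ => p.apply_ne_top _]
  congr 1
  refine Finset.sum_congr rfl fun a _ => ?_
  rw [tsum_eq_single b]
  · simp
  · intro a' h
    simp [h.symm]

theorem tsum_fintype_prod {A B : Type*} [Fintype A] (f : A → B → ℝ) (h : ∀ a, Summable (f a)) :
    ∑' z : A × B, f z.1 z.2 = ∑ a, ∑' b, f a b := by
  have hs : Summable fun z : A × B => f z.1 z.2 :=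
    Summable.of_abs ((summable_prod_of_nonneg fun _ => abs_nonneg _).2
      ⟨fun a => (h a).abs, Summable.of_finite⟩)
  rw [hs.tsum_prod' h, tsum_fintype]

variable {S U X₁ X₂ Y : Type*} [Fintype S] [Fintype X₁] [Fintype X₂] [Fintype U]

/-- The law of state, auxiliary letters and first input of the joint law. -/
def inputLaw (Q : PMF S) (P₂ : PMF X₂) (K : S → X₂ → PMF (U × X₁)) (s : S) (v : U × X₂)
    (x : X₁) : ℝ :=
  (Q s).toReal * (P₂ v.2).toReal * (K s v.2 (v.1, x)).toReal

theorem jointLaw_map_output (Q : PMF S) (W : X₁ → X₂ → S → PMF Y) (P₂ : PMF X₂)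
    (K : S → X₂ → PMF (U × X₁)) (v : U × X₂) (y : Y) :
    ((jointLaw Q W P₂ K).map (fun (_, u, _, x₂, y) => ((u, x₂), y)) (v, y)).toReal =
      outProb W Prod.snd (inputLaw Q P₂ K) v y := by
  classical
  obtain ⟨u, x₂⟩ := v
  have h1 : ∀ (ux : U × X₁) (x₂' : X₂) (s : S), (PMF.map (fun y => ((ux.1, x₂'), y))
      (W ux.2 x₂' s)) ((u, x₂), y) = if ux.1 = u ∧ x₂' = x₂ then W ux.2 x₂ s y else 0 := by
    intro ux x₂' s
    rw [PMF.map_apply]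
    split_ifs with h
    · obtain ⟨rfl, rfl⟩ := h
      rw [tsum_eq_single y]
      · simp
      · intro y' hy; simp [hy.symm]
    · rw [ENNReal.tsum_eq_zero]
      intro y'
      rw [if_neg]
      simp only [Prod.mk.injEq]
      tauto
  have h2 : ((jointLaw Q W P₂ K).map (fun (_, u, _, x₂, y) => ((u, x₂), y)) ((u, x₂), y)) =
      ∑ s, Q s * (P₂ x₂ * ∑ x, K s x₂ (u, x) * W x x₂ s y) := by
    unfold jointLaw
    simp only [PMF.map_bind, PMF.map_comp, PMF.bind_apply, tsum_fintype, Function.comp_def, h1]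
    refine Finset.sum_congr rfl fun s _ => ?_
    congr 1
    rw [Finset.sum_eq_single x₂ (fun x₂' _ h => by simp [h]) (by simp), Fintype.sum_prod_type,
      Finset.sum_eq_single u (fun u' _ h => by simp [h]) (by simp)]
    simp
  rw [h2, ENNReal.toReal_sum]
  · refine Finset.sum_congr rfl fun s _ => ?_
    rw [ENNReal.toReal_mul, ENNReal.toReal_mul, ENNReal.toReal_sum]
    · simp only [inputLaw, ENNReal.toReal_mul, Finset.mul_sum, mul_assoc]
    · exact fun x _ => ENNReal.mul_ne_top (PMF.apply_ne_top _ _) (PMF.apply_ne_top _ _)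
  · refine fun s _ => ENNReal.mul_ne_top (PMF.apply_ne_top _ _)
      (ENNReal.mul_ne_top (PMF.apply_ne_top _ _) (ENNReal.sum_ne_top.2 fun x _ =>
        ENNReal.mul_ne_top (PMF.apply_ne_top _ _) (PMF.apply_ne_top _ _)))

theorem jointLaw_map_input (Q : PMF S) (W : X₁ → X₂ → S → PMF Y) (P₂ : PMF X₂)
    (K : S → X₂ → PMF (U × X₁)) (u : U) (s : S) (x₂ : X₂) :
    ((jointLaw Q W P₂ K).map (fun (s, u, _, x₂, _) => (u, s, x₂)) (u, s, x₂)).toReal =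
      ∑ x, inputLaw Q P₂ K s (u, x₂) x := by
  classical
  have h2 : ((jointLaw Q W P₂ K).map (fun (s, u, _, x₂, _) => (u, s, x₂)) (u, s, x₂)) =
      Q s * (P₂ x₂ * ∑ x, K s x₂ (u, x)) := by
    unfold jointLaw
    simp only [PMF.map_bind, PMF.map_comp, PMF.bind_apply, tsum_fintype, Function.comp_def]
    rw [Finset.sum_eq_single s (fun s' _ h => by simp [h.symm]) (by simp),
      Finset.sum_eq_single x₂ (fun x₂' _ h => by simp [h.symm]) (by simp), Fintype.sum_prod_type,
      Finset.sum_eq_single u (fun u' _ h => by simp [h.symm]) (by simp)]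
    simp
  rw [h2, ENNReal.toReal_mul, ENNReal.toReal_mul,
    ENNReal.toReal_sum fun x _ => PMF.apply_ne_top _ _]
  simp only [inputLaw, Finset.mul_sum, mul_assoc]

theorem inputLaw_nonneg (Q : PMF S) (P₂ : PMF X₂) (K : S → X₂ → PMF (U × X₁)) (s : S)
    (v : U × X₂) (x : X₁) : 0 ≤ inputLaw Q P₂ K s v x :=
  mul_nonneg (mul_nonneg ENNReal.toReal_nonneg ENNReal.toReal_nonneg) ENNReal.toReal_nonneg

theorem sum_inputLaw (Q : PMF S) (P₂ : PMF X₂) (K : S → X₂ → PMF (U × X₁)) (s : S) (x₂ : X₂) :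
    ∑ u, ∑ x, inputLaw Q P₂ K s (u, x₂) x = (Q s).toReal * (P₂ x₂).toReal := by
  simp only [inputLaw, ← Finset.mul_sum]
  rw [← Fintype.sum_prod_type' (f := fun u x => (K s x₂ (u, x)).toReal), PMF.sum_toReal, mul_one]

theorem isTestLaw_inputLaw [DecidableEq X₂] (Q : PMF S) (P₂ : PMF X₂)
    (K : S → X₂ → PMF (U × X₁)) : IsTestLaw Q Prod.snd (inputLaw Q P₂ K) where
  nonneg := inputLaw_nonneg Q P₂ K
  total := by
    simp only [Fintype.sum_prod_type_right, sum_inputLaw, ← Finset.mul_sum, PMF.sum_toReal,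
      mul_one]
  indep s x₂ := by
    have : ∀ s, (∑ v : U × X₂, if v.2 = x₂ then ∑ x, inputLaw Q P₂ K s v x else 0) =
        (Q s).toReal * (P₂ x₂).toReal := fun s => by
      rw [Fintype.sum_prod_type_right, ← sum_inputLaw Q P₂ K]
      rw [Finset.sum_eq_single x₂ (fun x₂' _ h => by simp [h]) (by simp)]
      simp
    simp only [this, ← Finset.sum_mul, PMF.sum_toReal, one_mul]

/-- With V = (U, X₂) the first terms agree. In the second, the law of (S, X₂) is a product, so P₂
cancels inside the logarithm and I(U;S|X₂) becomes I(V;S). Division by log 2 passes from nats to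
bits. -/
theorem rateFunctional_jointLaw (Q : PMF S) (W : X₁ → X₂ → S → PMF Y) (P₂ : PMF X₂)
    (K : S → X₂ → PMF (U × X₁)) :
    rateFunctional (jointLaw Q W P₂ K) =
      rate Q W Prod.snd (inputLaw Q P₂ K) / Real.log 2 := by
  classical
  have hr := inputLaw_nonneg Q P₂ K
  rw [rateFunctional, rate, sub_div]
  congr 1
  · unfold mutualInfo
    simp only [PMF.map_fst_toReal, PMF.map_snd_toReal]
    have h1 : ∀ z : (U × X₂) × Y,
        ((jointLaw Q W P₂ K).map (fun (_, u, _, x₂, y) => ((u, x₂), y)) z).toReal =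
        outProb W Prod.snd (inputLaw Q P₂ K) z.1 z.2 :=
      fun z => jointLaw_map_output Q W P₂ K z.1 z.2
    simp only [h1, (hasSum_outProb W Prod.snd (inputLaw Q P₂ K) _).tsum_eq]
    have hs : ∀ v : U × X₂, Summable fun y => outProb W Prod.snd (inputLaw Q P₂ K) v y *
        Real.logb 2 (outProb W Prod.snd (inputLaw Q P₂ K) v y / (auxProb (inputLaw Q P₂ K) v *
          ∑ v', outProb W Prod.snd (inputLaw Q P₂ K) v' y)) := fun v => by
      simp only [Real.logb, ← mul_div_assoc]
      exact (summable_outProb_mul_log W Prod.snd hr v).div_const _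
    rw [tsum_fintype_prod (fun v y => outProb W Prod.snd (inputLaw Q P₂ K) v y *
        Real.logb 2 (outProb W Prod.snd (inputLaw Q P₂ K) v y / (auxProb (inputLaw Q P₂ K) v *
          ∑ v', outProb W Prod.snd (inputLaw Q P₂ K) v' y))) hs, Finset.sum_div]
    refine Finset.sum_congr rfl fun v _ => ?_
    rw [← tsum_div_const]
    simp only [Real.logb, mul_div_assoc]
  · unfold condMutualInfo
    have h1 : ∀ z : U × S × X₂,
        ((jointLaw Q W P₂ K).map (fun (s, u, _, x₂, _) => (u, s, x₂)) z).toReal =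
        ∑ x, inputLaw Q P₂ K z.2.1 (z.1, z.2.2) x :=
      fun z => jointLaw_map_input Q W P₂ K z.1 z.2.1 z.2.2
    have hA : ∀ x₂ : X₂, (∑ a : U × S × X₂, if x₂ = a.2.2 then
        ∑ x, inputLaw Q P₂ K a.2.1 (a.1, a.2.2) x else 0) = (P₂ x₂).toReal := by
      intro x₂
      simp only [Fintype.sum_prod_type, Finset.sum_ite_eq, Finset.mem_univ, if_true]
      rw [Finset.sum_comm]
      simp only [sum_inputLaw, ← Finset.sum_mul, PMF.sum_toReal, one_mul]
    have hB : ∀ (u : U) (x₂ : X₂), (∑ a : U × S × X₂, if (u, x₂) = (a.1, a.2.2) then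
        ∑ x, inputLaw Q P₂ K a.2.1 (a.1, a.2.2) x else 0) =
          auxProb (inputLaw Q P₂ K) (u, x₂) := by
      intro u x₂
      rw [Fintype.sum_prod_type, Finset.sum_eq_single u (fun u' _ h => by simp [h.symm]) (by simp)]
      simp [Fintype.sum_prod_type, auxProb]
    simp only [PMF.map_snd_toReal]
    simp only [PMF.map_toReal_eq_sum, h1, hA, hB, sum_inputLaw]
    rw [tsum_fintype, Fintype.sum_prod_type, Fintype.sum_prod_type, Finset.sum_div]
    refine Finset.sum_congr rfl fun u _ => ?_
    rw [Fintype.sum_prod_type_right, Finset.sum_div]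
    refine Finset.sum_congr rfl fun x₂ _ => ?_
    rw [Finset.sum_div]
    refine Finset.sum_congr rfl fun s _ => ?_
    dsimp only
    rw [Real.logb, ← mul_div_assoc]
    rcases eq_or_ne (P₂ x₂).toReal 0 with h | h
    · simp [inputLaw, h]
    · congr 3
      rw [← mul_assoc, mul_div_mul_right _ _ h]

theorem PMF.exists_toReal_eq {A : Type*} [Fintype A] {f : A → ℝ} (h0 : ∀ a, 0 ≤ f a)
    (h1 : ∑ a, f a = 1) : ∃ p : PMF A, ∀ a, (p a).toReal = f a := by
  refine ⟨PMF.ofFintype (fun a => ENNReal.ofReal (f a)) ?_, fun a => ?_⟩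
  · rw [← ENNReal.ofReal_sum_of_nonneg fun a _ => h0 a, h1, ENNReal.ofReal_one]
  · rw [PMF.ofFintype_apply, ENNReal.toReal_ofReal (h0 a)]

/-- Every test law is the input law of some `P₂` and `K`, up to an embedding of its auxiliary
alphabet. -/
theorem IsTestLaw.exists_rateFunctional_eq {V : Type*} [Fintype V] [DecidableEq X₂] [Nonempty X₁]
    {Q : PMF S} {ξ : V → X₂} {r : S → V → X₁ → ℝ} (h : IsTestLaw Q ξ r)
    (W : X₁ → X₂ → S → PMF Y) :
    ∃ (k : ℕ) (P₂ : PMF X₂) (K : S → X₂ → PMF (Fin k × X₁)),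
      rateFunctional (jointLaw Q W P₂ K) = rate Q W ξ r / Real.log 2 := by
  classical
  set p : X₂ → ℝ := fun x₂ => ∑ s, ∑ v, if ξ v = x₂ then ∑ x, r s v x else 0 with hp
  have hin : ∀ s v, 0 ≤ ∑ x, r s v x := fun s v => Finset.sum_nonneg fun x _ => h.nonneg s v x
  have hite : ∀ s v x₂, 0 ≤ if ξ v = x₂ then ∑ x, r s v x else 0 := fun s v x₂ => by
    split_ifs
    exacts [hin s v, le_rfl]
  have hp0 : ∀ x₂, 0 ≤ p x₂ := fun x₂ =>
    Finset.sum_nonneg fun s _ => Finset.sum_nonneg fun v _ => hite s v x₂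
  have hp1 : ∑ x₂, p x₂ = 1 := by
    rw [← h.total, hp, Finset.sum_comm]
    refine Finset.sum_congr rfl fun s _ => ?_
    rw [Finset.sum_comm]
    simp
  obtain ⟨P₂, hP₂⟩ := PMF.exists_toReal_eq hp0 hp1
  set e : V ≃ Fin (Fintype.card V) := Fintype.equivFin V
  have hne : Nonempty V := by
    by_contra hV
    rw [not_nonempty_iff] at hV
    have := h.total
    simp at this
  -- The conditional law of (V, X₁) given state and second input. Independence makes the mass of the
  -- condition a product; where it is zero, any law will do.
  have hq : ∀ s x₂, ∃ q : PMF (Fin (Fintype.card V) × X₁), ∀ u x,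
      (Q s).toReal * p x₂ * (q (u, x)).toReal = if ξ (e.symm u) = x₂ then r s (e.symm u) x else 0 := by
    intro s x₂
    have hsum : ∑ u, ∑ x, (if ξ (e.symm u) = x₂ then r s (e.symm u) x else 0) =
        (Q s).toReal * p x₂ := by
      rw [← h.indep s x₂, ← e.symm.sum_comp]
      refine Finset.sum_congr rfl fun u _ => ?_
      split_ifs <;> simp
    rcases eq_or_ne ((Q s).toReal * p x₂) 0 with h0 | h0
    · have hz : ∀ u x, (if ξ (e.symm u) = x₂ then r s (e.symm u) x else 0) = 0 := by
        intro u x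
        have hn : ∀ u x, 0 ≤ if ξ (e.symm u) = x₂ then r s (e.symm u) x else 0 := fun u x => by
          split_ifs
          exacts [h.nonneg _ _ _, le_rfl]
        rw [h0] at hsum
        have h1 := (Finset.sum_eq_zero_iff_of_nonneg
          fun u _ => Finset.sum_nonneg fun x _ => hn u x).1 hsum u (Finset.mem_univ u)
        exact (Finset.sum_eq_zero_iff_of_nonneg fun x _ => hn u x).1 h1 x (Finset.mem_univ x)
      have : Nonempty (Fin (Fintype.card V) × X₁) := ⟨(e hne.some, Classical.arbitrary X₁)⟩
      exact ⟨PMF.pure (Classical.arbitrary _), fun u x => by rw [h0, hz, zero_mul]⟩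
    · obtain ⟨q, hq⟩ := PMF.exists_toReal_eq (A := Fin (Fintype.card V) × X₁)
        (f := fun z => (if ξ (e.symm z.1) = x₂ then r s (e.symm z.1) z.2 else 0) /
          ((Q s).toReal * p x₂)) (fun z => by
            refine div_nonneg ?_ (mul_nonneg ENNReal.toReal_nonneg (hp0 _))
            split_ifs
            exacts [h.nonneg _ _ _, le_rfl]) (by
            rw [← Finset.sum_div, Fintype.sum_prod_type, hsum, div_self h0])
      exact ⟨q, fun u x => by rw [hq, mul_div_cancel₀ _ h0]⟩
  choose K hK using hq
  refine ⟨_, P₂, K, ?_⟩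
  rw [rateFunctional_jointLaw]
  congr 1
  -- Pairs off the graph of ξ have mass zero, so V embeds as that graph.
  refine rate_of_injective Q W (e := fun v => (e v, ξ v)) (fun v v' hv => ?_) (fun v => rfl) ?_ ?_
  · simpa using congrArg Prod.fst hv
  · intro s v x
    simp [inputLaw, hP₂, hK]
  · rintro s ⟨u, x₂⟩ x hv
    simp only [inputLaw, hP₂, hK]
    rw [if_neg]
    intro hu
    exact hv ⟨e.symm u, by simp [hu]⟩

end Bridge

/-! ### Attainment of the maximum by compactness -/

section Maximum

variable {S X₁ X₂ Y V : Type*} [Fintype S] [Fintype X₁] [Fintype X₂] [Fintype V]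

/-- A finite dominating measure of the channel. -/
def domMass (W : X₁ → X₂ → S → PMF Y) (y : Y) : ℝ :=
  ∑ z : X₂ × S × X₁, (W z.2.2 z.1 z.2.1 y).toReal

/-- The density of the channel with respect to the dominating measure. -/
def chanDensity (W : X₁ → X₂ → S → PMF Y) (z : X₂ × S × X₁) (y : Y) : ℝ :=
  (W z.2.2 z.1 z.2.1 y).toReal / domMass W y

/-- The density of the output when the inputs have law `p`. -/
def outDensity (W : X₁ → X₂ → S → PMF Y) (p : X₂ × S × X₁ → ℝ) (y : Y) : ℝ :=
  ∑ z, p z * chanDensity W z y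

/-- The entropy of the output relative to the dominating measure. -/
def outEntropy (W : X₁ → X₂ → S → PMF Y) (p : X₂ × S × X₁ → ℝ) : ℝ :=
  ∑' y, domMass W y * Real.negMulLog (outDensity W p y)

/-- The divergence of the state law under `p` from `Q`. -/
def stateDiv (Q : PMF S) (p : X₂ × S × X₁ → ℝ) : ℝ :=
  ∑ s, (-Real.negMulLog (∑ x₂, ∑ x, p (x₂, s, x)) -
    (∑ x₂, ∑ x, p (x₂, s, x)) * Real.log (Q s).toReal)

variable (Q : PMF S) (W : X₁ → X₂ → S → PMF Y)

theorem domMass_nonneg (y : Y) : 0 ≤ domMass W y :=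
  Finset.sum_nonneg fun _ _ => ENNReal.toReal_nonneg

theorem summable_domMass : Summable (domMass W) :=
  summable_sum fun z _ => (PMF.hasSum_toReal (W z.2.2 z.1 z.2.1)).summable

theorem chanDensity_nonneg (z : X₂ × S × X₁) (y : Y) : 0 ≤ chanDensity W z y :=
  div_nonneg ENNReal.toReal_nonneg (domMass_nonneg W y)

theorem domMass_mul_chanDensity (z : X₂ × S × X₁) (y : Y) :
    domMass W y * chanDensity W z y = (W z.2.2 z.1 z.2.1 y).toReal := by
  rcases eq_or_ne (domMass W y) 0 with h | h
  · have := (Finset.sum_eq_zero_iff_of_nonneg fun z _ => ENNReal.toReal_nonneg).1 h z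
      (Finset.mem_univ z)
    rw [h, zero_mul, this]
  · rw [chanDensity, mul_div_cancel₀ _ h]

theorem chanDensity_le_one (z : X₂ × S × X₁) (y : Y) : chanDensity W z y ≤ 1 :=
  div_le_one_of_le₀ (Finset.single_le_sum (f := fun z : X₂ × S × X₁ => (W z.2.2 z.1 z.2.1 y).toReal)
    (fun _ _ => ENNReal.toReal_nonneg) (Finset.mem_univ z)) (domMass_nonneg W y)

variable {p : X₂ × S × X₁ → ℝ}

theorem outDensity_nonneg (hp : p ∈ stdSimplex ℝ (X₂ × S × X₁)) (y : Y) : 0 ≤ outDensity W p y :=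
  Finset.sum_nonneg fun z _ => mul_nonneg (hp.1 z) (chanDensity_nonneg W z y)

theorem outDensity_le_one (hp : p ∈ stdSimplex ℝ (X₂ × S × X₁)) (y : Y) :
    outDensity W p y ≤ 1 := by
  rw [← hp.2]
  exact Finset.sum_le_sum fun z _ => mul_le_of_le_one_right (hp.1 z) (chanDensity_le_one W z y)

theorem abs_domMass_mul_negMulLog_le (hp : p ∈ stdSimplex ℝ (X₂ × S × X₁)) (y : Y) :
    ‖domMass W y * Real.negMulLog (outDensity W p y)‖ ≤ domMass W y := by
  have h := abs_mul_log_div_le (outDensity_nonneg W hp y) (outDensity_le_one W hp y)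
  rw [div_one] at h
  rw [Real.norm_eq_abs, abs_mul, abs_of_nonneg (domMass_nonneg W y), Real.negMulLog, neg_mul,
    abs_neg]
  exact mul_le_of_le_one_right (domMass_nonneg W y) h

theorem summable_outEntropy (hp : p ∈ stdSimplex ℝ (X₂ × S × X₁)) :
    Summable fun y => domMass W y * Real.negMulLog (outDensity W p y) :=
  Summable.of_norm_bounded (summable_domMass W) (abs_domMass_mul_negMulLog_le W hp)

/-- Densities with respect to the dominating measure lie in [0,1], where |t log t| ≤ 1, so the
series is dominated by `domMass` uniformly in the input law. This handles infinite output alphabets.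
-/
theorem continuousOn_outEntropy : ContinuousOn (outEntropy W) (stdSimplex ℝ (X₂ × S × X₁)) := by
  refine continuousOn_tsum (fun y => Continuous.continuousOn ?_) (summable_domMass W)
    fun y p hp => abs_domMass_mul_negMulLog_le W hp y
  have : Continuous fun p : X₂ × S × X₁ → ℝ => outDensity W p y := by
    unfold outDensity; fun_prop
  exact continuous_const.mul (Real.continuous_negMulLog.comp this)

theorem continuous_stateDiv : Continuous (stateDiv (X₁ := X₁) (X₂ := X₂) Q) := by
  unfold stateDiv
  refine continuous_finsetSum _ fun s _ => ?_
  have : Continuous fun p : X₂ × S × X₁ → ℝ => ∑ x₂, ∑ x, p (x₂, s, x) := by fun_prop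
  exact (Real.continuous_negMulLog.comp this).neg.sub (this.mul continuous_const)

section Mixture

variable {W} {Q} {c : V → ℝ} {q : V → X₂ × S × X₁ → ℝ} {ξ : V → X₂} {r : S → V → X₁ → ℝ}

/-- The rate of a mixture of laws with constant second input. -/
theorem rate_eq_of_mixture (hc : ∀ v, 0 ≤ c v) (hc1 : ∑ v, c v = 1)
    (hq : ∀ v, q v ∈ stdSimplex ℝ (X₂ × S × X₁)) (hξ : ∀ v z, z.1 ≠ ξ v → q v z = 0)
    (hr : ∀ s v x, r s v x = c v * q v (ξ v, s, x))
    (hQ : ∀ s v, (Q s).toReal = 0 → ∑ x, r s v x = 0) :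
    rate Q W ξ r = outEntropy W (∑ v, c v • q v) +
      ∑ v, c v * (-outEntropy W (q v) - stateDiv Q (q v)) := by
  have hsum : ∀ (v : V) (g : X₂ × S × X₁ → ℝ),
      ∑ z, q v z * g z = ∑ s, ∑ x, q v (ξ v, s, x) * g (ξ v, s, x) := by
    intro v g
    rw [Fintype.sum_prod_type, Finset.sum_eq_single (ξ v) (fun x₂ _ h => by
      refine Finset.sum_eq_zero fun z _ => ?_
      rw [hξ v (x₂, z) h, zero_mul]) (by simp), Fintype.sum_prod_type]
  have hmix : (∑ v, c v • q v) ∈ stdSimplex ℝ (X₂ × S × X₁) :=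
    (convex_stdSimplex ℝ _).sum_mem (fun v _ => hc v) hc1 fun v _ => hq v
  have hout : ∀ v y, outProb W ξ r v y = c v * (domMass W y * outDensity W (q v) y) := by
    intro v y
    simp only [outProb, hr, outDensity, Finset.mul_sum]
    rw [← Finset.mul_sum, ← Finset.mul_sum]
    have := hsum v fun z => (W z.2.2 z.1 z.2.1 y).toReal
    simp only at this
    simp only [mul_assoc, ← Finset.mul_sum]
    rw [← this]
    congr 1
    rw [Finset.mul_sum]
    refine Finset.sum_congr rfl fun z _ => ?_
    rw [← domMass_mul_chanDensity W z y]; ring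
  have haux : ∀ v, auxProb r v = c v := by
    intro v
    have := hsum v 1
    simp only [Pi.one_apply, mul_one] at this
    simp only [auxProb, hr, ← Finset.mul_sum]
    rw [← this, (hq v).2, mul_one]
  have hbar : ∀ y, outDensity W (∑ v, c v • q v) y = ∑ v, c v * outDensity W (q v) y := by
    intro y
    simp only [outDensity, Finset.sum_apply, Pi.smul_apply, smul_eq_mul, Finset.sum_mul,
      Finset.mul_sum]
    rw [Finset.sum_comm]
    simp only [mul_assoc]
  have hsumout : ∀ y, ∑ v, outProb W ξ r v y =
      domMass W y * outDensity W (∑ v, c v • q v) y := by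
    intro y
    rw [hbar, Finset.mul_sum]
    exact Finset.sum_congr rfl fun v _ => by rw [hout]; ring
  have hr0 : ∀ s v x, 0 ≤ r s v x := fun s v x => by
    rw [hr]; exact mul_nonneg (hc v) ((hq v).1 _)
  -- Weight and dominating mass cancel in the quotient. The remaining ratio of densities separates
  -- the entropy of the mixture from that of the component.
  have hterm : ∀ v y, outProb W ξ r v y *
      Real.log (outProb W ξ r v y / (auxProb r v * ∑ v', outProb W ξ r v' y)) =
      -(c v * outDensity W (q v) y) * (domMass W y *
        Real.log (outDensity W (∑ v, c v • q v) y)) -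
        c v * (domMass W y * Real.negMulLog (outDensity W (q v) y)) := by
    intro v y
    rw [hsumout, hout, haux, Real.negMulLog]
    rcases (hc v).eq_or_lt with h | h1
    · simp [← h]
    rcases (domMass_nonneg W y).eq_or_lt with h | h2
    · simp [← h]
    rcases (outDensity_nonneg W (hq v) y).eq_or_lt with h | h3
    · simp [← h]
    have h4 : 0 < outDensity W (∑ v, c v • q v) y := by
      rw [hbar]
      exact (mul_pos h1 h3).trans_le (Finset.single_le_sum
        (f := fun v => c v * outDensity W (q v) y)
        (fun v _ => mul_nonneg (hc v) (outDensity_nonneg W (hq v) y)) (Finset.mem_univ v))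
    rw [show c v * (domMass W y * outDensity W (q v) y) /
      (c v * (domMass W y * outDensity W (∑ v, c v • q v) y)) =
      outDensity W (q v) y / outDensity W (∑ v, c v • q v) y by field_simp,
      Real.log_div h3.ne' h4.ne']
    ring
  unfold rate
  rw [← Summable.tsum_finsetSum fun v _ => summable_outProb_mul_log W ξ hr0 v]
  have hI : ∑' y, ∑ v, outProb W ξ r v y *
      Real.log (outProb W ξ r v y / (auxProb r v * ∑ v', outProb W ξ r v' y)) =
      outEntropy W (∑ v, c v • q v) - ∑ v, c v * outEntropy W (q v) := by
    simp only [hterm, Finset.sum_sub_distrib]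
    have : ∀ y, ∑ v, -(c v * outDensity W (q v) y) * (domMass W y *
        Real.log (outDensity W (∑ v, c v • q v) y)) =
        domMass W y * Real.negMulLog (outDensity W (∑ v, c v • q v) y) := by
      intro y
      rw [← Finset.sum_mul, Finset.sum_neg_distrib, ← hbar, Real.negMulLog]
      ring
    simp only [this]
    rw [(summable_outEntropy W hmix).tsum_sub
      (summable_sum fun v _ => (summable_outEntropy W (hq v)).mul_left _),
      Summable.tsum_finsetSum fun v _ => (summable_outEntropy W (hq v)).mul_left _]
    simp only [tsum_mul_left]
    rfl
  have hD : ∀ v, ∑ s, (∑ x, r s v x) *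
      Real.log ((∑ x, r s v x) / (auxProb r v * (Q s).toReal)) = c v * stateDiv Q (q v) := by
    intro v
    rw [stateDiv, Finset.mul_sum]
    refine Finset.sum_congr rfl fun s _ => ?_
    have h1 : ∑ x₂, ∑ x, q v (x₂, s, x) = ∑ x, q v (ξ v, s, x) :=
      Finset.sum_eq_single (ξ v) (fun x₂ _ h => Finset.sum_eq_zero fun x _ => hξ v _ h) (by simp)
    have h2 : ∑ x, r s v x = c v * ∑ x, q v (ξ v, s, x) := by
      simp only [hr, Finset.mul_sum]
    have h3 := hQ s v
    rw [h1, haux, h2, Real.negMulLog]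
    rw [h2] at h3
    have hn : 0 ≤ ∑ x, q v (ξ v, s, x) := Finset.sum_nonneg fun x _ => (hq v).1 _
    rcases eq_or_ne (c v) 0 with h | h4
    · simp [h]
    rcases hn.eq_or_lt with h | h5
    · simp [← h]
    -- Splitting the logarithm would fail at Q s = 0; `hQ` rules this out wherever the law has mass.
    have h6 : (Q s).toReal ≠ 0 := fun h => (mul_ne_zero h4 h5.ne') (h3 h)
    rw [mul_div_mul_left _ _ h4, Real.log_div h5.ne' h6]
    ring
  rw [hI, Finset.sum_congr rfl fun v _ => hD v]
  simp only [mul_sub, Finset.sum_sub_distrib, mul_neg, Finset.sum_neg_distrib]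
  ring

theorem sum_mixture [DecidableEq X₂] (hξ : ∀ v z, z.1 ≠ ξ v → q v z = 0)
    (hr : ∀ s v x, r s v x = c v * q v (ξ v, s, x)) (s : S) (x₂ : X₂) :
    ∑ x, (∑ v, c v • q v) (x₂, s, x) = ∑ v, if ξ v = x₂ then ∑ x, r s v x else 0 := by
  simp only [Finset.sum_apply, Pi.smul_apply, smul_eq_mul]
  rw [Finset.sum_comm]
  refine Finset.sum_congr rfl fun v _ => ?_
  split_ifs with h
  · subst h; simp only [hr]
  · exact Finset.sum_eq_zero fun x _ => by rw [hξ v _ fun h' => h h'.symm, mul_zero]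

end Mixture

variable (X₁ X₂ S) in
/-- The input laws under which the second input is constant. -/
def constInputLaws : Set (X₂ × S × X₁ → ℝ) :=
  stdSimplex ℝ (X₂ × S × X₁) ∩ ⋃ x₂ : X₂, {p | ∀ z, z.1 ≠ x₂ → p z = 0}

/-- The pairs of input laws and negative conditional information terms of test laws, the
constraint on the second input left aside. -/
def mixturePoints : Set ((X₂ × S × X₁ → ℝ) × ℝ) :=
  convexHull ℝ ((fun p => (p, -outEntropy W p - stateDiv Q p)) '' constInputLaws S X₁ X₂)

/-- The independence constraint for the second input. -/
def indepPoints : Set ((X₂ × S × X₁ → ℝ) × ℝ) :=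
  {p | ∀ s x₂, ∑ x, p.1 (x₂, s, x) = (Q s).toReal * ∑ s', ∑ x, p.1 (x₂, s', x)}

/-- Laws with constant second input form a closed subset of the simplex (a finite union over x₂),
and the graph of a continuous function over a compact set is compact. The hull already contains
mixtures of every finite size. -/
theorem isCompact_mixturePoints : IsCompact (mixturePoints Q W) := by
  have h1 : IsCompact (constInputLaws S X₁ X₂) := by
    refine (isCompact_stdSimplex ℝ (X₂ × S × X₁)).inter_right (isClosed_iUnion_of_finite fun x₂ => ?_)
    simp only [Set.ofPred_forall]
    exact isClosed_iInter fun z => isClosed_iInter fun _ =>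
      isClosed_eq (continuous_apply z) continuous_const
  refine isCompact_convexHull_of_isCompact (h1.image_of_continuousOn ?_)
  exact continuousOn_id.prodMk
    (((continuousOn_outEntropy W).mono fun _ h => h.1).neg.sub (continuous_stateDiv Q).continuousOn)

theorem isClosed_indepPoints : IsClosed (indepPoints (X₁ := X₁) (X₂ := X₂) Q) := by
  simp only [indepPoints, Set.ofPred_forall]
  exact isClosed_iInter fun s => isClosed_iInter fun x₂ => isClosed_eq (by fun_prop) (by fun_prop)

theorem fst_mem_of_mem_mixturePoints {p : (X₂ × S × X₁ → ℝ) × ℝ} (hp : p ∈ mixturePoints Q W) :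
    p.1 ∈ stdSimplex ℝ (X₂ × S × X₁) := by
  have hc : Convex ℝ (LinearMap.fst ℝ (X₂ × S × X₁ → ℝ) ℝ ⁻¹' stdSimplex ℝ (X₂ × S × X₁)) :=
    (convex_stdSimplex ℝ _).linear_preimage _
  refine convexHull_min ?_ hc hp
  rintro _ ⟨q, hq, rfl⟩
  exact hq.1

variable {Q}

/-- Conditioning on V = v gives a law with constant second input ξ v; the test law is the mixture of
these with weights `auxProb r v`. -/
theorem IsTestLaw.exists_mixturePoint [Nonempty S] [Nonempty X₁] [DecidableEq X₂] {ξ : V → X₂}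
    {r : S → V → X₁ → ℝ} (h : IsTestLaw Q ξ r) : ∃ p ∈ mixturePoints Q W ∩ indepPoints Q,
      rate Q W ξ r = outEntropy W p.1 + p.2 := by
  classical
  have haux : ∀ v, 0 ≤ auxProb r v := auxProb_nonneg h.nonneg
  have htot : ∑ v, auxProb r v = 1 := by
    rw [← h.total, Finset.sum_comm]; rfl
  have hex : ∀ v, ∃ q ∈ stdSimplex ℝ (X₂ × S × X₁), (∀ z, z.1 ≠ ξ v → q z = 0) ∧
      ∀ s x, r s v x = auxProb r v * q (ξ v, s, x) := by
    intro v
    rcases eq_or_ne (auxProb r v) 0 with h0 | h0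
    · have hz : ∀ s x, r s v x = 0 := by
        intro s x
        have h1 := (Finset.sum_eq_zero_iff_of_nonneg
          fun s _ => Finset.sum_nonneg fun x _ => h.nonneg s v x).1 h0 s (Finset.mem_univ s)
        exact (Finset.sum_eq_zero_iff_of_nonneg fun x _ => h.nonneg s v x).1 h1 x
          (Finset.mem_univ x)
      -- An auxiliary letter of probability zero receives an arbitrary point mass compatible with ξ
      -- v.
      refine ⟨Pi.single (ξ v, Classical.arbitrary S, Classical.arbitrary X₁) 1,
        single_mem_stdSimplex _ _, fun z hz => ?_, fun s x => by rw [h0, hz, zero_mul]⟩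
      rw [Pi.single_eq_of_ne]
      rintro rfl
      exact hz rfl
    · refine ⟨fun z => if z.1 = ξ v then r z.2.1 v z.2.2 / auxProb r v else 0, ⟨fun z => ?_, ?_⟩,
        fun z hz => if_neg hz, fun s x => ?_⟩
      · dsimp only
        split_ifs
        exacts [div_nonneg (h.nonneg _ _ _) (haux v), le_rfl]
      · rw [Fintype.sum_prod_type, Finset.sum_eq_single (ξ v) (fun x₂ _ h => by simp [h])
          (by simp), Fintype.sum_prod_type]
        simp only [if_true, ← Finset.sum_div]
        exact div_self h0
      · simp only [if_true]
        rw [mul_div_cancel₀ _ h0]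
  choose q hq hξ hr using hex
  refine ⟨(∑ v, auxProb r v • q v, ∑ v, auxProb r v * (-outEntropy W (q v) - stateDiv Q (q v))),
    ⟨?_, fun s x₂ => ?_⟩, ?_⟩
  · have := (convex_convexHull ℝ ((fun p => (p, -outEntropy W p - stateDiv Q p)) ''
      constInputLaws S X₁ X₂)).sum_mem (t := Finset.univ) (w := auxProb r)
      (z := fun v => (q v, -outEntropy W (q v) - stateDiv Q (q v))) (fun v _ => haux v) htot
      fun v _ => subset_convexHull ℝ _ ⟨q v, ⟨hq v, Set.mem_iUnion.2 ⟨ξ v, hξ v⟩⟩, rfl⟩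
    have e1 := Prod.fst_sum (s := Finset.univ)
      (f := fun v => auxProb r v • (q v, -outEntropy W (q v) - stateDiv Q (q v)))
    have e2 := Prod.snd_sum (s := Finset.univ)
      (f := fun v => auxProb r v • (q v, -outEntropy W (q v) - stateDiv Q (q v)))
    have he : (∑ v, auxProb r v • q v,
        ∑ v, auxProb r v * (-outEntropy W (q v) - stateDiv Q (q v))) =
        ∑ v, auxProb r v • (q v, -outEntropy W (q v) - stateDiv Q (q v)) :=
      Prod.ext e1.symm e2.symm
    rw [he]
    exact this
  · have hm := sum_mixture hξ (fun s v x => hr v s x)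
    simp only [hm]
    exact h.indep s x₂
  -- Independence with Q s = 0 forces every mass at the state s to vanish.
  · refine rate_eq_of_mixture haux htot hq hξ (fun s v x => hr v s x) fun s v hs => ?_
    have := h.indep s (ξ v)
    rw [hs, zero_mul] at this
    have h2 := (Finset.sum_eq_zero_iff_of_nonneg fun v' _ => by
      split_ifs
      exacts [Finset.sum_nonneg fun x _ => h.nonneg s v' x, le_rfl]).1 this v (Finset.mem_univ v)
    simpa using h2

/-- The index set of a convex combination serves as auxiliary alphabet, which is then renumbered by
`Fin k`. -/
theorem exists_testLaw_of_mixturePoint [DecidableEq X₂] {p : (X₂ × S × X₁ → ℝ) × ℝ}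
    (hp : p ∈ mixturePoints Q W ∩ indepPoints Q) :
    ∃ (k : ℕ) (ξ : Fin k → X₂) (r : S → Fin k → X₁ → ℝ), IsTestLaw Q ξ r ∧
      rate Q W ξ r = outEntropy W p.1 + p.2 := by
  obtain ⟨hp, hi⟩ := hp
  obtain ⟨ι, _, c, z, hc, hc1, hz, rfl⟩ := mem_convexHull_iff_exists_fintype.1 hp
  choose q hq hqz using hz
  have hx : ∀ v, ∃ x₂, ∀ z, z.1 ≠ x₂ → q v z = 0 := fun v => Set.mem_iUnion.1 (hq v).2
  choose ξ hξ using hx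
  set r : S → ι → X₁ → ℝ := fun s v x => c v * q v (ξ v, s, x) with hr
  have h1 : (∑ v, c v • z v).1 = ∑ v, c v • q v := by
    rw [Prod.fst_sum]
    exact Finset.sum_congr rfl fun v _ => by rw [← hqz]; rfl
  have h2 : (∑ v, c v • z v).2 = ∑ v, c v * (-outEntropy W (q v) - stateDiv Q (q v)) := by
    rw [Prod.snd_sum]
    exact Finset.sum_congr rfl fun v _ => by rw [← hqz]; rfl
  have hmarg := sum_mixture (c := c) (r := r) hξ fun s v x => rfl
  have hlaw : IsTestLaw Q ξ r := by
    refine ⟨fun s v x => mul_nonneg (hc v) ((hq v).1.1 _), ?_, fun s x₂ => ?_⟩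
    · have : (∑ v, c v • q v) ∈ stdSimplex ℝ (X₂ × S × X₁) :=
        (convex_stdSimplex ℝ _).sum_mem (fun v _ => hc v) hc1 fun v _ => (hq v).1
      have h3 : ∀ p : X₂ × S × X₁ → ℝ, ∑ z, p z = ∑ s, ∑ x₂, ∑ x, p (x₂, s, x) := fun p => by
        rw [Finset.sum_comm]
        simp only [Fintype.sum_prod_type]
      rw [← this.2, h3]
      refine Finset.sum_congr rfl fun s _ => ?_
      refine Eq.trans ?_ (Finset.sum_congr rfl fun x₂ _ => (hmarg s x₂).symm)
      refine Eq.trans ?_ Finset.sum_comm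
      simp
    · have := hi s x₂
      rw [h1] at this
      simpa only [hmarg] using this
  have e := Fintype.equivFin ι
  have hrate := rate_eq_of_mixture (W := W) (Q := Q) hc hc1 (fun v => (hq v).1) hξ
    (fun s v x => rfl) (fun s v hs => by
      have := hlaw.indep s (ξ v)
      rw [hs, zero_mul] at this
      have h2 := (Finset.sum_eq_zero_iff_of_nonneg fun v' _ => by
        split_ifs
        exacts [Finset.sum_nonneg fun x _ => hlaw.nonneg s v' x, le_rfl]).1 this v
          (Finset.mem_univ v)
      simpa using h2)
  refine ⟨Fintype.card ι, fun u => ξ (e.symm u), fun s v x => r s (e.symm v) x, ⟨fun s v x =>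
    hlaw.nonneg _ _ _, ?_, fun s x₂ => ?_⟩, ?_⟩
  · rw [← hlaw.total]
    exact Finset.sum_congr rfl fun s _ => e.symm.sum_comp fun v => ∑ x, r s v x
  · have hs : ∀ s', ∑ u, (if ξ (e.symm u) = x₂ then ∑ x, r s' (e.symm u) x else 0) =
        ∑ v, if ξ v = x₂ then ∑ x, r s' v x else 0 := fun s' =>
      e.symm.sum_comp fun v => if ξ v = x₂ then ∑ x, r s' v x else 0
    rw [hs, hlaw.indep]
    simp only [hs]
  · rw [h1, h2, ← hrate]
    refine (rate_of_injective Q W (ξ := fun u => ξ (e.symm u)) (ξ' := ξ) (r' := r)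
      (e := fun u => e.symm u) e.symm.injective (fun v => rfl) (fun s v x => rfl) ?_).symm
    intro s v x hv
    exact absurd (e.symm.surjective v) hv

/-- The information quantity attains a maximum over all finite auxiliary alphabets. -/
theorem exists_max_rateFunctional [Nonempty X₁] [Nonempty X₂] (Q : PMF S)
    (W : X₁ → X₂ → S → PMF Y) : ∃ (k : ℕ) (P₂ : PMF X₂) (K : S → X₂ → PMF (Fin k × X₁)),
      ∀ (k' : ℕ) (P₂' : PMF X₂) (K' : S → X₂ → PMF (Fin k' × X₁)),
        rateFunctional (jointLaw Q W P₂' K') ≤ rateFunctional (jointLaw Q W P₂ K) := by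
  classical
  have hS : Nonempty S := Q.support_nonempty.to_subtype.map Subtype.val
  have hcpt : IsCompact (mixturePoints Q W ∩ indepPoints Q) :=
    (isCompact_mixturePoints Q W).inter_right (isClosed_indepPoints Q)
  have hne : (mixturePoints Q W ∩ indepPoints Q).Nonempty := by
    obtain ⟨p, hp, -⟩ := (isTestLaw_inputLaw Q (PMF.pure (Classical.arbitrary X₂))
      fun _ _ => PMF.pure ((0 : Fin 1), Classical.arbitrary X₁)).exists_mixturePoint W
    exact ⟨p, hp⟩
  have hcont : ContinuousOn (fun p : (X₂ × S × X₁ → ℝ) × ℝ => outEntropy W p.1 + p.2)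
      (mixturePoints Q W ∩ indepPoints Q) :=
    ((continuousOn_outEntropy W).comp continuousOn_fst fun p hp =>
      fst_mem_of_mem_mixturePoints Q W hp.1).add continuousOn_snd
  obtain ⟨p, hp, hmax⟩ := hcpt.exists_isMaxOn hne hcont
  obtain ⟨k, ξ, r, hr, hrate⟩ := exists_testLaw_of_mixturePoint W hp
  obtain ⟨k, P₂, K, hK⟩ := hr.exists_rateFunctional_eq W
  refine ⟨k, P₂, K, fun k' P₂' K' => ?_⟩
  rw [hK, rateFunctional_jointLaw]
  refine div_le_div_of_nonneg_right ?_ (Real.log_nonneg one_le_two)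
  obtain ⟨p', hp', h'⟩ := (isTestLaw_inputLaw Q P₂' K').exists_mixturePoint W
  rw [h', hrate]
  exact hmax hp'

end Maximum

/-! ### Data processing and quantization of the output -/

section DataProcessing

variable {S X₁ X₂ Y B V : Type*} [Fintype S] [Fintype X₁] [Fintype V]

/-- The channel followed by a deterministic map of its output. -/
def mapChannel (W : X₁ → X₂ → S → PMF Y) (g : Y → B) (x₁ : X₁) (x₂ : X₂) (s : S) : PMF B :=
  (W x₁ x₂ s).map g

theorem PMF.hasSum_map_toReal (p : PMF Y) (g : Y → B) (b : B) :
    HasSum (fun y : {y // g y = b} => (p y).toReal) (p.map g b).toReal := by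
  classical
  have h1 : p.map g b = ∑' y : {y // g y = b}, p y := by
    rw [PMF.map_apply]
    have := tsum_subtype {y | g y = b} (fun y => p y)
    refine Eq.trans (tsum_congr fun y => ?_) this.symm
    by_cases h : g y = b <;> simp [Set.indicator, h, eq_comm]
  have h2 : ∑' y : {y // g y = b}, p y ≠ ∞ := h1 ▸ (p.map g).apply_ne_top b
  have := ENNReal.hasSum_toReal h2
  rwa [← ENNReal.tsum_toReal_eq fun y => p.apply_ne_top _, ← h1] at this

theorem hasSum_outProb_mapChannel (W : X₁ → X₂ → S → PMF Y) (g : Y → B) (ξ : V → X₂)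
    (r : S → V → X₁ → ℝ) (v : V) (b : B) :
    HasSum (fun y : {y // g y = b} => outProb W ξ r v y) (outProb (mapChannel W g) ξ r v b) :=
  hasSum_sum fun s _ => hasSum_sum fun x _ => (PMF.hasSum_map_toReal (W x (ξ v) s) g b).mul_left _

/-- The log-sum inequality on each fibre of g, added up over the fibres. -/
theorem sum_mul_log_div_fiber_le [Fintype B] (g : Y → B) {a b : Y → ℝ} {a' b' : B → ℝ}
    (ha : ∀ y, 0 ≤ a y) (hb : ∀ y, 0 ≤ b y) (hab : ∀ y, b y = 0 → a y = 0)
    (ha' : ∀ t, HasSum (fun y : {y // g y = t} => a y) (a' t))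
    (hb' : ∀ t, HasSum (fun y : {y // g y = t} => b y) (b' t))
    (hs : Summable fun y => a y * Real.log (a y / b y)) :
    ∑ t, a' t * Real.log (a' t / b' t) ≤ ∑' y, a y * Real.log (a y / b y) := by
  have h2 : Summable fun z : Σ t, {y // g y = t} => a z.2 * Real.log (a z.2 / b z.2) :=
    (Equiv.sigmaFiberEquiv g).summable_iff.2 hs
  have h1 : ∑' y, a y * Real.log (a y / b y) =
      ∑ t, ∑' y : {y // g y = t}, a y * Real.log (a y / b y) := by
    rw [← tsum_fintype (L := .unconditional B), ← h2.tsum_sigma]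
    exact ((Equiv.sigmaFiberEquiv g).tsum_eq fun y => a y * Real.log (a y / b y)).symm
  rw [h1]
  refine Finset.sum_le_sum fun t _ => ?_
  rw [← (ha' t).tsum_eq, ← (hb' t).tsum_eq]
  exact tsum_mul_log_div_ge (fun y => ha y) (fun y => hb y) (fun y => hab y) (ha' t).summable
    (hb' t).summable (hs.subtype {y | g y = t})

/-- Data processing: mapping the channel output does not increase the rate. -/
theorem rate_mapChannel_le [Fintype B] (Q : PMF S) (W : X₁ → X₂ → S → PMF Y) (g : Y → B)
    (ξ : V → X₂) {r : S → V → X₁ → ℝ} (hr : ∀ s v x, 0 ≤ r s v x) :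
    rate Q (mapChannel W g) ξ r ≤ rate Q W ξ r := by
  refine sub_le_sub_right (Finset.sum_le_sum fun v _ => ?_) _
  rw [tsum_fintype]
  refine sum_mul_log_div_fiber_le g (fun y => outProb_nonneg hr v y)
    (fun y => mul_nonneg (auxProb_nonneg hr v)
      (Finset.sum_nonneg fun v' _ => outProb_nonneg hr v' y)) (fun y h => ?_)
    (hasSum_outProb_mapChannel W g ξ r v)
    (fun b => (hasSum_sum fun v' _ => hasSum_outProb_mapChannel W g ξ r v' b).mul_left _)
    (summable_outProb_mul_log W ξ hr v)
  rcases mul_eq_zero.1 h with h | h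
  · exact outProb_eq_zero hr h y
  · exact (Finset.sum_eq_zero_iff_of_nonneg fun v' _ => outProb_nonneg hr v' y).1 h v
      (Finset.mem_univ v)

open Classical in
/-- The map that keeps the elements of a finite set and forgets all others. -/
def quantize (T : Finset Y) (y : Y) : Option T := if h : y ∈ T then some ⟨y, h⟩ else none

theorem quantize_eq_some {T : Finset Y} {y : Y} {t : T} : quantize T y = some t ↔ y = t := by
  unfold quantize
  split_ifs with h
  · simp [Subtype.ext_iff]
  · simp only [false_iff]
    rintro rfl
    exact h t.2

theorem outProb_quantize_some (W : X₁ → X₂ → S → PMF Y) (T : Finset Y) (ξ : V → X₂)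
    (r : S → V → X₁ → ℝ) (v : V) (t : T) :
    outProb (mapChannel W (quantize T)) ξ r v (some t) = outProb W ξ r v t := by
  have h := hasSum_outProb_mapChannel W (quantize T) ξ r v (some t)
  have h2 : HasSum (fun y : {y // quantize T y = some t} => outProb W ξ r v y)
      (outProb W ξ r v t) :=
    hasSum_single (⟨t, quantize_eq_some.2 rfl⟩ : {y // quantize T y = some t})
      fun y hy => (hy (Subtype.ext (quantize_eq_some.1 y.2))).elim
  exact h.unique h2

/-- Quantizations of the channel output come arbitrarily close to the rate. -/
theorem exists_rate_quantize_gt (Q : PMF S) (W : X₁ → X₂ → S → PMF Y) (ξ : V → X₂)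
    {r : S → V → X₁ → ℝ} (hr : ∀ s v x, 0 ≤ r s v x) (h1 : ∑ v, auxProb r v = 1) {a : ℝ}
    (ha : a < rate Q W ξ r) :
    ∃ T : Finset Y, a < rate Q (mapChannel W (quantize T)) ξ r := by
  classical
  have hsum : HasSum (fun y => ∑ v, outProb W ξ r v y *
      Real.log (outProb W ξ r v y / (auxProb r v * ∑ v', outProb W ξ r v' y)))
      (∑ v, ∑' y, outProb W ξ r v y *
      Real.log (outProb W ξ r v y / (auxProb r v * ∑ v', outProb W ξ r v' y))) :=
    hasSum_sum fun v _ => (summable_outProb_mul_log W ξ hr v).hasSum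
  -- A finite partial sum of the series for I(V;Y) is already large enough; T is its set of outputs.
  obtain ⟨T, hT⟩ := ((hsum.eventually (lt_mem_nhds (lt_sub_iff_add_lt.1 ha))).exists)
  refine ⟨T, (lt_sub_iff_add_lt.2 hT).trans_le (sub_le_sub_right ?_ _)⟩
  -- The lumped symbol contributes a nonnegative amount: in the log-sum inequality over v both
  -- totals agree, because the auxiliary probabilities add up to one.
  have hn : 0 ≤ ∑ v, outProb (mapChannel W (quantize T)) ξ r v none *
      Real.log (outProb (mapChannel W (quantize T)) ξ r v none /
        (auxProb r v * ∑ v', outProb (mapChannel W (quantize T)) ξ r v' none)) := by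
    refine le_trans ?_ (sum_mul_log_div_ge Finset.univ (fun v => outProb_nonneg hr v none)
      (fun v => mul_nonneg (auxProb_nonneg hr v)
        (Finset.sum_nonneg fun v' _ => outProb_nonneg hr v' none)) fun v h => ?_)
    · rw [← Finset.sum_mul, h1, one_mul]
      by_cases h0 : ∑ v, outProb (mapChannel W (quantize T)) ξ r v none = 0
      · simp [h0]
      · rw [div_self h0]; simp
    · rcases mul_eq_zero.1 h with h | h
      · exact outProb_eq_zero hr h none
      · exact (Finset.sum_eq_zero_iff_of_nonneg fun v' _ => outProb_nonneg hr v' none).1 h v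
          (Finset.mem_univ v)
  simp only [tsum_fintype, Fintype.sum_option, outProb_quantize_some]
  rw [Finset.sum_add_distrib, Finset.sum_comm]
  refine le_trans (le_of_eq ?_) (le_add_of_nonneg_left hn)
  refine Finset.sum_congr rfl fun v _ => ?_
  exact (Finset.sum_coe_sort T fun y => outProb W ξ r v y *
      Real.log (outProb W ξ r v y / (auxProb r v * ∑ v', outProb W ξ r v' y))).symm

end DataProcessing

/-! ### Transfer of codes between a channel and its quantizations -/

section CodeTransfer

variable {S X₁ X₂ Y B : Type*} {Mc M₁ n : ℕ}

/-- The code that maps the channel outputs before decoding. -/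
def Code.comap (c : Code S X₁ X₂ B Mc M₁ n) (g : Y → B) : Code S X₁ X₂ Y Mc M₁ n where
  enc₁ := c.enc₁
  enc₂ := c.enc₂
  dec y := c.dec (g ∘ y)

/-- The average probability of correct decoding. -/
def Code.correctProb (c : Code S X₁ X₂ Y Mc M₁ n) (Q : PMF S) (W : X₁ → X₂ → S → PMF Y) : ℝ≥0∞ :=
  ∑' (w : Fin Mc × Fin M₁) (s : Fin n → S) (y : Fin n → Y),
    if c.dec y = w then c.jointProb Q W w s y else 0

theorem Code.errorProb_add_correctProb (c : Code S X₁ X₂ Y Mc M₁ n) (Q : PMF S)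
    (W : X₁ → X₂ → S → PMF Y) (hc : Mc ≠ 0) (h₁ : M₁ ≠ 0) :
    c.errorProb Q W + c.correctProb Q W = 1 := by
  have h : ∀ w s y, (if c.dec y = w then 0 else c.jointProb Q W w s y) +
      (if c.dec y = w then c.jointProb Q W w s y else 0) = c.jointProb Q W w s y := by
    intro w s y
    split_ifs <;> simp
  unfold errorProb correctProb
  rw [← ENNReal.tsum_add]
  simp only [← ENNReal.tsum_add, h]
  simp only [jointProb, Finset.prod_mul_distrib, ENNReal.tsum_mul_left]
  simp only [tsum_pi_prod, PMF.tsum_coe, Finset.prod_const_one, mul_one]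
  rw [tsum_fintype, Finset.sum_const, Finset.card_univ, Fintype.card_prod,
    Fintype.card_fin, Fintype.card_fin, nsmul_eq_mul, Nat.cast_mul, mul_one,
    mul_mul_mul_comm, ENNReal.inv_mul_cancel (by simpa using hc) (ENNReal.natCast_ne_top _),
    ENNReal.inv_mul_cancel (by simpa using h₁) (ENNReal.natCast_ne_top _), one_mul]

/-- Output sequences are grouped by their image under g. The sum over a group factors into sums over
fibres, which are the letter probabilities of the mapped channel. -/
theorem Code.correctProb_comap (c : Code S X₁ X₂ B Mc M₁ n) (Q : PMF S)
    (W : X₁ → X₂ → S → PMF Y) (g : Y → B) :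
    (c.comap g).correctProb Q W = c.correctProb Q (mapChannel W g) := by
  classical
  unfold correctProb
  refine tsum_congr fun w => tsum_congr fun s => ?_
  have h1 : ∀ y : Fin n → Y, (if (c.comap g).dec y = w then (c.comap g).jointProb Q W w s y else 0)
      = ∑' b : Fin n → B, if b = g ∘ y then
        (if c.dec b = w then (c.comap g).jointProb Q W w s y else 0) else 0 := by
    intro y
    rw [tsum_ite_eq]
    rfl
  simp only [h1]
  rw [ENNReal.tsum_comm]
  refine tsum_congr fun b => ?_
  split_ifs with hb
  · have h2 : ∀ y : Fin n → Y, (if b = g ∘ y then (c.comap g).jointProb Q W w s y else 0) =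
        (Mc : ℝ≥0∞)⁻¹ * (M₁ : ℝ≥0∞)⁻¹ * ((∏ i, Q (s i)) * ∏ i, if b i = g (y i) then
          W (c.enc₁ w.1 w.2 s i) (c.input₂ w.1 s i) (s i) (y i) else 0) := by
      intro y
      split_ifs with h
      · subst h
        simp only [Function.comp_apply, if_true, jointProb, Finset.prod_mul_distrib]
        rfl
      · obtain ⟨i, hi⟩ : ∃ i, b i ≠ g (y i) := by
          by_contra hcon
          push Not at hcon
          exact h (funext hcon)
        rw [Finset.prod_eq_zero (f := fun i => if b i = g (y i) then
          W (c.enc₁ w.1 w.2 s i) (c.input₂ w.1 s i) (s i) (y i) else 0) (Finset.mem_univ i)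
          (if_neg hi), mul_zero, mul_zero]
    simp only [h2, ENNReal.tsum_mul_left]
    rw [tsum_pi_prod fun i t => if b i = g t then
      W (c.enc₁ w.1 w.2 s i) (c.input₂ w.1 s i) (s i) t else 0]
    simp only [jointProb, Finset.prod_mul_distrib, mapChannel, PMF.map_apply]
  · simp

theorem Code.errorProb_comap (c : Code S X₁ X₂ B Mc M₁ n) (Q : PMF S)
    (W : X₁ → X₂ → S → PMF Y) (g : Y → B) (hc : Mc ≠ 0) (h₁ : M₁ ≠ 0) :
    (c.comap g).errorProb Q W = c.errorProb Q (mapChannel W g) := by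
  have h1 := (c.comap g).errorProb_add_correctProb Q W hc h₁
  have h2 := c.errorProb_add_correctProb Q (mapChannel W g) hc h₁
  rw [Code.correctProb_comap, ← h2] at h1
  refine (ENNReal.add_left_inj ?_).1 h1
  exact ne_top_of_le_ne_top ENNReal.one_ne_top (h2 ▸ le_add_self)

/-- A code remains almost as good after a suitable quantization of the channel output. -/
theorem Code.exists_quantize [Nonempty Y] (c : Code S X₁ X₂ Y Mc M₁ n) (Q : PMF S)
    (W : X₁ → X₂ → S → PMF Y) {a : ℝ≥0∞} (ha : a < c.correctProb Q W) :
    ∃ (T : Finset Y) (c' : Code S X₁ X₂ (Option T) Mc M₁ n),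
      a < c'.correctProb Q (mapChannel W (quantize T)) := by
  classical
  have h1 : ∀ c : Code S X₁ X₂ Y Mc M₁ n, c.correctProb Q W =
      ∑' (y : Fin n → Y) (w : Fin Mc × Fin M₁) (s : Fin n → S),
        if c.dec y = w then c.jointProb Q W w s y else 0 := fun c =>
    (tsum_congr fun w => ENNReal.tsum_comm).trans ENNReal.tsum_comm
  -- Finitely many output sequences already account for more than a; T collects their letters.
  rw [h1, ENNReal.tsum_eq_iSup_sum, lt_iSup_iff] at ha
  obtain ⟨A, hA⟩ := ha
  set T : Finset Y := A.biUnion fun y => Finset.univ.image y with hT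
  -- The value at `none` does not matter: only sequences in A are counted, and their letters lie in
  -- T.
  let f : Option T → Y := fun o => o.elim (Classical.arbitrary Y) Subtype.val
  refine ⟨T, c.comap f, hA.trans_le ?_⟩
  rw [← Code.correctProb_comap, h1]
  refine le_trans (le_of_eq ?_) (ENNReal.sum_le_tsum A)
  refine Finset.sum_congr rfl fun y hy => ?_
  have hdec : ((c.comap f).comap (quantize T)).dec y = c.dec y := by
    refine congrArg c.dec (funext fun i => ?_)
    have hi : y i ∈ T := Finset.mem_biUnion.2 ⟨y, hy, Finset.mem_image_of_mem y (Finset.mem_univ i)⟩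
    have : quantize T (y i) = some ⟨y i, hi⟩ := quantize_eq_some.2 rfl
    simp only [Function.comp_apply, this, f, Option.elim_some]
  rw [hdec]
  rfl

end CodeTransfer

/-! ### Entropy on a finite sample space and Fano's inequality -/

section FiniteEntropy

variable {Ω A B : Type*} [Fintype Ω]

open Classical in
/-- The law of the variable `X` under the weights `P`. -/
def law (P : Ω → ℝ) (X : Ω → A) (a : A) : ℝ := ∑ ω, if X ω = a then P ω else 0

/-- The entropy, in nats, of the variable `X` under the weights `P`. -/
def entropy (P : Ω → ℝ) (X : Ω → A) : ℝ := -∑ ω, P ω * Real.log (law P X (X ω))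

variable {P : Ω → ℝ}

theorem law_nonneg (hP : ∀ ω, 0 ≤ P ω) (X : Ω → A) (a : A) : 0 ≤ law P X a :=
  Finset.sum_nonneg fun ω _ => by
    split_ifs
    exacts [hP ω, le_rfl]

theorem le_law (hP : ∀ ω, 0 ≤ P ω) (X : Ω → A) (ω : Ω) : P ω ≤ law P X (X ω) := by
  classical
  have := Finset.single_le_sum (f := fun ω' => if X ω' = X ω then P ω' else 0) (fun ω' _ => by
    split_ifs
    exacts [hP ω', le_rfl]) (Finset.mem_univ ω)
  simpa [law] using this

theorem law_pos (hP : ∀ ω, 0 ≤ P ω) (X : Ω → A) {ω : Ω} (h : 0 < P ω) : 0 < law P X (X ω) :=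
  h.trans_le (le_law hP X ω)

theorem sum_law_mul [Fintype A] (P : Ω → ℝ) (X : Ω → A) (F : A → ℝ) :
    ∑ a, law P X a * F a = ∑ ω, P ω * F (X ω) := by
  classical
  simp only [law, Finset.sum_mul]
  rw [Finset.sum_comm]
  simp

theorem sum_law [Fintype A] (P : Ω → ℝ) (X : Ω → A) : ∑ a, law P X a = ∑ ω, P ω := by
  simpa using sum_law_mul P X fun _ => 1

open Classical in
theorem law_comp [Fintype A] (P : Ω → ℝ) (X : Ω → A) (g : A → B) (b : B) :
    law P (fun ω => g (X ω)) b = ∑ a, if g a = b then law P X a else 0 := by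
  have := sum_law_mul P X fun a => if g a = b then 1 else 0
  simpa [law] using this.symm

theorem law_congr {X : Ω → A} {X' : Ω → B} {a : A} {b : B} (h : ∀ ω, X ω = a ↔ X' ω = b) :
    law P X a = law P X' b := by
  classical
  exact Finset.sum_congr rfl fun ω _ => if_congr (h ω) rfl rfl

theorem sum_law_right [Fintype B] (P : Ω → ℝ) (X : Ω → A) (Z : Ω → B) (a : A) :
    ∑ b, law P (fun ω => (X ω, Z ω)) (a, b) = law P X a := by
  classical
  simp only [law]
  rw [Finset.sum_comm]
  refine Finset.sum_congr rfl fun ω _ => ?_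
  by_cases h : X ω = a <;> simp [h]

theorem sum_law_left [Fintype A] (P : Ω → ℝ) (X : Ω → A) (Z : Ω → B) (b : B) :
    ∑ a, law P (fun ω => (X ω, Z ω)) (a, b) = law P Z b := by
  rw [← sum_law_right P Z X]
  exact Finset.sum_congr rfl fun a _ => law_congr fun ω => by simp [and_comm]

/-- Entropy depends only on the partition that the variable generates, so tuples may be rearranged
or re-encoded freely. -/
theorem entropy_congr {X : Ω → A} {X' : Ω → B}
    (h : ∀ ω ω', X ω = X ω' ↔ X' ω = X' ω') : entropy P X = entropy P X' := by
  have hl : ∀ ω, law P X (X ω) = law P X' (X' ω) := fun ω => law_congr fun ω' => h ω' ω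
  simp only [entropy, hl]

/-- Mutual information in terms of entropies. -/
theorem sum_law_mul_log [Fintype A] [Fintype B] (hP : ∀ ω, 0 ≤ P ω) (X : Ω → A) (Z : Ω → B) :
    ∑ a, ∑ b, law P (fun ω => (X ω, Z ω)) (a, b) *
      Real.log (law P (fun ω => (X ω, Z ω)) (a, b) / (law P X a * law P Z b)) =
    entropy P X + entropy P Z - entropy P fun ω => (X ω, Z ω) := by
  rw [← Fintype.sum_prod_type' (f := fun a b => law P (fun ω => (X ω, Z ω)) (a, b) *
      Real.log (law P (fun ω => (X ω, Z ω)) (a, b) / (law P X a * law P Z b)))]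
  rw [sum_law_mul P (fun ω => (X ω, Z ω)) fun c =>
    Real.log (law P (fun ω => (X ω, Z ω)) c / (law P X c.1 * law P Z c.2))]
  simp only [entropy]
  rw [sub_neg_eq_add, ← neg_add, ← Finset.sum_add_distrib, neg_add_eq_sub,
    ← Finset.sum_sub_distrib]
  refine Finset.sum_congr rfl fun ω _ => ?_
  rcases (hP ω).eq_or_lt with h | h
  · simp [← h]
  · rw [Real.log_div (law_pos hP _ h).ne' (mul_pos (law_pos hP _ h) (law_pos hP _ h)).ne',
      Real.log_mul (law_pos hP _ h).ne' (law_pos hP _ h).ne']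
    ring

/-- Subadditivity of entropy. -/
theorem entropy_pi_le [Fintype A] {n : ℕ} (hP : ∀ ω, 0 ≤ P ω) (h1 : ∑ ω, P ω = 1)
    (X : Ω → Fin n → A) : entropy P X ≤ ∑ i, entropy P fun ω => X ω i := by
  -- Nonnegativity of the divergence from the product of the marginals.
  have h := sum_mul_log_div_ge (Finset.univ : Finset (Fin n → A)) (a := law P X)
    (b := fun a => ∏ i, law P (fun ω => X ω i) (a i)) (law_nonneg hP X)
    (fun a => Finset.prod_nonneg fun i _ => law_nonneg hP _ _) fun a ha => by
      obtain ⟨i, -, hi⟩ := Finset.prod_eq_zero_iff.1 ha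
      refine le_antisymm ?_ (law_nonneg hP X a)
      rw [← hi]
      refine Finset.sum_le_sum fun ω _ => ?_
      split_ifs with h1 h2 h2
      · exact le_rfl
      · exact absurd (congrFun h1 i) h2
      · exact hP ω
      · exact le_rfl
  rw [sum_pi_prod, sum_law, h1, Finset.prod_congr rfl fun i _ => (sum_law P fun ω => X ω i).trans h1,
    Finset.prod_const_one, div_one, Real.log_one, mul_zero,
    sum_law_mul P X fun a => Real.log (law P X a / ∏ i, law P (fun ω => X ω i) (a i))] at h
  simp only [entropy]
  rw [Finset.sum_neg_distrib, neg_le_neg_iff, Finset.sum_comm, ← sub_nonneg,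
    ← Finset.sum_sub_distrib]
  refine h.trans_eq (Finset.sum_congr rfl fun ω _ => ?_)
  rcases (hP ω).eq_or_lt with h | h
  · simp [← h]
  · rw [Real.log_div (law_pos hP _ h).ne' (Finset.prod_pos fun i _ =>
      law_pos hP (fun ω => X ω i) h).ne', Real.log_prod fun i _ =>
      (law_pos hP (fun ω => X ω i) h).ne', mul_sub, Finset.mul_sum]

/-- Fano's inequality for a uniform message. -/
theorem fano {M : ℕ} {A : Type*} [Fintype A] (hP : ∀ ω, 0 ≤ P ω) (h1 : ∑ ω, P ω = 1)
    (X : Ω → Fin M) (Z : Ω → A) (hX : ∀ w, law P X w = (M : ℝ)⁻¹) (d : A → Fin M) {q : ℝ}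
    (hq : ∑ ω, (if d (Z ω) = X ω then P ω else 0) = q) :
    q * Real.log M - Real.binEntropy q ≤
      entropy P X + entropy P Z - entropy P fun ω => (X ω, Z ω) := by
  classical
  have hM : (0 : ℝ) < M := by
    rcases Nat.eq_zero_or_pos M with rfl | hM
    · have : IsEmpty Ω := ⟨fun ω => (X ω).elim0⟩
      simp at h1
    · exact_mod_cast hM
  set a : Fin M × A → ℝ := law P fun ω => (X ω, Z ω) with ha
  -- Mutual information is the divergence of a from b, where b makes X uniform and independent of Z.
  -- It is coarsened to the event E of a correct guess, which has b-mass 1/M for every d.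
  set b : Fin M × A → ℝ := fun c => (M : ℝ)⁻¹ * law P Z c.2 with hb
  have ha0 : ∀ c, 0 ≤ a c := law_nonneg hP _
  have hb0 : ∀ c, 0 ≤ b c := fun c => mul_nonneg (by positivity) (law_nonneg hP _ _)
  have hle : ∀ c, a c ≤ law P Z c.2 := fun c => Finset.sum_le_sum fun ω _ => by
    split_ifs with h1 h2 h2
    · exact le_rfl
    · exact absurd (congrArg Prod.snd h1) h2
    · exact hP ω
    · exact le_rfl
  have hab : ∀ c, b c = 0 → a c = 0 := fun c hc => by
    have : law P Z c.2 = 0 := by simpa [hb, hM.ne'] using hc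
    exact le_antisymm (this ▸ hle c) (ha0 c)
  rw [← sum_law_mul_log hP, ← Fintype.sum_prod_type' (f := fun w z => a (w, z) *
    Real.log (a (w, z) / (law P X w * law P Z z)))]
  simp only [hX]
  set E : Finset (Fin M × A) := Finset.univ.filter fun c => d c.2 = c.1 with hE
  have haE : ∑ c ∈ E, a c = q := by
    rw [Finset.sum_filter, ← hq]
    have := sum_law_mul P (fun ω => (X ω, Z ω)) fun c => if d c.2 = c.1 then 1 else 0
    simpa using this
  have hbE : ∑ c ∈ E, b c = (M : ℝ)⁻¹ := by
    rw [Finset.sum_filter, Fintype.sum_prod_type_right]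
    simp only [hb, Finset.sum_ite_eq, Finset.mem_univ, if_true]
    rw [← Finset.mul_sum, sum_law, h1, mul_one]
  have ha1 : ∑ c, a c = 1 := (sum_law P _).trans h1
  have hb1 : ∑ c, b c = 1 := by
    rw [Fintype.sum_prod_type_right]
    simp only [hb, Finset.sum_const, Finset.card_univ, Fintype.card_fin, nsmul_eq_mul]
    simp only [mul_inv_cancel_left₀ hM.ne']
    rw [sum_law, h1]
  have haE' : ∑ c ∈ Eᶜ, a c = 1 - q := by
    rw [← ha1, ← Finset.sum_add_sum_compl E a, haE]; ring
  have hbE' : ∑ c ∈ Eᶜ, b c = 1 - (M : ℝ)⁻¹ := by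
    rw [← hb1, ← Finset.sum_add_sum_compl E b, hbE]; ring
  -- This covers M = 1, where the complement of E has b-mass zero and the log-sum bound divides by
  -- zero.
  have hle' : 1 - q ≤ M * (1 - (M : ℝ)⁻¹) := by
    rw [← haE', ← hbE', Finset.mul_sum]
    refine Finset.sum_le_sum fun c _ => (hle c).trans_eq ?_
    simp only [hb, mul_inv_cancel_left₀ hM.ne']
  have hq1 : 0 ≤ 1 - q := haE' ▸ Finset.sum_nonneg fun c _ => ha0 c
  have hq0 : 0 ≤ q := haE ▸ Finset.sum_nonneg fun c _ => ha0 c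
  rw [← Finset.sum_add_sum_compl E]
  have h2 := sum_mul_log_div_ge E ha0 hb0 hab
  have h3 := sum_mul_log_div_ge Eᶜ ha0 hb0 hab
  rw [haE, hbE] at h2
  rw [haE', hbE'] at h3
  have h4 : q * Real.log (q / (M : ℝ)⁻¹) = q * Real.log q + q * Real.log M := by
    rcases hq0.eq_or_lt with h | h
    · simp [← h]
    · rw [div_inv_eq_mul, Real.log_mul h.ne' hM.ne', mul_add]
  -- Dividing by a number in (0, 1] can only increase the logarithm.
  have h5 : (1 - q) * Real.log (1 - q) ≤ (1 - q) * Real.log ((1 - q) / (1 - (M : ℝ)⁻¹)) := by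
    rcases hq1.eq_or_lt with h | h
    · simp [← h]
    · have h6 : 0 < 1 - (M : ℝ)⁻¹ := by
        by_contra hcon
        have := mul_nonpos_of_nonneg_of_nonpos hM.le (not_lt.1 hcon)
        linarith
      refine mul_le_mul_of_nonneg_left (Real.log_le_log h ?_) hq1
      rw [le_div_iff₀ h6]
      have : 0 < (M : ℝ)⁻¹ := by positivity
      nlinarith
  have h7 : Real.binEntropy q = -(q * Real.log q) - (1 - q) * Real.log (1 - q) := by
    rw [Real.binEntropy_eq_negMulLog_add_negMulLog_one_sub, Real.negMulLog, Real.negMulLog]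
    ring
  rw [h7]
  linarith

end FiniteEntropy

/-! ### Independence of one coordinate under a product law -/

section Split

/-- Integrating out one coordinate of a product law. -/
theorem sum_prod_mul_split {ι A : Type*} [Fintype ι] [DecidableEq ι] [Fintype A] (p : ι → A → ℝ)
    (i : ι) (hp : ∑ t, p i t = 1) (φ : A → ℝ) (G : (ι → A) → ℝ)
    (hG : ∀ a b : ι → A, (∀ j, j ≠ i → a j = b j) → G a = G b) :
    ∑ a : ι → A, (∏ j, p j (a j)) * (φ (a i) * G a) =
      (∑ t, p i t * φ t) * ∑ a : ι → A, (∏ j, p j (a j)) * G a := by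
  have hA : Nonempty A := by
    by_contra h
    rw [not_nonempty_iff] at h
    simp at hp
  -- The factor over the other coordinates does not depend on ψ, so ψ = 1 identifies it.
  have key : ∀ ψ : A → ℝ, ∑ a : ι → A, (∏ j, p j (a j)) * (ψ (a i) * G a) =
      (∑ t, p i t * ψ t) * ∑ b : {j // j ≠ i} → A, (∏ j : {j // j ≠ i}, p j (b j)) *
        G ((Equiv.funSplitAt i A).symm (Classical.arbitrary A, b)) := by
    intro ψ
    rw [← (Equiv.funSplitAt i A).symm.sum_comp, Fintype.sum_prod_type, Finset.sum_mul]
    refine Finset.sum_congr rfl fun t _ => ?_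
    rw [Finset.mul_sum]
    refine Finset.sum_congr rfl fun b _ => ?_
    have hi : (Equiv.funSplitAt i A).symm (t, b) i = t := by simp
    have hj : ∀ j : {j // j ≠ i}, (Equiv.funSplitAt i A).symm (t, b) j = b j := fun j => by
      simp [j.2]
    rw [hi, hG _ ((Equiv.funSplitAt i A).symm (Classical.arbitrary A, b)) fun j hj => by simp [hj],
      Fintype.prod_eq_mul_prod_subtype_ne _ i, hi]
    simp only [hj]
    ring
  rw [key φ]
  have := key 1
  simp only [Pi.one_apply, one_mul, mul_one, hp] at this
  rw [this]

end Split

/-! ### The law of a block and Csiszár's sum identity by telescoping -/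

section Block

variable {S X₁ X₂ Y : Type*} [Fintype S] [Fintype X₁] [Fintype X₂] [Fintype Y] {M n : ℕ}
  (Q : PMF S) (W : X₁ → X₂ → S → PMF Y) (e : Fin M → (Fin n → S) → Fin n → X₁)
  (f : Fin M → (Fin n → S) → Fin n → X₂)

/-- The law of message, states and channel outputs when the inputs are given by `e` and `f`. -/
def blockLaw (ω : Fin M × (Fin n → S) × (Fin n → Y)) : ℝ :=
  (M : ℝ)⁻¹ * ((∏ i, (Q (ω.2.1 i)).toReal) *
    ∏ i, (W (e ω.1 ω.2.1 i) (f ω.1 ω.2.1 i) (ω.2.1 i) (ω.2.2 i)).toReal)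

theorem blockLaw_nonneg (ω : Fin M × (Fin n → S) × (Fin n → Y)) : 0 ≤ blockLaw Q W e f ω :=
  mul_nonneg (by positivity) (mul_nonneg (Finset.prod_nonneg fun _ _ => ENNReal.toReal_nonneg)
    (Finset.prod_nonneg fun _ _ => ENNReal.toReal_nonneg))

theorem sum_blockLaw_output (F : Fin M → (Fin n → S) → ℝ) :
    ∑ ω, blockLaw Q W e f ω * F ω.1 ω.2.1 =
      ∑ w, (M : ℝ)⁻¹ * ∑ s : Fin n → S, (∏ i, (Q (s i)).toReal) * F w s := by
  simp only [Fintype.sum_prod_type, blockLaw, Finset.mul_sum]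
  refine Finset.sum_congr rfl fun w _ => Finset.sum_congr rfl fun s _ => ?_
  simp only [mul_right_comm _ _ (F w s), ← mul_assoc, ← Finset.mul_sum]
  rw [sum_pi_prod fun i y => (W (e w s i) (f w s i) (s i) y).toReal]
  simp only [PMF.sum_toReal, Finset.prod_const_one, mul_one]

theorem sum_blockLaw (hM : M ≠ 0) : ∑ ω, blockLaw Q W e f ω = 1 := by
  have h := sum_blockLaw_output Q W e f fun _ _ => 1
  simp only [mul_one] at h
  rw [h, sum_pi_prod fun _ t => (Q t).toReal]
  simp only [PMF.sum_toReal, Finset.prod_const_one, mul_one, Finset.sum_const, Finset.card_univ,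
    Fintype.card_fin, nsmul_eq_mul]
  exact mul_inv_cancel₀ (by exact_mod_cast hM)

theorem law_blockLaw_message (w : Fin M) :
    law (blockLaw Q W e f) (fun ω => ω.1) w = (M : ℝ)⁻¹ := by
  classical
  have h := sum_blockLaw_output Q W e f fun w' _ => if w' = w then 1 else 0
  simp only [mul_ite, mul_one, mul_zero] at h
  unfold law
  refine (Finset.sum_congr rfl fun ω _ => ?_).trans (h.trans ?_)
  · congr
  · rw [Finset.sum_eq_single w (fun w' _ h => by simp [h]) (by simp)]
    simp only [if_true]
    rw [sum_pi_prod fun _ t => (Q t).toReal]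
    simp [PMF.sum_toReal]

theorem law_blockLaw_message_states (w : Fin M) (s : Fin n → S) :
    law (blockLaw Q W e f) (fun ω => (ω.1, ω.2.1)) (w, s) =
      (M : ℝ)⁻¹ * ∏ i, (Q (s i)).toReal := by
  classical
  have h := sum_blockLaw_output Q W e f fun w' s' => if (w', s') = (w, s) then 1 else 0
  simp only [mul_ite, mul_one, mul_zero] at h
  unfold law
  refine (Finset.sum_congr rfl fun ω _ => ?_).trans (h.trans ?_)
  · congr
  · rw [Finset.sum_eq_single w (fun w' _ h => by simp [h]) (by simp)]
    simp

/-- The state at time `i` is independent of what is determined by message and the other states. -/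
theorem law_blockLaw_state_prod {A : Type*} [Fintype A] (i : Fin n)
    (g : Fin M → (Fin n → S) → A)
    (hg : ∀ w s s', (∀ j, j ≠ i → s j = s' j) → g w s = g w s') (t : S) (a : A) :
    law (blockLaw Q W e f) (fun ω => (ω.2.1 i, g ω.1 ω.2.1)) (t, a) =
      (Q t).toReal * law (blockLaw Q W e f) (fun ω => g ω.1 ω.2.1) a := by
  classical
  have h1 := sum_blockLaw_output Q W e f fun w s =>
    (if s i = t then 1 else 0) * if g w s = a then 1 else 0
  have h2 := sum_blockLaw_output Q W e f fun w s => if g w s = a then 1 else 0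
  have h3 : law (blockLaw Q W e f) (fun ω => (ω.2.1 i, g ω.1 ω.2.1)) (t, a) =
      ∑ ω, blockLaw Q W e f ω * ((if ω.2.1 i = t then 1 else 0) *
        if g ω.1 ω.2.1 = a then 1 else 0) := by
    refine Finset.sum_congr rfl fun ω _ => ?_
    by_cases ha : ω.2.1 i = t <;> by_cases hb : g ω.1 ω.2.1 = a <;> simp [ha, hb]
  have h4 : law (blockLaw Q W e f) (fun ω => g ω.1 ω.2.1) a =
      ∑ ω, blockLaw Q W e f ω * if g ω.1 ω.2.1 = a then 1 else 0 := by
    refine Finset.sum_congr rfl fun ω _ => ?_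
    by_cases hb : g ω.1 ω.2.1 = a <;> simp [hb]
  rw [h3, h4, h1, h2, Finset.mul_sum]
  refine Finset.sum_congr rfl fun w _ => ?_
  rw [sum_prod_mul_split (fun _ t => (Q t).toReal) i (PMF.sum_toReal Q)
    (fun s => if s = t then 1 else 0) (fun s => if g w s = a then 1 else 0)
    fun s s' h => by rw [hg w s s' h]]
  simp only [mul_ite, mul_one, mul_zero, Finset.sum_ite_eq', Finset.mem_univ, if_true]
  ring

theorem law_blockLaw_state (hM : M ≠ 0) (i : Fin n) (t : S) :
    law (blockLaw Q W e f) (fun ω => ω.2.1 i) t = (Q t).toReal := by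
  have h := law_blockLaw_state_prod Q W e f i (fun _ _ => ()) (fun _ _ _ _ => rfl) t ()
  have h1 : law (blockLaw Q W e f) (fun _ => ()) () = 1 := by
    simp [law, sum_blockLaw Q W e f hM]
  rw [h1, mul_one] at h
  rw [← h]
  exact law_congr fun ω => by simp

open Classical in
/-- The output at time `i` given the message, all states and the other outputs. -/
theorem law_blockLaw_output_prod {A : Type*} [Fintype A] (i : Fin n)
    (g : Fin M × (Fin n → S) × (Fin n → Y) → A)
    (hg : ∀ w s y y', (∀ j, j ≠ i → y j = y' j) → g (w, s, y) = g (w, s, y')) (a : A) (t : Y) :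
    law (blockLaw Q W e f) (fun ω => (g ω, ω.2.2 i)) (a, t) =
      ∑ ω, if g ω = a then blockLaw Q W e f ω *
        (W (e ω.1 ω.2.1 i) (f ω.1 ω.2.1 i) (ω.2.1 i) t).toReal else 0 := by
  have h3 : law (blockLaw Q W e f) (fun ω => (g ω, ω.2.2 i)) (a, t) =
      ∑ ω, blockLaw Q W e f ω * ((if ω.2.2 i = t then 1 else 0) *
        if g ω = a then 1 else 0) := by
    refine Finset.sum_congr rfl fun ω _ => ?_
    by_cases ha : ω.2.2 i = t <;> by_cases hb : g ω = a <;> simp [ha, hb]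
  have h4 : ∑ ω, (if g ω = a then blockLaw Q W e f ω *
        (W (e ω.1 ω.2.1 i) (f ω.1 ω.2.1 i) (ω.2.1 i) t).toReal else 0) =
      ∑ ω, blockLaw Q W e f ω * ((W (e ω.1 ω.2.1 i) (f ω.1 ω.2.1 i) (ω.2.1 i) t).toReal *
        if g ω = a then 1 else 0) := by
    refine Finset.sum_congr rfl fun ω _ => ?_
    by_cases hb : g ω = a <;> simp [hb]
  rw [h3]
  rw [h4]
  simp only [Fintype.sum_prod_type, blockLaw]
  refine Finset.sum_congr rfl fun w _ => Finset.sum_congr rfl fun s _ => ?_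
  simp only [mul_assoc, ← Finset.mul_sum]
  congr 2
  rw [sum_prod_mul_split (fun j y => (W (e w s j) (f w s j) (s j) y).toReal) i (PMF.sum_toReal _)
    (fun y => if y = t then 1 else 0) (fun y => if g (w, s, y) = a then 1 else 0)
    fun y y' h => by rw [hg w s y y' h]]
  simp only [mul_ite, mul_one, mul_zero, Finset.sum_ite_eq', Finset.mem_univ, if_true]
  rw [Finset.mul_sum]
  refine Finset.sum_congr rfl fun y _ => ?_
  split_ifs <;> ring

/-- The message, the states before time `k` and the outputs from time `k` on. -/
def hybrid (k : ℕ) (ω : Fin M × (Fin n → S) × (Fin n → Y)) : Fin M × (Fin n → S ⊕ Y) :=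
  (ω.1, fun j => if (j : ℕ) < k then Sum.inl (ω.2.1 j) else Sum.inr (ω.2.2 j))

/-- The auxiliary variable of the converse: the message, the states before time `i` and the
outputs after time `i`. -/
def auxVar (i : Fin n) (ω : Fin M × (Fin n → S) × (Fin n → Y)) :
    Fin M × (Fin n → Option (S ⊕ Y)) :=
  (ω.1, fun j => if j < i then some (Sum.inl (ω.2.1 j)) else
    if i < j then some (Sum.inr (ω.2.2 j)) else none)

theorem hybrid_eq_iff (k : ℕ) (ω ω' : Fin M × (Fin n → S) × (Fin n → Y)) :
    hybrid k ω = hybrid k ω' ↔ ω.1 = ω'.1 ∧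
      ∀ j : Fin n, ((j : ℕ) < k → ω.2.1 j = ω'.2.1 j) ∧ (k ≤ (j : ℕ) → ω.2.2 j = ω'.2.2 j) := by
  simp only [hybrid, Prod.mk.injEq, funext_iff]
  refine and_congr_right fun _ => forall_congr' fun j => ?_
  by_cases h : (j : ℕ) < k
  · simp [h]
  · simp [h, not_lt.1 h]

theorem auxVar_eq_iff (i : Fin n) (ω ω' : Fin M × (Fin n → S) × (Fin n → Y)) :
    auxVar i ω = auxVar i ω' ↔ ω.1 = ω'.1 ∧
      ∀ j : Fin n, (j < i → ω.2.1 j = ω'.2.1 j) ∧ (i < j → ω.2.2 j = ω'.2.2 j) := by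
  simp only [auxVar, Prod.mk.injEq, funext_iff]
  refine and_congr_right fun _ => forall_congr' fun j => ?_
  rcases lt_trichotomy j i with h | h | h
  · simp [h, h.not_gt]
  · simp [h]
  · simp [h, h.not_gt]

/-- The hybrid at i carries the information of V_i and Y_i, and the hybrid at i + 1 that of V_i and
S_i. One step of the hybrid thus trades Y_i for S_i with V_i kept. -/
theorem entropy_hybrid (P : Fin M × (Fin n → S) × (Fin n → Y) → ℝ) (i : Fin n) :
    entropy P (hybrid i) = entropy P fun ω => (auxVar i ω, ω.2.2 i) := by
  refine entropy_congr fun ω ω' => ?_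
  simp only [hybrid_eq_iff, Prod.mk.injEq, auxVar_eq_iff]
  constructor
  · rintro ⟨h1, h2⟩
    exact ⟨⟨h1, fun j => ⟨fun h => (h2 j).1 h, fun h => (h2 j).2 (le_of_lt h)⟩⟩, (h2 i).2 le_rfl⟩
  · rintro ⟨⟨h1, h2⟩, h3⟩
    refine ⟨h1, fun j => ⟨fun h => (h2 j).1 h, fun h => ?_⟩⟩
    rcases (show i ≤ j from h).eq_or_lt with rfl | h
    exacts [h3, (h2 j).2 h]

theorem entropy_hybrid_succ (P : Fin M × (Fin n → S) × (Fin n → Y) → ℝ) (i : Fin n) :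
    entropy P (hybrid (i + 1)) = entropy P fun ω => (auxVar i ω, ω.2.1 i) := by
  refine entropy_congr fun ω ω' => ?_
  simp only [hybrid_eq_iff, Prod.mk.injEq, auxVar_eq_iff]
  constructor
  · rintro ⟨h1, h2⟩
    exact ⟨⟨h1, fun j => ⟨fun h => (h2 j).1 (Nat.lt_succ_of_lt h), fun h => (h2 j).2 h⟩⟩,
      (h2 i).1 (Nat.lt_succ_self _)⟩
  · rintro ⟨⟨h1, h2⟩, h3⟩
    refine ⟨h1, fun j => ⟨fun h => ?_, fun h => (h2 j).2 h⟩⟩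
    rcases (show j ≤ i from Nat.lt_succ_iff.1 h).eq_or_lt with rfl | h
    exacts [h3, (h2 j).1 h]

/-- Csiszár's sum identity: the hybrids run from (W, Yⁿ) at 0 to (W, Sⁿ) at n, and the entropy
differences telescope. -/
theorem entropy_hybrid_sub (P : Fin M × (Fin n → S) × (Fin n → Y) → ℝ) :
    entropy P (fun ω => (ω.1, ω.2.2)) - entropy P (fun ω => (ω.1, ω.2.1)) =
      ∑ i : Fin n, ((entropy P fun ω => (auxVar i ω, ω.2.2 i)) -
        entropy P fun ω => (auxVar i ω, ω.2.1 i)) := by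
  have h0 : entropy P (hybrid 0) = entropy P fun ω => (ω.1, ω.2.2) :=
    entropy_congr fun ω ω' => by simp [hybrid_eq_iff, funext_iff]
  have hn : entropy P (hybrid n) = entropy P fun ω => (ω.1, ω.2.1) :=
    entropy_congr fun ω ω' => by
      simp only [hybrid_eq_iff, Prod.mk.injEq, funext_iff]
      refine and_congr_right fun _ => forall_congr' fun j => ?_
      simp
  rw [← h0, ← hn, ← Finset.sum_range_sub' (fun k => entropy P (hybrid k)) n,
    ← Fin.sum_univ_eq_sum_range (fun k => entropy P (hybrid k) - entropy P (hybrid (k + 1)))]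
  exact Finset.sum_congr rfl fun i _ => by rw [entropy_hybrid, entropy_hybrid_succ]

/-- Message and states are independent and the states are i.i.d., so the logarithm of their joint
law is a sum. -/
theorem entropy_blockLaw_message_states (hM : M ≠ 0) :
    entropy (blockLaw Q W e f) (fun ω => (ω.1, ω.2.1)) =
      entropy (blockLaw Q W e f) (fun ω => ω.1) +
        ∑ i, entropy (blockLaw Q W e f) fun ω => ω.2.1 i := by
  simp only [entropy]
  rw [Finset.sum_neg_distrib, ← neg_add, Finset.sum_comm, ← Finset.sum_add_distrib]
  congr 1
  refine Finset.sum_congr rfl fun ω _ => ?_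
  rw [law_blockLaw_message_states Q W e f, law_blockLaw_message Q W e f]
  simp only [law_blockLaw_state Q W e f hM]
  by_cases h : ∏ i, (Q (ω.2.1 i)).toReal = 0
  · simp [blockLaw, h]
  · rw [Real.log_mul (inv_ne_zero (Nat.cast_ne_zero.2 hM)) h, Real.log_prod fun i hi => Finset.prod_ne_zero_iff.1 h i hi,
      mul_add, Finset.mul_sum]

end Block

/-! ### Single-letter converse for a block -/

section BlockConverse

variable {S X₁ X₂ Y : Type*} [Fintype S] [Fintype X₁] [Fintype X₂] [Fintype Y] {M n : ℕ}
  (Q : PMF S) (W : X₁ → X₂ → S → PMF Y) (e : Fin M → (Fin n → S) → Fin n → X₁)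
  (f : Fin M → (Fin n → S) → Fin n → X₂)

/-- The law of state, auxiliary variable and first input at time `i`. -/
def timeLaw (i : Fin n) (s : S) (v : Fin M × (Fin n → Option (S ⊕ Y))) (x : X₁) : ℝ :=
  law (blockLaw Q W e f) (fun ω => ((ω.2.1 i, auxVar i ω), e ω.1 ω.2.1 i)) ((s, v), x)

/-- The second input at time `i` as a function of the auxiliary variable. -/
def timeInput [Nonempty S] (i : Fin n) (v : Fin M × (Fin n → Option (S ⊕ Y))) : X₂ :=
  f v.1 (fun j => (v.2 j).elim (Classical.arbitrary S)
    (Sum.elim id fun _ => Classical.arbitrary S)) i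

/-- The second input is a strictly causal function of the states. -/
def StrictlyCausal (f : Fin M → (Fin n → S) → Fin n → X₂) : Prop :=
  ∀ w i s s', (∀ j : Fin n, j < i → s j = s' j) → f w s i = f w s' i

variable {f}

/-- V_i contains the states before i; the placeholders at the other times are ignored by strict
causality. -/
theorem timeInput_auxVar [Nonempty S] (hf : StrictlyCausal f) (i : Fin n)
    (ω : Fin M × (Fin n → S) × (Fin n → Y)) :
    timeInput f i (auxVar i ω) = f ω.1 ω.2.1 i :=
  hf _ _ _ _ fun j hj => by simp [auxVar, hj]

theorem sum_timeLaw (i : Fin n) (s : S) (v : Fin M × (Fin n → Option (S ⊕ Y))) :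
    ∑ x, timeLaw Q W e f i s v x =
      law (blockLaw Q W e f) (fun ω => (ω.2.1 i, auxVar i ω)) (s, v) :=
  sum_law_right (blockLaw Q W e f)
    (fun ω : Fin M × (Fin n → S) × (Fin n → Y) => (ω.2.1 i, auxVar i ω))
    (fun ω => e ω.1 ω.2.1 i) (s, v)

theorem auxProb_timeLaw (i : Fin n) (v : Fin M × (Fin n → Option (S ⊕ Y))) :
    auxProb (timeLaw Q W e f i) v = law (blockLaw Q W e f) (auxVar i) v := by
  simp only [auxProb, sum_timeLaw]
  exact sum_law_left _ (fun ω => ω.2.1 i) (auxVar i) v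

/-- V_i itself may depend on S_i, through the later outputs. The second input, however, is
determined by the message and the earlier states, so it is independent of S_i. -/
theorem isTestLaw_timeLaw [Nonempty S] [DecidableEq X₂] (hM : M ≠ 0) (hf : StrictlyCausal f)
    (i : Fin n) : IsTestLaw Q (timeInput f i) (timeLaw Q W e f i) where
  nonneg s v x := law_nonneg (blockLaw_nonneg Q W e f) _ _
  total := by
    rw [Finset.sum_comm]
    have : ∀ v, ∑ s, ∑ x, timeLaw Q W e f i s v x = law (blockLaw Q W e f) (auxVar i) v :=
      auxProb_timeLaw Q W e i
    simp only [this]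
    rw [sum_law, sum_blockLaw Q W e f hM]
  indep s x₂ := by
    have h1 : ∀ s, (∑ v, if timeInput f i v = x₂ then ∑ x, timeLaw Q W e f i s v x else 0) =
        law (blockLaw Q W e f) (fun ω => (ω.2.1 i, f ω.1 ω.2.1 i)) (s, x₂) := by
      intro s
      have h2 := law_comp (blockLaw Q W e f)
        (fun ω : Fin M × (Fin n → S) × (Fin n → Y) => (ω.2.1 i, auxVar i ω))
        (fun z => (z.1, timeInput f i z.2)) (s, x₂)
      simp only [timeInput_auxVar hf] at h2
      rw [h2]
      refine Eq.trans ?_ (Fintype.sum_prod_type _).symm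
      rw [Finset.sum_eq_single (s := Finset.univ) (ι := S) s (fun s' _ h => by simp [h]) (by simp)]
      refine Finset.sum_congr rfl fun v _ => ?_
      rw [sum_timeLaw]
      by_cases h : timeInput f i v = x₂ <;> simp [h]
    simp only [h1]
    rw [sum_law_left]
    exact law_blockLaw_state_prod Q W e f i (fun w s => f w s i)
      (fun w s s' h => hf w i s s' fun j hj => h j hj.ne) s x₂

/-- Memorylessness: V_i does not involve Y_i, so given the message, all states and the other
outputs, Y_i follows the channel law at the inputs and state of time i. -/
theorem outProb_timeLaw [Nonempty S] (hf : StrictlyCausal f) (i : Fin n)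
    (v : Fin M × (Fin n → Option (S ⊕ Y))) (y : Y) :
    outProb W (timeInput f i) (timeLaw Q W e f i) v y =
      law (blockLaw Q W e f) (fun ω => (auxVar i ω, ω.2.2 i)) (v, y) := by
  classical
  rw [law_blockLaw_output_prod Q W e f i (auxVar i) (fun w s y y' h =>
    (auxVar_eq_iff i _ _).2 ⟨rfl, fun j => ⟨fun _ => rfl, fun hj => h j hj.ne'⟩⟩) v y]
  have h := sum_law_mul (blockLaw Q W e f)
    (fun ω : Fin M × (Fin n → S) × (Fin n → Y) => ((ω.2.1 i, auxVar i ω), e ω.1 ω.2.1 i))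
    fun z => if z.1.2 = v then (W z.2 (timeInput f i v) z.1.1 y).toReal else 0
  rw [Fintype.sum_prod_type, Fintype.sum_prod_type] at h
  unfold outProb
  refine Eq.trans ?_ (h.trans ?_)
  · refine Finset.sum_congr rfl fun s _ => ?_
    rw [Finset.sum_eq_single v (fun v' _ h => by simp [h]) (by simp)]
    simp only [if_true]
    rfl
  · refine Finset.sum_congr rfl fun ω _ => ?_
    by_cases hv : auxVar i ω = v
    · subst hv
      simp [timeInput_auxVar hf]
    · simp [hv]

/-- Both mutual informations are expanded into entropies; the entropy of V_i cancels. -/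
theorem rate_timeLaw [Nonempty S] (hM : M ≠ 0) (hf : StrictlyCausal f) (i : Fin n) :
    rate Q W (timeInput f i) (timeLaw Q W e f i) =
      (entropy (blockLaw Q W e f) fun ω => ω.2.2 i) -
      (entropy (blockLaw Q W e f) fun ω => ω.2.1 i) -
      ((entropy (blockLaw Q W e f) fun ω => (auxVar i ω, ω.2.2 i)) -
        entropy (blockLaw Q W e f) fun ω => (auxVar i ω, ω.2.1 i)) := by
  have hP := blockLaw_nonneg Q W e f
  have h1 := sum_law_mul_log hP (auxVar i) fun ω => ω.2.2 i
  have h2 := sum_law_mul_log hP (fun ω => ω.2.1 i) (auxVar i)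
  have h3 : (entropy (blockLaw Q W e f) fun ω => (ω.2.1 i, auxVar i ω)) =
      entropy (blockLaw Q W e f) fun ω => (auxVar i ω, ω.2.1 i) :=
    entropy_congr fun ω ω' => by simp [and_comm]
  rw [Finset.sum_comm] at h2
  unfold rate
  simp only [tsum_fintype, outProb_timeLaw Q W e hf, auxProb_timeLaw, sum_timeLaw]
  simp only [sum_law_left]
  simp only [law_blockLaw_state Q W e f hM] at h2
  simp only [mul_comm (law _ (auxVar i) _) (ENNReal.toReal _)]
  rw [h1, h2, h3]
  ring

/-- The converse for a block: the number of messages that can be told apart is bounded by the rates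
of test laws. -/
theorem block_converse [Nonempty S] [DecidableEq X₂] (hM : M ≠ 0) (hf : StrictlyCausal f)
    (d : (Fin n → Y) → Fin M) {q C : ℝ}
    (hq : ∑ ω, (if d ω.2.2 = ω.1 then blockLaw Q W e f ω else 0) = q)
    (hC : ∀ (ξ : Fin M × (Fin n → Option (S ⊕ Y)) → X₂)
      (r : S → Fin M × (Fin n → Option (S ⊕ Y)) → X₁ → ℝ),
      IsTestLaw Q ξ r → rate Q W ξ r ≤ C) :
    q * Real.log M - Real.binEntropy q ≤ n * C := by
  have hP := blockLaw_nonneg Q W e f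
  have h1 := sum_blockLaw Q W e f hM
  have h2 := fano hP h1 (fun ω => ω.1) (fun ω => ω.2.2) (law_blockLaw_message Q W e f) d hq
  have h3 := entropy_pi_le hP h1 fun ω => ω.2.2
  have h4 := entropy_blockLaw_message_states Q W e f hM
  have h5 := entropy_hybrid_sub (blockLaw Q W e f)
  have h6 : ∑ i : Fin n, rate Q W (timeInput f i) (timeLaw Q W e f i) ≤ ∑ _i : Fin n, C :=
    Finset.sum_le_sum fun i _ => hC _ _ (isTestLaw_timeLaw Q W e hM hf i)
  simp only [rate_timeLaw Q W e hM hf, Finset.sum_sub_distrib, Finset.sum_const, Finset.card_univ,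
    Fintype.card_fin, nsmul_eq_mul] at h6 h5
  -- In Fano's bound H(W) + H(Yⁿ) - H(W,Yⁿ), subadditivity replaces H(Yⁿ) by the sum of the H(Y_i),
  -- and H(W) is H(W,Sⁿ) minus the sum of the H(S_i). Telescoping the remaining difference leaves
  -- the sum of the single-letter rates.
  linarith

end BlockConverse

/-! ### Converse for codes -/

section CodeConverse

variable {S X₁ X₂ Y : Type*} [Fintype S] [Fintype X₁] [Fintype X₂] {Mc M₁ n : ℕ}

/-- Asking only for the common message can only raise the success probability, and some individual
message does at least as well as the average. Fixing it leaves a code to which `block_converse`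
applies. -/
theorem Code.converse_of_fintype [Fintype Y] [DecidableEq X₂] (c : Code S X₁ X₂ Y Mc M₁ n)
    (Q : PMF S) (W : X₁ → X₂ → S → PMF Y) (hc : Mc ≠ 0) (h₁ : M₁ ≠ 0) {C : ℝ}
    (hC : ∀ (ξ : Fin Mc × (Fin n → Option (S ⊕ Y)) → X₂)
      (r : S → Fin Mc × (Fin n → Option (S ⊕ Y)) → X₁ → ℝ),
      IsTestLaw Q ξ r → rate Q W ξ r ≤ C) :
    ∃ q : ℝ, c.correctProb Q W ≤ ENNReal.ofReal q ∧ q ≤ 1 ∧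
      q * Real.log Mc - Real.binEntropy q ≤ n * C := by
  classical
  have hS : Nonempty S := Q.support_nonempty.to_subtype.map Subtype.val
  have : NeZero M₁ := ⟨h₁⟩
  set p : Fin M₁ → ℝ≥0∞ := fun w₁ => ∑ w : Fin Mc, ∑ s : Fin n → S, ∑ y : Fin n → Y,
    if (c.dec y).1 = w then (Mc : ℝ≥0∞)⁻¹ *
      ∏ i, (Q (s i) * W (c.enc₁ w w₁ s i) (c.input₂ w s i) (s i) (y i)) else 0 with hp
  obtain ⟨w₁, hw₁⟩ := Finite.exists_max p
  have hle : c.correctProb Q W ≤ p w₁ := by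
    have h2 : c.correctProb Q W ≤ ∑ w₁, (M₁ : ℝ≥0∞)⁻¹ * p w₁ := by
      simp only [Code.correctProb, tsum_fintype]
      rw [Fintype.sum_prod_type_right]
      refine Finset.sum_le_sum fun w₁ _ => ?_
      rw [hp, Finset.mul_sum]
      refine Finset.sum_le_sum fun w _ => ?_
      rw [Finset.mul_sum]
      refine Finset.sum_le_sum fun s _ => ?_
      rw [Finset.mul_sum]
      refine Finset.sum_le_sum fun y _ => ?_
      by_cases h : c.dec y = (w, w₁)
      · simp only [h, if_true, Code.jointProb]
        rw [← mul_assoc, mul_comm (M₁ : ℝ≥0∞)⁻¹]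
      · rw [if_neg h]; exact zero_le
    refine h2.trans ((Finset.sum_le_sum fun w _ => mul_le_mul_right (hw₁ w) _).trans_eq ?_)
    rw [Finset.sum_const, Finset.card_univ, Fintype.card_fin, nsmul_eq_mul, ← mul_assoc,
      ENNReal.mul_inv_cancel (by simpa using h₁) (ENNReal.natCast_ne_top _), one_mul]
  set P := blockLaw Q W (fun w s => c.enc₁ w w₁ s) c.input₂ with hP
  refine ⟨∑ ω, if (c.dec ω.2.2).1 = ω.1 then P ω else 0, hle.trans_eq ?_, ?_,
    block_converse Q W _ hc ?_ (fun y => (c.dec y).1) rfl hC⟩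
  · rw [ENNReal.ofReal_sum_of_nonneg fun ω _ => by
      split_ifs
      exacts [blockLaw_nonneg Q W _ _ ω, le_rfl], Fintype.sum_prod_type]
    refine Finset.sum_congr rfl fun w _ => ?_
    rw [Fintype.sum_prod_type]
    refine Finset.sum_congr rfl fun s _ => Finset.sum_congr rfl fun y _ => ?_
    split_ifs
    · rw [hP, blockLaw, ← Finset.prod_mul_distrib, ENNReal.ofReal_mul (by positivity),
        ENNReal.ofReal_prod_of_nonneg fun i _ =>
          mul_nonneg ENNReal.toReal_nonneg ENNReal.toReal_nonneg,
        ENNReal.ofReal_inv_of_pos (by positivity), ENNReal.ofReal_natCast]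
      congr 1
      refine Finset.prod_congr rfl fun i _ => ?_
      rw [ENNReal.ofReal_mul ENNReal.toReal_nonneg, ENNReal.ofReal_toReal (PMF.apply_ne_top _ _),
        ENNReal.ofReal_toReal (PMF.apply_ne_top _ _)]
    · simp
  · rw [← sum_blockLaw Q W (fun w s => c.enc₁ w w₁ s) c.input₂ hc]
    refine Finset.sum_le_sum fun ω _ => ?_
    split_ifs
    exacts [le_rfl, blockLaw_nonneg Q W _ _ ω]
  · intro w i s s' h
    exact congrArg (c.enc₂ i w) (funext fun j => h _ j.2)

/-- The converse: a bound on the rates of all test laws bounds the common rate of every code. -/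
theorem IsAchievable.le_of_rateFunctional_le [Nonempty X₁] [Nonempty X₂] {Q : PMF S}
    {W : X₁ → X₂ → S → PMF Y} {R : ℝ × ℝ} (hR : IsAchievable Q W R) {C : ℝ}
    (hC : ∀ (k : ℕ) (P₂ : PMF X₂) (K : S → X₂ → PMF (Fin k × X₁)),
      rateFunctional (jointLaw Q W P₂ K) ≤ C) : R.1 ≤ C := by
  classical
  have hS : Nonempty S := Q.support_nonempty.to_subtype.map Subtype.val
  have hY : Nonempty Y := (W (Classical.arbitrary X₁) (Classical.arbitrary X₂)
    (Classical.arbitrary S)).support_nonempty.to_subtype.map Subtype.val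
  obtain ⟨hR1, -, hR⟩ := hR
  have hlog : 0 < Real.log 2 := Real.log_pos one_lt_two
  have key : ∀ δ : ℝ, 0 < δ → δ < 1 → ∃ q : ℝ, 1 - δ ≤ q ∧ q ≤ 1 ∧
      q * (R.1 * Real.log 2) - Real.binEntropy q ≤ C * Real.log 2 := by
    intro δ hδ hδ1
    -- Half of δ leaves the strict inequality that quantization of the output needs.
    obtain ⟨n, hn, c, hc⟩ := hR (δ / 2) (half_pos hδ)
    have hMc : ⌈(2 : ℝ) ^ ((n : ℝ) * R.1)⌉₊ ≠ 0 := (Nat.ceil_pos.2 (by positivity)).ne'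
    have hM₁ : ⌈(2 : ℝ) ^ ((n : ℝ) * R.2)⌉₊ ≠ 0 := (Nat.ceil_pos.2 (by positivity)).ne'
    have hsum := c.errorProb_add_correctProb Q W hMc hM₁
    have hlt : ENNReal.ofReal (1 - δ) < c.correctProb Q W := by
      by_contra hcon
      have h1 : (1 : ℝ≥0∞) ≤ ENNReal.ofReal (δ / 2) + ENNReal.ofReal (1 - δ) :=
        hsum ▸ add_le_add hc (not_lt.1 hcon)
      rw [← ENNReal.ofReal_add (by linarith) (by linarith), ENNReal.one_le_ofReal] at h1
      linarith
    obtain ⟨T, c', hc'⟩ := c.exists_quantize Q W hlt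
    obtain ⟨q, hq, hq1, hqC⟩ := c'.converse_of_fintype Q (mapChannel W (quantize T)) hMc hM₁
      (C := C * Real.log 2) fun ξ r hr => by
        obtain ⟨k, P₂, K, hK⟩ := hr.exists_rateFunctional_eq W
        refine (rate_mapChannel_le Q W (quantize T) ξ hr.nonneg).trans ?_
        rw [← div_le_iff₀ hlog, ← hK]
        exact hC k P₂ K
    have hq0 : 1 - δ < q := by
      by_contra hcon
      exact (hc'.trans_le hq).not_ge (ENNReal.ofReal_le_ofReal (not_lt.1 hcon))
    refine ⟨q, hq0.le, hq1, ?_⟩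
    have h0 : 0 ≤ q := by linarith
    have h1 : (n : ℝ) * R.1 * Real.log 2 ≤ Real.log (⌈(2 : ℝ) ^ ((n : ℝ) * R.1)⌉₊ : ℝ) := by
      rw [← Real.log_rpow two_pos]
      exact Real.log_le_log (by positivity) (Nat.le_ceil _)
    have h2 := mul_le_mul_of_nonneg_left h1 h0
    have h3 := Real.binEntropy_nonneg h0 hq1
    have hn1 : (1 : ℝ) ≤ n := by exact_mod_cast hn
    -- The block length need not grow: n ≥ 1 is enough, because the entropy term itself vanishes as
    -- q tends to 1.
    have h4 : Real.binEntropy q ≤ n * Real.binEntropy q := le_mul_of_one_le_left h3 hn1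
    have h5 : (n : ℝ) * (q * (R.1 * Real.log 2) - Real.binEntropy q) ≤ n * (C * Real.log 2) := by
      linarith
    exact le_of_mul_le_mul_left h5 (by linarith)
  by_contra hcon
  -- A rate above C violates the bound at q = 1, hence by continuity for all q near 1, while `key`
  -- supplies such q.
  have hlt : C * Real.log 2 < 1 * (R.1 * Real.log 2) - Real.binEntropy 1 := by
    rw [Real.binEntropy_one, one_mul, sub_zero]
    exact mul_lt_mul_of_pos_right (not_le.1 hcon) hlog
  have hcont : Continuous fun q : ℝ => q * (R.1 * Real.log 2) - Real.binEntropy q :=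
    (continuous_id.mul continuous_const).sub Real.binEntropy_continuous
  obtain ⟨δ, hδ, hball⟩ := Metric.eventually_nhds_iff.1
    (hcont.continuousAt.eventually (lt_mem_nhds hlt))
  obtain ⟨q, hq1, hq2, hq3⟩ := key (min (δ / 2) (1 / 2)) (by positivity)
    ((min_le_right _ _).trans_lt (by norm_num))
  refine (hball (y := q) ?_).not_ge hq3
  rw [Real.dist_eq, abs_lt]
  have := min_le_left (δ / 2) (1 / 2)
  constructor <;> linarith

end CodeConverse

/-! ### Expected shares in a random codebook -/

section RandomCoding

/-- The tangent of the convex function 1/X at m, taken at X = β + B. It is linear in B, so only the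
mean of B enters the expectation. -/
theorem div_add_ge_tangent {β B m : ℝ} (hβ : 0 ≤ β) (hB : 0 ≤ B) (hm : 0 < m) :
    β / m ^ 2 * (2 * m - β - B) ≤ β / (β + B) := by
  rcases hβ.eq_or_lt with rfl | hβ
  · simp
  · have hX : 0 < β + B := by linarith
    rw [div_mul_eq_mul_div, div_le_div_iff₀ (by positivity) hX]
    nlinarith [mul_nonneg hβ.le (sq_nonneg (m - (β + B)))]

variable {ι C : Type*} [Fintype ι] [DecidableEq ι] [Fintype C] {ρ : C → ℝ}

theorem sum_prod_mul_apply (h1 : ∑ z, ρ z = 1) (w : ι) (φ : C → ℝ) :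
    ∑ c : ι → C, (∏ i, ρ (c i)) * φ (c w) = ∑ z, ρ z * φ z := by
  have h := sum_prod_mul_split (fun _ : ι => ρ) w h1 φ (fun _ => 1) fun _ _ _ => rfl
  simp only [mul_one] at h
  rw [h, sum_pi_prod fun _ => ρ, h1, Finset.prod_const_one, mul_one]

theorem sum_prod_mul_apply₂ (h1 : ∑ z, ρ z = 1) {w w' : ι} (hw : w' ≠ w) (φ ψ : C → ℝ) :
    ∑ c : ι → C, (∏ i, ρ (c i)) * (φ (c w) * ψ (c w')) =
      (∑ z, ρ z * φ z) * ∑ z, ρ z * ψ z := by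
  rw [sum_prod_mul_split (fun _ : ι => ρ) w h1 φ (fun c => ψ (c w'))
    fun a b h => by rw [h w' hw], sum_prod_mul_apply h1]

/-- The expected share of one member of a family of independent identically distributed letters,
bounded below with Jensen's inequality. -/
theorem sum_prod_mul_share_ge (h0 : ∀ z, 0 ≤ ρ z) (h1 : ∑ z, ρ z = 1) (w : ι) {α β g : C → ℝ}
    {γ : ℝ} (hα : ∀ z, 0 ≤ α z) (hβ : ∀ z, 0 ≤ β z) (hg : ∀ z, 0 ≤ g z) (hγ : 0 < γ)
    (hgγ : ∑ z, ρ z * g z ≤ γ) :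
    ∑ z, ρ z * (α z * (β z / (β z + Fintype.card ι * γ))) ≤
      ∑ c : ι → C, (∏ i, ρ (c i)) *
        (α (c w) * (β (c w) / (β (c w) + ∑ i ∈ Finset.univ.erase w, g (c i)))) := by
  have hι : (0 : ℝ) < Fintype.card ι := by exact_mod_cast Fintype.card_pos_iff.2 ⟨w⟩
  -- K bounds the expected total of the competitors, and the tangent point is β + K. There 2(β + K)
  -- - β - K = β + K, which leaves exactly the share β / (β + K).
  set K : ℝ := Fintype.card ι * γ with hK
  have hKpos : 0 < K := by positivity
  have hm : ∀ z, 0 < β z + K := fun z => by linarith [hβ z]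
  set φ : C → ℝ := fun z => α z * (β z / (β z + K) ^ 2) with hφ
  have hφ0 : ∀ z, 0 ≤ φ z := fun z => mul_nonneg (hα z) (div_nonneg (hβ z) (sq_nonneg _))
  have hpt : ∀ c : ι → C, (∏ i, ρ (c i)) * (φ (c w) * (2 * (β (c w) + K) - β (c w))) -
      ∑ i ∈ Finset.univ.erase w, (∏ i, ρ (c i)) * (φ (c w) * g (c i)) ≤ (∏ i, ρ (c i)) *
        (α (c w) * (β (c w) / (β (c w) + ∑ i ∈ Finset.univ.erase w, g (c i)))) := by
    intro c
    have h := div_add_ge_tangent (hβ (c w))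
      (Finset.sum_nonneg (s := Finset.univ.erase w) fun i _ => hg (c i)) (hm (c w))
    have h2 := mul_le_mul_of_nonneg_left (mul_le_mul_of_nonneg_left h (hα (c w)))
      (Finset.prod_nonneg (s := Finset.univ) fun i _ => h0 (c i))
    refine le_trans (le_of_eq ?_) h2
    simp only [← Finset.mul_sum, hφ]
    ring
  refine le_trans ?_ (Finset.sum_le_sum fun c _ => hpt c)
  rw [Finset.sum_sub_distrib, Finset.sum_comm,
    sum_prod_mul_apply h1 w fun z => φ z * (2 * (β z + K) - β z),
    Finset.sum_congr rfl fun i hi => sum_prod_mul_apply₂ h1 (Finset.ne_of_mem_erase hi) φ g,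
    Finset.sum_const, nsmul_eq_mul]
  have h3 : ((Finset.univ.erase w).card : ℝ) * ((∑ z, ρ z * φ z) * ∑ z, ρ z * g z) ≤
      Fintype.card ι * ((∑ z, ρ z * φ z) * γ) := by
    have h5 : 0 ≤ ∑ z, ρ z * φ z := Finset.sum_nonneg fun z _ => mul_nonneg (h0 z) (hφ0 z)
    have h4 : ((Finset.univ.erase w).card : ℝ) ≤ Fintype.card ι := by
      exact_mod_cast Finset.card_le_univ _
    refine mul_le_mul h4 (mul_le_mul_of_nonneg_left hgγ h5) (mul_nonneg h5 ?_) hι.le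
    exact Finset.sum_nonneg fun z _ => mul_nonneg (h0 z) (hg z)
  refine le_trans (le_of_eq ?_) (sub_le_sub_left h3 _)
  rw [mul_left_comm, ← hK, Finset.sum_mul, ← Finset.sum_sub_distrib]
  refine Finset.sum_congr rfl fun z _ => ?_
  simp only [hφ]
  have := (hm z).ne'
  field_simp
  ring

end RandomCoding

/-! ### One-shot random coding with randomized encoder and decoder -/

section OneShot

theorem share_mono {x x' B : ℝ} (hx : 0 ≤ x) (hxx : x ≤ x') (hB : 0 ≤ B) :
    x / (x + B) ≤ x' / (x' + B) := by
  rcases hx.eq_or_lt with rfl | hx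
  · rw [zero_div]; exact div_nonneg hxx (add_nonneg hxx hB)
  · rw [div_le_div_iff₀ (by linarith) (by linarith)]
    nlinarith [mul_le_mul_of_nonneg_right hxx hB]

variable {S X₁ X₂ U Y : Type*} [Fintype S] [Fintype X₁] [Fintype X₂] [Fintype U] [Fintype Y]

/-- A random coding bound for a single use of a channel: the average probability of correct decoding
of `M` messages, with `J` auxiliary letters for each message. -/
theorem exists_one_shot_code [Nonempty X₁] {M J : ℕ} (hM : M ≠ 0) (hJ : J ≠ 0)
    {P₂ : X₂ → ℝ} {κ : X₂ → U → ℝ} {a : X₂ → U → S → ℝ} {b : X₂ → U → Y → ℝ} {Q : S → ℝ}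
    {θ : X₂ → U → S → X₁ → ℝ} {W : X₁ → X₂ → S → Y → ℝ}
    (hP0 : ∀ x, 0 ≤ P₂ x) (hP1 : ∑ x, P₂ x = 1) (hκ0 : ∀ x u, 0 ≤ κ x u)
    (hκ1 : ∀ x, ∑ u, κ x u = 1) (ha0 : ∀ x u s, 0 ≤ a x u s)
    (ha1 : ∀ x s, ∑ u, κ x u * a x u s ≤ 1) (hb0 : ∀ x u y, 0 ≤ b x u y)
    (hb1 : ∀ y, ∑ x, P₂ x * ∑ u, κ x u * b x u y ≤ 1) (hQ0 : ∀ s, 0 ≤ Q s)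
    (hθ0 : ∀ x u s t, 0 ≤ θ x u s t) (hθ1 : ∀ x u s, ∑ t, θ x u s t ≤ 1)
    (hW0 : ∀ t x s y, 0 ≤ W t x s y) :
    ∃ (f : Fin M → X₂) (e : Fin M → S → X₁) (d : Y → Fin M),
      ∑ x, P₂ x * ∑ u, κ x u * ∑ s, ∑ t, ∑ y, Q s * θ x u s t * W t x s y *
          (J * (a x u s / (a x u s + J))) * (b x u y / (b x u y + M * J)) ≤
        (M : ℝ)⁻¹ * ∑ w, ∑ s, Q s * ∑ y, if d y = w then W (e w s) (f w) s y else 0 := by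
  classical
  have : NeZero M := ⟨hM⟩
  have hJ0 : (0 : ℝ) < J := by exact_mod_cast Nat.pos_of_ne_zero hJ
  -- ρ is the law of a codeword: a second input and J auxiliary letters, conditionally independent
  -- given it. The encoder `k` picks index j with probability a / A and then a first input by θ; the
  -- decoder picks w with probability N / D. `val` is the resulting success probability.
  set ρ : X₂ × (Fin J → U) → ℝ := fun z => P₂ z.1 * ∏ j, κ z.1 (z.2 j) with hρ
  set A : X₂ × (Fin J → U) → S → ℝ := fun z s => ∑ j, a z.1 (z.2 j) s with hA
  set N : X₂ × (Fin J → U) → Y → ℝ := fun z y => ∑ j, b z.1 (z.2 j) y with hN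
  set k : X₂ × (Fin J → U) → S → X₁ → ℝ := fun z s t =>
    ∑ j, a z.1 (z.2 j) s / A z s * θ z.1 (z.2 j) s t with hk
  set D : (Fin M → X₂ × (Fin J → U)) → Y → ℝ := fun c y => ∑ w, N (c w) y with hD
  set val : (Fin M → X₂ × (Fin J → U)) → ℝ := fun c => (M : ℝ)⁻¹ * ∑ w, ∑ s, Q s *
    ∑ t, k (c w) s t * ∑ y, W t (c w).1 s y * (N (c w) y / D c y) with hval
  have hρ0 : ∀ z, 0 ≤ ρ z := fun z =>
    mul_nonneg (hP0 _) (Finset.prod_nonneg fun _ _ => hκ0 _ _)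
  have hρ1 : ∑ z, ρ z = 1 := by
    rw [Fintype.sum_prod_type]
    simp only [hρ, ← Finset.mul_sum]
    rw [← hP1]
    refine Finset.sum_congr rfl fun x _ => ?_
    rw [sum_pi_prod fun _ => κ x]
    simp [hκ1]
  have hA0 : ∀ z s, 0 ≤ A z s := fun z s => Finset.sum_nonneg fun _ _ => ha0 _ _ _
  have hN0 : ∀ z y, 0 ≤ N z y := fun z y => Finset.sum_nonneg fun _ _ => hb0 _ _ _
  have hD0 : ∀ c y, 0 ≤ D c y := fun c y => Finset.sum_nonneg fun _ _ => hN0 _ _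
  have hk0 : ∀ z s t, 0 ≤ k z s t := fun z s t =>
    Finset.sum_nonneg fun _ _ => mul_nonneg (div_nonneg (ha0 _ _ _) (hA0 _ _)) (hθ0 _ _ _ _)
  have hk1 : ∀ z s, ∑ t, k z s t ≤ 1 := fun z s => by
    simp only [hk]
    rw [Finset.sum_comm]
    calc ∑ j, ∑ t, a z.1 (z.2 j) s / A z s * θ z.1 (z.2 j) s t
        ≤ ∑ j, a z.1 (z.2 j) s / A z s := Finset.sum_le_sum fun j _ => by
          rw [← Finset.mul_sum]
          exact mul_le_of_le_one_right (div_nonneg (ha0 _ _ _) (hA0 _ _)) (hθ1 _ _ _)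
      _ = A z s / A z s := by rw [← Finset.sum_div]
      _ ≤ 1 := div_self_le_one _
  have hD1 : ∀ c y, ∑ w, N (c w) y / D c y ≤ 1 := fun c y => by
    rw [← Finset.sum_div]
    exact div_self_le_one _
  -- First the encoder is replaced by a best letter for each message and state, with the decoder
  -- still randomized; then the decoder by a best message for each output.
  have derandomize : ∀ c, ∃ (e : Fin M → S → X₁) (d : Y → Fin M), val c ≤ (M : ℝ)⁻¹ *
      ∑ w, ∑ s, Q s * ∑ y, if d y = w then W (e w s) (c w).1 s y else 0 := by
    intro c
    have he : ∀ w s, ∃ t, ∑ t, k (c w) s t * ∑ y, W t (c w).1 s y * (N (c w) y / D c y) ≤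
        ∑ y, W t (c w).1 s y * (N (c w) y / D c y) := fun w s =>
      exists_ge_weighted_sum (fun t => hk0 _ _ t) (hk1 _ _) fun t => Finset.sum_nonneg fun y _ =>
        mul_nonneg (hW0 _ _ _ _) (div_nonneg (hN0 _ _) (hD0 _ _))
    choose e he using he
    have hd : ∀ y, ∃ w, ∑ w, N (c w) y / D c y * ∑ s, Q s * W (e w s) (c w).1 s y ≤
        ∑ s, Q s * W (e w s) (c w).1 s y := fun y =>
      exists_ge_weighted_sum (fun w => div_nonneg (hN0 _ _) (hD0 _ _)) (hD1 c y)
        fun w => Finset.sum_nonneg fun s _ => mul_nonneg (hQ0 s) (hW0 _ _ _ _)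
    choose d hd using hd
    refine ⟨e, d, mul_le_mul_of_nonneg_left ?_ (by positivity)⟩
    calc ∑ w, ∑ s, Q s * ∑ t, k (c w) s t * ∑ y, W t (c w).1 s y * (N (c w) y / D c y)
        ≤ ∑ w, ∑ s, Q s * ∑ y, W (e w s) (c w).1 s y * (N (c w) y / D c y) :=
          Finset.sum_le_sum fun w _ => Finset.sum_le_sum fun s _ =>
            mul_le_mul_of_nonneg_left (he w s) (hQ0 s)
      _ = ∑ y, ∑ w, N (c w) y / D c y * ∑ s, Q s * W (e w s) (c w).1 s y := by
          rw [Finset.sum_comm (s := (Finset.univ : Finset Y))]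
          refine Finset.sum_congr rfl fun w _ => ?_
          simp only [Finset.mul_sum]
          rw [Finset.sum_comm]
          exact Finset.sum_congr rfl fun y _ => Finset.sum_congr rfl fun s _ => by ring
      _ ≤ ∑ y, ∑ s, Q s * W (e (d y) s) (c (d y)).1 s y := Finset.sum_le_sum fun y _ => hd y
      _ = ∑ w, ∑ s, Q s * ∑ y, if d y = w then W (e w s) (c w).1 s y else 0 := by
          simp only [Finset.mul_sum]
          refine Eq.symm ((Finset.sum_congr rfl fun w _ => Finset.sum_comm).trans
            (Finset.sum_comm.trans (Finset.sum_congr rfl fun y _ => ?_)))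
          rw [Finset.sum_eq_single (d y) (fun w _ h => by simp [h.symm]) (by simp)]
          simp
  -- For a fixed message and index, Jensen is applied twice: over the codewords of the other
  -- messages (mean at most J each), and over the other auxiliary letters of the same codeword (mean
  -- at most 1 each).
  have hone : ∀ (w : Fin M) (j : Fin J) (s : S) (t : X₁) (y : Y),
      ∑ x, P₂ x * ∑ u, κ x u * ((Q s * θ x u s t * W t x s y * (b x u y / (b x u y + M * J))) *
        (a x u s / (a x u s + J))) ≤
      ∑ c : Fin M → X₂ × (Fin J → U), (∏ i, ρ (c i)) *
        ((Q s * (a (c w).1 ((c w).2 j) s / A (c w) s * θ (c w).1 ((c w).2 j) s t) *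
          W t (c w).1 s y) * (N (c w) y / D c y)) := by
    intro w j s t y
    set α : X₂ × (Fin J → U) → ℝ := fun z =>
      Q s * (a z.1 (z.2 j) s / A z s * θ z.1 (z.2 j) s t) * W t z.1 s y with hα
    have hα0 : ∀ z, 0 ≤ α z := fun z => mul_nonneg (mul_nonneg (hQ0 s)
      (mul_nonneg (div_nonneg (ha0 _ _ _) (hA0 _ _)) (hθ0 _ _ _ _))) (hW0 _ _ _ _)
    have hNJ : ∑ z, ρ z * N z y ≤ J := by
      rw [Fintype.sum_prod_type]
      have : ∀ x, ∑ u : Fin J → U, ρ (x, u) * N (x, u) y = J * (P₂ x * ∑ u, κ x u * b x u y) := by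
        intro x
        simp only [hρ, hN, mul_assoc, ← Finset.mul_sum]
        simp only [Finset.mul_sum (Finset.univ : Finset (Fin J))]
        rw [Finset.sum_comm, Finset.sum_congr rfl fun j _ =>
          sum_prod_mul_apply (hκ1 x) j fun u => b x u y]
        rw [Finset.sum_const, Finset.card_univ, Fintype.card_fin, nsmul_eq_mul, mul_left_comm]
      simp only [this, ← Finset.mul_sum]
      exact mul_le_of_le_one_right hJ0.le (hb1 y)
    have hdec := sum_prod_mul_share_ge (ι := Fin M) hρ0 hρ1 w (α := α)
      (β := fun z => b z.1 (z.2 j) y) (g := fun z => N z y) hα0 (fun z => hb0 _ _ _)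
      (fun z => hN0 z y) hJ0 hNJ
    have henc : ∑ x, P₂ x * ∑ u, κ x u * ((Q s * θ x u s t * W t x s y *
        (b x u y / (b x u y + M * J))) * (a x u s / (a x u s + J))) ≤
        ∑ z, ρ z * (α z * (b z.1 (z.2 j) y / (b z.1 (z.2 j) y + M * J))) := by
      rw [Fintype.sum_prod_type]
      refine Finset.sum_le_sum fun x _ => ?_
      simp only [hρ, mul_assoc (P₂ x), ← Finset.mul_sum]
      refine mul_le_mul_of_nonneg_left ?_ (hP0 x)
      have h := sum_prod_mul_share_ge (ι := Fin J) (hκ0 x) (hκ1 x) j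
        (α := fun u => Q s * θ x u s t * W t x s y * (b x u y / (b x u y + M * J)))
        (β := fun u => a x u s) (g := fun u => a x u s)
        (fun u => mul_nonneg (mul_nonneg (mul_nonneg (hQ0 s) (hθ0 _ _ _ _)) (hW0 _ _ _ _))
          (div_nonneg (hb0 _ _ _) (add_nonneg (hb0 _ _ _) (by positivity))))
        (fun u => ha0 x u s) (fun u => ha0 x u s) one_pos (ha1 x s)
      simp only [Fintype.card_fin, mul_one] at h
      refine h.trans_eq (Finset.sum_congr rfl fun u _ => ?_)
      rw [Finset.add_sum_erase Finset.univ (fun i => a x (u i) s) (Finset.mem_univ j)]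
      simp only [hα, hA]
      ring
    refine henc.trans (le_trans (le_of_eq ?_) (hdec.trans ?_))
    · simp only [Fintype.card_fin]
    · refine Finset.sum_le_sum fun c _ => ?_
      refine mul_le_mul_of_nonneg_left (mul_le_mul_of_nonneg_left ?_ (hα0 _))
        (Finset.prod_nonneg fun i _ => hρ0 _)
      have hB : D c y = N (c w) y + ∑ i ∈ Finset.univ.erase w, N (c i) y :=
        (Finset.add_sum_erase Finset.univ (fun i => N (c i) y) (Finset.mem_univ w)).symm
      rw [hB]
      -- The decoder's weight for w contains the term of the chosen index j, and shares increase
      -- with the numerator.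
      exact share_mono (hb0 _ _ _) (Finset.single_le_sum (f := fun j => b (c w).1 ((c w).2 j) y)
        (fun j _ => hb0 _ _ _) (Finset.mem_univ j)) (Finset.sum_nonneg fun i _ => hN0 _ _)
  have hval0 : ∀ c, 0 ≤ val c := fun c => mul_nonneg (by positivity)
    (Finset.sum_nonneg fun w _ => Finset.sum_nonneg fun s _ => mul_nonneg (hQ0 s)
      (Finset.sum_nonneg fun t _ => mul_nonneg (hk0 _ _ _) (Finset.sum_nonneg fun y _ =>
        mul_nonneg (hW0 _ _ _ _) (div_nonneg (hN0 _ _) (hD0 _ _)))))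
  have hne : Nonempty (Fin M → X₂ × (Fin J → U)) := by
    by_contra hcon
    rw [not_nonempty_iff] at hcon
    have := sum_pi_prod fun (_ : Fin M) => ρ
    simp [hρ1] at this
  obtain ⟨c, hc⟩ := exists_ge_weighted_sum (k := fun c : Fin M → X₂ × (Fin J → U) =>
    ∏ i, ρ (c i)) (c := val) (fun c => Finset.prod_nonneg fun i _ => hρ0 _)
    (by rw [sum_pi_prod fun _ => ρ]; simp [hρ1]) hval0
  obtain ⟨e, d, hed⟩ := derandomize c
  refine ⟨fun w => (c w).1, e, d, le_trans ?_ (hc.trans hed)⟩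
  have hsum : ∑ c : Fin M → X₂ × (Fin J → U), (∏ i, ρ (c i)) * val c =
      (M : ℝ)⁻¹ * ∑ w : Fin M, ∑ j : Fin J, ∑ s, ∑ t, ∑ y,
        ∑ c : Fin M → X₂ × (Fin J → U), (∏ i, ρ (c i)) *
        ((Q s * (a (c w).1 ((c w).2 j) s / A (c w) s * θ (c w).1 ((c w).2 j) s t) *
          W t (c w).1 s y) * (N (c w) y / D c y)) := by
    have hv : ∀ c : Fin M → X₂ × (Fin J → U), (∏ i, ρ (c i)) * val c =
        ∑ w : Fin M, ∑ j : Fin J, ∑ s, ∑ t, ∑ y, (M : ℝ)⁻¹ * ((∏ i, ρ (c i)) *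
        ((Q s * (a (c w).1 ((c w).2 j) s / A (c w) s * θ (c w).1 ((c w).2 j) s t) *
          W t (c w).1 s y) * (N (c w) y / D c y))) := by
      intro c
      simp only [hval, hk, Finset.mul_sum, Finset.sum_mul]
      refine Finset.sum_congr rfl fun w _ => ?_
      refine Eq.trans ?_ Finset.sum_comm
      refine Finset.sum_congr rfl fun s _ => ?_
      refine Eq.trans ?_ Finset.sum_comm
      refine Finset.sum_congr rfl fun t _ => ?_
      refine Finset.sum_comm.trans ?_
      exact Finset.sum_congr rfl fun j _ => Finset.sum_congr rfl fun y _ => by ring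
    simp only [hv, Finset.mul_sum]
    refine Finset.sum_comm.trans (Finset.sum_congr rfl fun w _ => ?_)
    refine Finset.sum_comm.trans (Finset.sum_congr rfl fun j _ => ?_)
    refine Finset.sum_comm.trans (Finset.sum_congr rfl fun s _ => ?_)
    refine Finset.sum_comm.trans (Finset.sum_congr rfl fun t _ => ?_)
    exact Finset.sum_comm
  rw [hsum]
  refine le_trans (le_of_eq ?_) (mul_le_mul_of_nonneg_left (Finset.sum_le_sum fun w _ =>
    Finset.sum_le_sum fun j _ => Finset.sum_le_sum fun s _ => Finset.sum_le_sum fun t _ =>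
      Finset.sum_le_sum fun y _ => hone w j s t y) (by positivity))
  -- The bound is the same for all w and j: M cancels the average, and J becomes the factor in the
  -- statement.
  rw [Finset.sum_const, Finset.sum_const, Finset.card_univ, Finset.card_univ, Fintype.card_fin,
    Fintype.card_fin, nsmul_eq_mul, nsmul_eq_mul, inv_mul_cancel_left₀ (by exact_mod_cast hM)]
  simp only [Finset.mul_sum]
  refine Eq.trans (Finset.sum_congr rfl fun x _ => Finset.sum_comm) ?_
  refine Finset.sum_comm.trans (Finset.sum_congr rfl fun s _ => ?_)
  refine Eq.trans (Finset.sum_congr rfl fun x _ => Finset.sum_comm) ?_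
  refine Finset.sum_comm.trans (Finset.sum_congr rfl fun t _ => ?_)
  refine Eq.trans (Finset.sum_congr rfl fun x _ => Finset.sum_comm) ?_
  refine Finset.sum_comm.trans (Finset.sum_congr rfl fun y _ => ?_)
  exact Finset.sum_congr rfl fun x _ => Finset.sum_congr rfl fun u _ => by ring

end OneShot

/-! ### Product codebooks and exponential moments -/

section Block

theorem sum_pi_prod₂ {ι A B : Type*} [Fintype ι] [DecidableEq ι] [Fintype A] [Fintype B]
    (G : ι → A → B → ℝ) :
    ∑ a : ι → A, ∑ b : ι → B, ∏ i, G i (a i) (b i) = ∏ i, ∑ a, ∑ b, G i a b := by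
  rw [← sum_pi_prod fun i a => ∑ b, G i a b]
  exact Finset.sum_congr rfl fun a _ => sum_pi_prod fun i b => G i (a i) b

/-- For x ≥ 1 the left side is nonpositive; for x < 1 use x ≤ x ^ τ. A power, unlike a share,
factors over the letters of a block. -/
theorem one_sub_rpow_le {x τ : ℝ} (hx : 0 ≤ x) (hτ : 0 < τ) (hτ1 : τ ≤ 1) :
    1 - x ^ τ ≤ 1 / (1 + x) := by
  rcases le_or_gt 1 x with h | h
  · have := Real.one_le_rpow h hτ.le
    have h2 : 0 ≤ 1 / (1 + x) := by positivity
    linarith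
  · have h1 : x ≤ x ^ τ := by
      rcases hx.eq_or_lt with rfl | hx
      · exact Real.rpow_nonneg le_rfl _
      · simpa using Real.rpow_le_rpow_of_exponent_ge hx h.le hτ1
    have h2 : 1 - x ≤ 1 / (1 + x) := by
      rw [le_div_iff₀ (by linarith)]
      nlinarith
    linarith

/-- A union bound: p q ≥ p + q - 1 for shares p, q ≤ 1, each bounded by `one_sub_rpow_le`. -/
theorem share_mul_share_ge {A B J K τ : ℝ} (hA : 0 ≤ A) (hB : 0 < B) (hJ : 0 < J) (hK : 0 < K)
    (hτ : 0 < τ) (hτ1 : τ ≤ 1) :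
    1 - A ^ τ / J ^ τ - K ^ τ * B ^ (-τ) ≤ J / (A + J) * (B / (B + K)) := by
  have h1 := one_sub_rpow_le (div_nonneg hA hJ.le) hτ hτ1
  have h2 := one_sub_rpow_le (div_nonneg hK.le hB.le) hτ hτ1
  rw [Real.div_rpow hA hJ.le] at h1
  rw [Real.div_rpow hK.le hB.le, div_eq_mul_inv, ← Real.rpow_neg hB.le] at h2
  have e1 : 1 / (1 + A / J) = J / (A + J) := by field_simp; ring
  have e2 : 1 / (1 + K / B) = B / (B + K) := by field_simp
  rw [e1] at h1
  rw [e2] at h2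
  have h3 : J / (A + J) ≤ 1 := div_le_one_of_le₀ (by linarith) (by linarith)
  have h4 : B / (B + K) ≤ 1 := div_le_one_of_le₀ (by linarith) (by linarith)
  nlinarith [mul_nonneg (sub_nonneg.2 h3) (sub_nonneg.2 h4)]

variable {S X₁ X₂ U Y : Type*} [Fintype S] [Fintype X₁] [Fintype X₂] [Fintype U] [Fintype Y]

theorem sum_pi_prod₅ {n : ℕ} (G : X₂ → U → S → X₁ → Y → ℝ) :
    ∑ x : Fin n → X₂, ∑ u : Fin n → U, ∑ s : Fin n → S, ∑ t : Fin n → X₁, ∑ y : Fin n → Y,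
      ∏ i, G (x i) (u i) (s i) (t i) (y i) =
      (∑ x, ∑ u, ∑ s, ∑ t, ∑ y, G x u s t y) ^ n := by
  have h1 : ∀ (x : Fin n → X₂) (u : Fin n → U) (s : Fin n → S),
      ∑ t : Fin n → X₁, ∑ y : Fin n → Y, ∏ i, G (x i) (u i) (s i) (t i) (y i) =
        ∏ i, ∑ t, ∑ y, G (x i) (u i) (s i) t y := fun x u s =>
    sum_pi_prod₂ fun i t y => G (x i) (u i) (s i) t y
  have h2 : ∀ x : Fin n → X₂, ∑ u : Fin n → U, ∑ s : Fin n → S,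
      ∏ i, ∑ t, ∑ y, G (x i) (u i) (s i) t y = ∏ i, ∑ u, ∑ s, ∑ t, ∑ y, G (x i) u s t y :=
    fun x => sum_pi_prod₂ fun i u s => ∑ t, ∑ y, G (x i) u s t y
  simp only [h1, h2]
  rw [sum_pi_prod fun (_ : Fin n) x => ∑ u, ∑ s, ∑ t, ∑ y, G x u s t y]
  simp

/-- A random coding bound for `n` uses of a memoryless channel. -/
theorem exists_block_code [Nonempty X₁] {M J : ℕ} (hM : M ≠ 0) (hJ : J ≠ 0) (n : ℕ)
    {P₂ : X₂ → ℝ} {κ : X₂ → U → ℝ} {a : X₂ → U → S → ℝ} {b : X₂ → U → Y → ℝ} {Q : S → ℝ}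
    {θ : X₂ → U → S → X₁ → ℝ} {W : X₁ → X₂ → S → Y → ℝ}
    (hP0 : ∀ x, 0 ≤ P₂ x) (hP1 : ∑ x, P₂ x = 1) (hκ0 : ∀ x u, 0 ≤ κ x u)
    (hκ1 : ∀ x, ∑ u, κ x u = 1) (ha0 : ∀ x u s, 0 ≤ a x u s)
    (ha1 : ∀ x s, ∑ u, κ x u * a x u s ≤ 1) (hb0 : ∀ x u y, 0 ≤ b x u y)
    (hb1 : ∀ y, ∑ x, P₂ x * ∑ u, κ x u * b x u y ≤ 1) (hQ0 : ∀ s, 0 ≤ Q s)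
    (hθ0 : ∀ x u s t, 0 ≤ θ x u s t) (hθ1 : ∀ x u s, ∑ t, θ x u s t ≤ 1)
    (hW0 : ∀ t x s y, 0 ≤ W t x s y) {L : X₂ → U → S → X₁ → Y → ℝ}
    (hL : ∀ x u s t y, L x u s t y = P₂ x * (κ x u * (Q s * θ x u s t * W t x s y * a x u s)))
    (hL1 : ∑ x, ∑ u, ∑ s, ∑ t, ∑ y, L x u s t y = 1)
    (hLb : ∀ x u s t y, b x u y = 0 → L x u s t y = 0) {τ : ℝ} (hτ : 0 < τ) (hτ1 : τ ≤ 1) :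
    ∃ (f : Fin M → Fin n → X₂) (e : Fin M → (Fin n → S) → Fin n → X₁)
      (d : (Fin n → Y) → Fin M),
      1 - (∑ x, ∑ u, ∑ s, ∑ t, ∑ y, L x u s t y * a x u s ^ τ) ^ n / (J : ℝ) ^ τ -
        (M * J : ℝ) ^ τ * (∑ x, ∑ u, ∑ s, ∑ t, ∑ y, L x u s t y * b x u y ^ (-τ)) ^ n ≤
      (M : ℝ)⁻¹ * ∑ w, ∑ s : Fin n → S, (∏ i, Q (s i)) *
        ∑ y : Fin n → Y, if d y = w then ∏ i, W (e w s i) (f w i) (s i) (y i) else 0 := by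
  have hJ0 : (0 : ℝ) < J := by exact_mod_cast Nat.pos_of_ne_zero hJ
  have hM0 : (0 : ℝ) < M := by exact_mod_cast Nat.pos_of_ne_zero hM
  obtain ⟨f, e, d, h⟩ := exists_one_shot_code (S := Fin n → S) (X₁ := Fin n → X₁)
    (X₂ := Fin n → X₂) (U := Fin n → U) (Y := Fin n → Y) hM hJ (P₂ := fun x => ∏ i, P₂ (x i))
    (κ := fun x u => ∏ i, κ (x i) (u i)) (a := fun x u s => ∏ i, a (x i) (u i) (s i))
    (b := fun x u y => ∏ i, b (x i) (u i) (y i)) (Q := fun s => ∏ i, Q (s i))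
    (θ := fun x u s t => ∏ i, θ (x i) (u i) (s i) (t i))
    (W := fun t x s y => ∏ i, W (t i) (x i) (s i) (y i))
    (fun _ => Finset.prod_nonneg fun _ _ => hP0 _) (by rw [sum_pi_prod fun _ => P₂]; simp [hP1])
    (fun _ _ => Finset.prod_nonneg fun _ _ => hκ0 _ _)
    (fun x => by rw [sum_pi_prod fun i => κ (x i)]; simp [hκ1])
    (fun _ _ _ => Finset.prod_nonneg fun _ _ => ha0 _ _ _)
    (fun x s => by
      simp only [← Finset.prod_mul_distrib]
      rw [sum_pi_prod fun i u => κ (x i) u * a (x i) u (s i)]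
      exact Finset.prod_le_one (fun i _ => Finset.sum_nonneg fun u _ =>
        mul_nonneg (hκ0 _ _) (ha0 _ _ _)) fun i _ => ha1 _ _)
    (fun _ _ _ => Finset.prod_nonneg fun _ _ => hb0 _ _ _)
    (fun y => by
      simp only [← Finset.prod_mul_distrib, Finset.mul_sum]
      rw [sum_pi_prod₂ fun i x u => P₂ x * (κ x u * b x u (y i))]
      refine Finset.prod_le_one (fun i _ => Finset.sum_nonneg fun x _ => Finset.sum_nonneg
        fun u _ => mul_nonneg (hP0 _) (mul_nonneg (hκ0 _ _) (hb0 _ _ _))) fun i _ => ?_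
      simpa only [Finset.mul_sum] using hb1 (y i))
    (fun _ => Finset.prod_nonneg fun _ _ => hQ0 _)
    (fun _ _ _ _ => Finset.prod_nonneg fun _ _ => hθ0 _ _ _ _)
    (fun x u s => by
      rw [sum_pi_prod fun i => θ (x i) (u i) (s i)]
      exact Finset.prod_le_one (fun i _ => Finset.sum_nonneg fun t _ => hθ0 _ _ _ _)
        fun i _ => hθ1 _ _ _)
    (fun _ _ _ _ => Finset.prod_nonneg fun _ _ => hW0 _ _ _ _)
  refine ⟨f, e, d, le_trans ?_ h⟩
  have e1 := sum_pi_prod₅ (n := n) L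
  have e2 := sum_pi_prod₅ (n := n) fun x u s t y => L x u s t y * a x u s ^ τ
  have e3 := sum_pi_prod₅ (n := n) fun x u s t y => L x u s t y * b x u y ^ (-τ)
  rw [hL1, one_pow] at e1
  rw [← e1, ← e2, ← e3]
  simp only [Finset.sum_div, Finset.mul_sum, ← Finset.sum_sub_distrib]
  refine Finset.sum_le_sum fun x _ => Finset.sum_le_sum fun u _ => Finset.sum_le_sum fun s _ =>
    Finset.sum_le_sum fun t _ => Finset.sum_le_sum fun y _ => ?_
  have hA0 : 0 ≤ ∏ i, a (x i) (u i) (s i) := Finset.prod_nonneg fun _ _ => ha0 _ _ _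
  have hB0 : 0 ≤ ∏ i, b (x i) (u i) (y i) := Finset.prod_nonneg fun _ _ => hb0 _ _ _
  simp only [Finset.prod_mul_distrib]
  rw [Real.finsetProd_rpow _ _ fun i _ => ha0 _ _ _,
    Real.finsetProd_rpow _ _ fun i _ => hb0 _ _ _]
  have hΛ : ∏ i, L (x i) (u i) (s i) (t i) (y i) = (∏ i, P₂ (x i)) * ((∏ i, κ (x i) (u i)) *
      ((∏ i, Q (s i)) * (∏ i, θ (x i) (u i) (s i) (t i)) * (∏ i, W (t i) (x i) (s i) (y i)) *
        ∏ i, a (x i) (u i) (s i))) := by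
    simp only [hL, Finset.prod_mul_distrib]
  have hΛ0 : 0 ≤ ∏ i, L (x i) (u i) (s i) (t i) (y i) := Finset.prod_nonneg fun i _ => by
    rw [hL]
    exact mul_nonneg (hP0 _) (mul_nonneg (hκ0 _ _) (mul_nonneg (mul_nonneg (mul_nonneg (hQ0 _)
      (hθ0 _ _ _ _)) (hW0 _ _ _ _)) (ha0 _ _ _)))
  -- The numerator of the encoder's share is the likelihood ratio that changes the codebook law into
  -- the true joint law.
  have hrhs : (∏ i, P₂ (x i)) * ((∏ i, κ (x i) (u i)) * ((∏ i, Q (s i)) *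
      (∏ i, θ (x i) (u i) (s i) (t i)) * (∏ i, W (t i) (x i) (s i) (y i)) *
      (J * ((∏ i, a (x i) (u i) (s i)) / ((∏ i, a (x i) (u i) (s i)) + J))) *
      ((∏ i, b (x i) (u i) (y i)) / ((∏ i, b (x i) (u i) (y i)) + M * J)))) =
      (∏ i, L (x i) (u i) (s i) (t i) (y i)) * (J / ((∏ i, a (x i) (u i) (s i)) + J) *
      ((∏ i, b (x i) (u i) (y i)) / ((∏ i, b (x i) (u i) (y i)) + M * J))) := by
    rw [hΛ]; ring
  rw [hrhs]
  rcases hΛ0.eq_or_lt with h0 | h0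
  · rw [← h0]; simp
  have hB : 0 < ∏ i, b (x i) (u i) (y i) := by
    refine hB0.lt_of_ne fun h => h0.ne' ?_
    obtain ⟨i, -, hi⟩ := Finset.prod_eq_zero_iff.1 h.symm
    exact Finset.prod_eq_zero (Finset.mem_univ i) (hLb _ _ _ _ _ hi)
  have := mul_le_mul_of_nonneg_left
    (share_mul_share_ge hA0 hB hJ0 (mul_pos hM0 hJ0) hτ hτ1) h0.le
  refine le_trans (le_of_eq ?_) this
  ring

/-- The moment generating function is 1 at zero, with derivative the negative mean, so it drops
below 1 just to the right. -/
theorem eventually_sum_mul_exp_lt_one {Z : Type*} [Fintype Z] {p c : Z → ℝ} (h1 : ∑ z, p z = 1)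
    (hc : ∑ z, p z * c z < 0) :
    ∀ᶠ τ in nhdsWithin (0 : ℝ) (Set.Ioi 0), ∑ z, p z * Real.exp (τ * c z) < 1 := by
  have hd : HasDerivAt (fun τ : ℝ => ∑ z, p z * Real.exp (τ * c z)) (∑ z, p z * c z) 0 := by
    refine HasDerivAt.fun_sum fun z _ => ?_
    have := (((hasDerivAt_id (0 : ℝ)).mul_const (c z)).exp).const_mul (p z)
    simpa using this
  have hs := (hasDerivAt_iff_tendsto_slope.1 hd).eventually (gt_mem_nhds hc)
  have hs' : ∀ᶠ τ in nhdsWithin (0 : ℝ) (Set.Ioi 0),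
      slope (fun τ : ℝ => ∑ z, p z * Real.exp (τ * c z)) 0 τ < 0 :=
    hs.filter_mono (nhdsWithin_mono _ fun τ hτ => (Set.mem_Ioi.1 hτ).ne')
  filter_upwards [hs', self_mem_nhdsWithin] with τ hτ hpos
  have hpos : 0 < τ := hpos
  rw [slope_def_field, sub_zero, div_neg_iff] at hτ
  simp only [zero_mul, Real.exp_zero, mul_one, h1] at hτ
  rcases hτ with h | h
  · linarith [h.2]
  · linarith [h.1]

end Block

/-! ### Likelihood ratios and their expected logarithms -/

section Achievability

variable {S X₁ X₂ U Y : Type*} [Fintype S] [Fintype X₁] [Fintype X₂] [Fintype U]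
  (Q : PMF S) (W : X₁ → X₂ → S → PMF Y) (P₂ : PMF X₂) (K : S → X₂ → PMF (U × X₁))

/-- The conditional probability of the auxiliary letter given state and second input. -/
def condAux (x : X₂) (u : U) (s : S) : ℝ := ∑ t, (K s x (u, t)).toReal

/-- The conditional probability of the auxiliary letter given the second input. -/
def meanAux (x : X₂) (u : U) : ℝ := ∑ s, (Q s).toReal * condAux K x u s

/-- The likelihood ratio of auxiliary letter and state. -/
def stateRatio (x : X₂) (u : U) (s : S) : ℝ := condAux K x u s / meanAux Q K x u

/-- The conditional probability of the output and the auxiliary letter given the second input. -/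
def condOut (x : X₂) (u : U) (y : Y) : ℝ :=
  ∑ s, ∑ t, (Q s).toReal * (K s x (u, t)).toReal * (W t x s y).toReal

/-- The probability of the output. -/
def meanOut (y : Y) : ℝ := ∑ x, (P₂ x).toReal * ∑ u, condOut Q W K x u y

/-- The likelihood ratio of auxiliary letter and output. -/
def outRatio (x : X₂) (u : U) (y : Y) : ℝ :=
  condOut Q W K x u y / (meanAux Q K x u * meanOut Q W P₂ K y)

/-- The joint probabilities of the letters. -/
def letterLaw (x : X₂) (u : U) (s : S) (t : X₁) (y : Y) : ℝ :=
  inputLaw Q P₂ K s (u, x) t * (W t x s y).toReal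

theorem mul_div_self_le {x z : ℝ} (hz : 0 ≤ z) : x * (z / x) ≤ z := by
  rcases eq_or_ne x 0 with rfl | hx
  · simpa using hz
  · rw [mul_div_cancel₀ _ hx]

theorem condAux_nonneg (x : X₂) (u : U) (s : S) : 0 ≤ condAux K x u s :=
  Finset.sum_nonneg fun _ _ => ENNReal.toReal_nonneg

theorem sum_condAux (x : X₂) (s : S) : ∑ u, condAux K x u s = 1 := by
  have := PMF.sum_toReal (K s x)
  rwa [Fintype.sum_prod_type] at this

theorem meanAux_nonneg (x : X₂) (u : U) : 0 ≤ meanAux Q K x u :=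
  Finset.sum_nonneg fun _ _ => mul_nonneg ENNReal.toReal_nonneg (condAux_nonneg K x u _)

theorem sum_meanAux (x : X₂) : ∑ u, meanAux Q K x u = 1 := by
  simp only [meanAux]
  rw [Finset.sum_comm]
  simp only [← Finset.mul_sum, sum_condAux, mul_one, PMF.sum_toReal]

theorem condOut_nonneg (x : X₂) (u : U) (y : Y) : 0 ≤ condOut Q W K x u y :=
  Finset.sum_nonneg fun _ _ => Finset.sum_nonneg fun _ _ =>
    mul_nonneg (mul_nonneg ENNReal.toReal_nonneg ENNReal.toReal_nonneg) ENNReal.toReal_nonneg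

theorem meanOut_nonneg (y : Y) : 0 ≤ meanOut Q W P₂ K y :=
  Finset.sum_nonneg fun _ _ => mul_nonneg ENNReal.toReal_nonneg
    (Finset.sum_nonneg fun _ _ => condOut_nonneg Q W K _ _ y)

theorem stateRatio_nonneg (x : X₂) (u : U) (s : S) : 0 ≤ stateRatio Q K x u s :=
  div_nonneg (condAux_nonneg K x u s) (meanAux_nonneg Q K x u)

theorem outRatio_nonneg (x : X₂) (u : U) (y : Y) : 0 ≤ outRatio Q W P₂ K x u y :=
  div_nonneg (condOut_nonneg Q W K x u y)
    (mul_nonneg (meanAux_nonneg Q K x u) (meanOut_nonneg Q W P₂ K y))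

theorem sum_meanAux_mul_stateRatio_le (x : X₂) (s : S) :
    ∑ u, meanAux Q K x u * stateRatio Q K x u s ≤ 1 := by
  rw [← sum_condAux K x s]
  refine Finset.sum_le_sum fun u _ => ?_
  exact mul_div_self_le (condAux_nonneg K x u s)

/-- The ratio would have mean one under the codebook law; only an inequality holds in general
because a zero denominator makes it vanish. -/
theorem sum_mul_outRatio_le (y : Y) :
    ∑ x, (P₂ x).toReal * ∑ u, meanAux Q K x u * outRatio Q W P₂ K x u y ≤ 1 := by
  have h : ∀ x u, meanAux Q K x u * outRatio Q W P₂ K x u y ≤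
      condOut Q W K x u y / meanOut Q W P₂ K y := by
    intro x u
    rw [outRatio, div_mul_eq_div_div_swap]
    exact mul_div_self_le (div_nonneg (condOut_nonneg Q W K x u y) (meanOut_nonneg Q W P₂ K y))
  calc ∑ x, (P₂ x).toReal * ∑ u, meanAux Q K x u * outRatio Q W P₂ K x u y
      ≤ ∑ x, (P₂ x).toReal * ∑ u, condOut Q W K x u y / meanOut Q W P₂ K y :=
        Finset.sum_le_sum fun x _ => mul_le_mul_of_nonneg_left
          (Finset.sum_le_sum fun u _ => h x u) ENNReal.toReal_nonneg
    _ = meanOut Q W P₂ K y / meanOut Q W P₂ K y := by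
        simp only [← Finset.sum_div, ← mul_div_assoc]
        rfl
    _ ≤ 1 := div_self_le_one _

theorem letterLaw_pos_iff_aux {x : X₂} {u : U} {s : S} {t : X₁} {y : Y}
    (h : letterLaw Q W P₂ K x u s t y ≠ 0) :
    0 < (Q s).toReal ∧ 0 < (P₂ x).toReal ∧ 0 < (K s x (u, t)).toReal ∧ 0 < (W t x s y).toReal := by
  simp only [letterLaw, inputLaw, ne_eq, mul_eq_zero, not_or] at h
  exact ⟨ENNReal.toReal_nonneg.lt_of_ne' h.1.1.1, ENNReal.toReal_nonneg.lt_of_ne' h.1.1.2,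
    ENNReal.toReal_nonneg.lt_of_ne' h.1.2, ENNReal.toReal_nonneg.lt_of_ne' h.2⟩

theorem condAux_pos {x : X₂} {u : U} {s : S} {t : X₁} (h : 0 < (K s x (u, t)).toReal) :
    0 < condAux K x u s :=
  h.trans_le (Finset.single_le_sum (f := fun t => (K s x (u, t)).toReal)
    (fun _ _ => ENNReal.toReal_nonneg) (Finset.mem_univ t))

theorem meanAux_pos {x : X₂} {u : U} {s : S} (hQ : 0 < (Q s).toReal) (h : 0 < condAux K x u s) :
    0 < meanAux Q K x u :=
  (mul_pos hQ h).trans_le (Finset.single_le_sum (f := fun s => (Q s).toReal * condAux K x u s)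
    (fun s _ => mul_nonneg ENNReal.toReal_nonneg (condAux_nonneg K x u s)) (Finset.mem_univ s))

theorem stateRatio_pos {x : X₂} {u : U} {s : S} {t : X₁} {y : Y}
    (h : letterLaw Q W P₂ K x u s t y ≠ 0) : 0 < stateRatio Q K x u s := by
  obtain ⟨h1, -, h3, -⟩ := letterLaw_pos_iff_aux Q W P₂ K h
  exact div_pos (condAux_pos K h3) (meanAux_pos Q K h1 (condAux_pos K h3))

theorem outRatio_pos {x : X₂} {u : U} {s : S} {t : X₁} {y : Y}
    (h : letterLaw Q W P₂ K x u s t y ≠ 0) : 0 < outRatio Q W P₂ K x u y := by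
  obtain ⟨h1, h2, h3, h4⟩ := letterLaw_pos_iff_aux Q W P₂ K h
  have h5 : 0 < condOut Q W K x u y := by
    refine (mul_pos (mul_pos h1 h3) h4).trans_le ?_
    refine (Finset.single_le_sum (f := fun t =>
      (Q s).toReal * (K s x (u, t)).toReal * (W t x s y).toReal) (fun t _ => by positivity)
      (Finset.mem_univ t)).trans ?_
    exact Finset.single_le_sum (f := fun s => ∑ t,
      (Q s).toReal * (K s x (u, t)).toReal * (W t x s y).toReal) (fun s _ =>
        Finset.sum_nonneg fun t _ => by positivity) (Finset.mem_univ s)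
  have h6 : 0 < meanOut Q W P₂ K y := by
    refine (mul_pos h2 h5).trans_le ?_
    refine (mul_le_mul_of_nonneg_left (Finset.single_le_sum (f := fun u => condOut Q W K x u y)
      (fun u _ => condOut_nonneg Q W K x u y) (Finset.mem_univ u)) h2.le).trans ?_
    exact Finset.single_le_sum (f := fun x => (P₂ x).toReal * ∑ u, condOut Q W K x u y)
      (fun x _ => mul_nonneg ENNReal.toReal_nonneg
        (Finset.sum_nonneg fun u _ => condOut_nonneg Q W K x u y)) (Finset.mem_univ x)
  exact div_pos h5 (mul_pos (meanAux_pos Q K h1 (condAux_pos K h3)) h6)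

/-- Change of measure: drawing the auxiliary letter independently of the state and reweighting by
`stateRatio` gives back the joint law. -/
theorem letterLaw_eq (x : X₂) (u : U) (s : S) (t : X₁) (y : Y) :
    letterLaw Q W P₂ K x u s t y = (P₂ x).toReal * (meanAux Q K x u * ((Q s).toReal *
      ((K s x (u, t)).toReal / condAux K x u s) * (W t x s y).toReal * stateRatio Q K x u s)) := by
  rw [letterLaw, inputLaw, stateRatio]
  rcases (ENNReal.toReal_nonneg (a := Q s)).eq_or_lt with h | h1
  · simp [← h]
  rcases (ENNReal.toReal_nonneg (a := K s x (u, t))).eq_or_lt with h | h2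
  · simp [← h]
  have h3 := (condAux_pos K h2).ne'
  have h4 := (meanAux_pos Q K h1 (condAux_pos K h2)).ne'
  field_simp

theorem auxProb_inputLaw (x : X₂) (u : U) :
    auxProb (inputLaw Q P₂ K) (u, x) = (P₂ x).toReal * meanAux Q K x u := by
  simp only [auxProb, inputLaw, meanAux, condAux, Finset.mul_sum]
  exact Finset.sum_congr rfl fun s _ => Finset.sum_congr rfl fun t _ => by ring

theorem outProb_inputLaw (x : X₂) (u : U) (y : Y) :
    outProb W Prod.snd (inputLaw Q P₂ K) (u, x) y = (P₂ x).toReal * condOut Q W K x u y := by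
  simp only [outProb, inputLaw, condOut, Finset.mul_sum]
  exact Finset.sum_congr rfl fun s _ => Finset.sum_congr rfl fun t _ => by ring

theorem sum_outProb_inputLaw (y : Y) :
    ∑ v, outProb W Prod.snd (inputLaw Q P₂ K) v y = meanOut Q W P₂ K y := by
  simp only [Fintype.sum_prod_type_right, outProb_inputLaw, ← Finset.mul_sum]
  rfl

variable [Fintype Y]

/-- The expectation under the joint law. -/
def letterMean (F : X₂ → U → S → X₁ → Y → ℝ) : ℝ :=
  ∑ x, ∑ u, ∑ s, ∑ t, ∑ y, letterLaw Q W P₂ K x u s t y * F x u s t y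

theorem letterMean_of_input (F : X₂ → U → S → ℝ) :
    (letterMean Q W P₂ K fun x u s _ _ => F x u s) =
      ∑ v : U × X₂, ∑ s, (∑ t, inputLaw Q P₂ K s v t) * F v.2 v.1 s := by
  rw [Fintype.sum_prod_type_right]
  refine Finset.sum_congr rfl fun x _ => Finset.sum_congr rfl fun u _ =>
    Finset.sum_congr rfl fun s _ => ?_
  rw [Finset.sum_mul]
  refine Finset.sum_congr rfl fun t _ => ?_
  simp only [letterLaw]
  rw [← Finset.sum_mul, ← Finset.mul_sum, PMF.sum_toReal, mul_one]

theorem letterMean_of_output (F : X₂ → U → Y → ℝ) :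
    (letterMean Q W P₂ K fun x u _ _ y => F x u y) =
      ∑ v : U × X₂, ∑ y, outProb W Prod.snd (inputLaw Q P₂ K) v y * F v.2 v.1 y := by
  rw [Fintype.sum_prod_type_right]
  refine Finset.sum_congr rfl fun x _ => Finset.sum_congr rfl fun u _ => ?_
  simp only [outProb, Finset.sum_mul]
  exact (Finset.sum_comm.trans (Finset.sum_congr rfl fun s _ => Finset.sum_comm)).symm

theorem letterMean_one : (letterMean Q W P₂ K fun _ _ _ _ _ => 1) = 1 := by
  classical
  rw [letterMean_of_input Q W P₂ K fun _ _ _ => 1, Finset.sum_comm]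
  simpa using (isTestLaw_inputLaw Q P₂ K).total

theorem letterMean_log_stateRatio :
    (letterMean Q W P₂ K fun x u s _ _ => Real.log (stateRatio Q K x u s)) =
      ∑ v, ∑ s, (∑ t, inputLaw Q P₂ K s v t) * Real.log ((∑ t, inputLaw Q P₂ K s v t) /
        (auxProb (inputLaw Q P₂ K) v * (Q s).toReal)) := by
  rw [letterMean_of_input Q W P₂ K fun x u s => Real.log (stateRatio Q K x u s)]
  refine Finset.sum_congr rfl fun v _ => Finset.sum_congr rfl fun s _ => ?_
  obtain ⟨u, x⟩ := v
  have h : ∑ t, inputLaw Q P₂ K s (u, x) t =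
      (Q s).toReal * (P₂ x).toReal * condAux K x u s := by
    simp only [inputLaw, condAux, Finset.mul_sum]
  rw [h, auxProb_inputLaw, stateRatio]
  rcases eq_or_ne ((Q s).toReal * (P₂ x).toReal) 0 with h0 | h0
  · simp [h0]
  · rw [mul_right_comm (P₂ x).toReal, mul_comm (P₂ x).toReal, mul_div_mul_left _ _ h0]

theorem letterMean_log_outRatio :
    (letterMean Q W P₂ K fun x u _ _ y => Real.log (outRatio Q W P₂ K x u y)) =
      ∑ v, ∑ y, outProb W Prod.snd (inputLaw Q P₂ K) v y *
        Real.log (outProb W Prod.snd (inputLaw Q P₂ K) v y / (auxProb (inputLaw Q P₂ K) v *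
          ∑ v', outProb W Prod.snd (inputLaw Q P₂ K) v' y)) := by
  rw [letterMean_of_output Q W P₂ K fun x u y => Real.log (outRatio Q W P₂ K x u y)]
  refine Finset.sum_congr rfl fun v _ => Finset.sum_congr rfl fun y _ => ?_
  obtain ⟨u, x⟩ := v
  rw [outProb_inputLaw, auxProb_inputLaw, sum_outProb_inputLaw, outRatio]
  rcases eq_or_ne (P₂ x).toReal 0 with h0 | h0
  · simp [h0]
  · rw [mul_assoc (P₂ x).toReal (meanAux Q K x u), mul_div_mul_left _ _ h0]

theorem rate_inputLaw_eq : rate Q W Prod.snd (inputLaw Q P₂ K) =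
    (letterMean Q W P₂ K fun x u _ _ y => Real.log (outRatio Q W P₂ K x u y)) -
      letterMean Q W P₂ K fun x u s _ _ => Real.log (stateRatio Q K x u s) := by
  rw [letterMean_log_outRatio, letterMean_log_stateRatio, rate]
  simp only [tsum_fintype]

/-- Nonnegativity of I(V;S), by log-sum. It keeps the exponent of the number of auxiliary words
nonnegative, so rounding up at most doubles that number. -/
theorem letterMean_log_stateRatio_nonneg :
    0 ≤ letterMean Q W P₂ K fun x u s _ _ => Real.log (stateRatio Q K x u s) := by
  classical
  have hr := inputLaw_nonneg Q P₂ K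
  have htot : ∑ v, ∑ s, ∑ t, inputLaw Q P₂ K s v t = 1 := by
    rw [Finset.sum_comm]; exact (isTestLaw_inputLaw Q P₂ K).total
  rw [letterMean_log_stateRatio, ← Fintype.sum_prod_type' (f := fun v s =>
    (∑ t, inputLaw Q P₂ K s v t) * Real.log ((∑ t, inputLaw Q P₂ K s v t) /
        (auxProb (inputLaw Q P₂ K) v * (Q s).toReal)))]
  refine le_trans (le_of_eq ?_) (sum_mul_log_div_ge Finset.univ
    (a := fun z : (U × X₂) × S => ∑ t, inputLaw Q P₂ K z.2 z.1 t)
    (b := fun z => auxProb (inputLaw Q P₂ K) z.1 * (Q z.2).toReal)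
    (fun z => Finset.sum_nonneg fun t _ => hr _ _ _)
    (fun z => mul_nonneg (auxProb_nonneg hr _) ENNReal.toReal_nonneg) fun z hz => ?_)
  · have h1 : ∑ z : (U × X₂) × S, ∑ t, inputLaw Q P₂ K z.2 z.1 t = 1 :=
      (Fintype.sum_prod_type _).trans htot
    have h2 : ∑ z : (U × X₂) × S, auxProb (inputLaw Q P₂ K) z.1 * (Q z.2).toReal = 1 := by
      rw [Fintype.sum_prod_type]
      simp only [← Finset.mul_sum, PMF.sum_toReal, mul_one]
      exact htot
    rw [h1, h2]
    simp
  · rcases mul_eq_zero.1 hz with h | h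
    · exact (Finset.sum_eq_zero_iff_of_nonneg fun s _ => Finset.sum_nonneg fun t _ => hr _ _ _).1 h
        z.2 (Finset.mem_univ _)
    · simp [inputLaw, h]

end Achievability

/-! ### Existence of codes below the rate -/

section CodeExistence

variable {S X₁ X₂ U Y : Type*} [Fintype S] [Fintype X₁] [Fintype X₂] [Fintype U]

theorem exists_code_of_maps [Fintype Y] {M M₁ n : ℕ} (hM : M ≠ 0) (h₁ : M₁ = 1) (Q : PMF S)
    (W : X₁ → X₂ → S → PMF Y) (f : Fin M → Fin n → X₂) (e : Fin M → (Fin n → S) → Fin n → X₁)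
    (d : (Fin n → Y) → Fin M) :
    ∃ c : Code S X₁ X₂ Y M M₁ n, c.StateFree₂ ∧ c.correctProb Q W = ENNReal.ofReal
      ((M : ℝ)⁻¹ * ∑ w, ∑ s : Fin n → S, (∏ i, (Q (s i)).toReal) * ∑ y : Fin n → Y,
        if d y = w then ∏ i, (W (e w s i) (f w i) (s i) (y i)).toReal else 0) := by
  subst h₁
  refine ⟨⟨fun w _ s => e w s, fun i w _ => f w i, fun y => (d y, 0)⟩, fun _ _ _ _ => rfl, ?_⟩
  have hn : ∀ (w : Fin M) (s : Fin n → S) (y : Fin n → Y),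
      0 ≤ if d y = w then ∏ i, (W (e w s i) (f w i) (s i) (y i)).toReal else 0 := by
    intro w s y
    split_ifs
    exacts [Finset.prod_nonneg fun _ _ => ENNReal.toReal_nonneg, le_rfl]
  have hQ : ∀ s : Fin n → S, 0 ≤ ∏ i, (Q (s i)).toReal := fun s =>
    Finset.prod_nonneg fun _ _ => ENNReal.toReal_nonneg
  have hM0 : (0 : ℝ) < M := by exact_mod_cast Nat.pos_of_ne_zero hM
  simp only [Code.correctProb, tsum_fintype, Fintype.sum_prod_type, Finset.univ_unique,
    Finset.sum_singleton]
  rw [ENNReal.ofReal_mul (by positivity), ENNReal.ofReal_sum_of_nonneg fun w _ =>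
    Finset.sum_nonneg fun s _ => mul_nonneg (hQ s) (Finset.sum_nonneg fun y _ => hn w s y),
    Finset.mul_sum]
  refine Finset.sum_congr rfl fun w _ => ?_
  rw [ENNReal.ofReal_sum_of_nonneg fun s _ =>
    mul_nonneg (hQ s) (Finset.sum_nonneg fun y _ => hn w s y), Finset.mul_sum]
  refine Finset.sum_congr rfl fun s _ => ?_
  rw [ENNReal.ofReal_mul (hQ s), ENNReal.ofReal_sum_of_nonneg fun y _ => hn w s y, Finset.mul_sum,
    Finset.mul_sum]
  refine Finset.sum_congr rfl fun y _ => ?_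
  by_cases h : d y = w
  · simp only [h, Fin.default_eq_zero, if_true, Code.jointProb, Code.input₂, Nat.cast_one,
      inv_one, mul_one, Finset.prod_mul_distrib]
    rw [ENNReal.ofReal_inv_of_pos hM0, ENNReal.ofReal_natCast,
      ENNReal.ofReal_prod_of_nonneg fun _ _ => ENNReal.toReal_nonneg,
      ENNReal.ofReal_prod_of_nonneg fun _ _ => ENNReal.toReal_nonneg]
    simp only [ENNReal.ofReal_toReal (PMF.apply_ne_top _ _)]
  · simp [h]

theorem Code.errorProb_le_of_correctProb {Y : Type*} {Mc M₁ n : ℕ} (c : Code S X₁ X₂ Y Mc M₁ n)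
    (Q : PMF S) (W : X₁ → X₂ → S → PMF Y) (hc : Mc ≠ 0) (h₁ : M₁ ≠ 0) {ε : ℝ}
    (h : ENNReal.ofReal (1 - ε) ≤ c.correctProb Q W) : c.errorProb Q W ≤ ENNReal.ofReal ε := by
  have h1 := c.errorProb_add_correctProb Q W hc h₁
  have h2 : c.correctProb Q W ≠ ∞ := ne_top_of_le_ne_top ENNReal.one_ne_top (h1 ▸ le_add_self)
  have h3 : (1 : ℝ≥0∞) ≤ ENNReal.ofReal ε + ENNReal.ofReal (1 - ε) := by
    rw [← ENNReal.ofReal_one]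
    refine le_trans (le_of_eq ?_) ENNReal.ofReal_add_le
    congr 1; ring
  refine (ENNReal.add_le_add_iff_right h2).1 ?_
  rw [h1]
  exact h3.trans (add_le_add_right h _)

theorem natCeil_le_two_mul {x : ℝ} (hx : 1 ≤ x) : (⌈x⌉₊ : ℝ) ≤ 2 * x := by
  have := (Nat.ceil_lt_add_one (zero_le_one.trans hx)).le
  linarith

/-- Rates below `I(U,X₂;Y) - I(U;S|X₂)` are achieved by block codes when the output alphabet is
finite. -/
theorem exists_code_of_lt_rate [Fintype Y] [Nonempty X₁] (Q : PMF S) (W : X₁ → X₂ → S → PMF Y)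
    (P₂ : PMF X₂) (K : S → X₂ → PMF (U × X₁)) {R : ℝ} (hR0 : 0 ≤ R)
    (hR : R * Real.log 2 < rate Q W Prod.snd (inputLaw Q P₂ K)) {ε : ℝ} (hε : 0 < ε) :
    ∃ n : ℕ, 0 < n ∧ ∃ c : Code S X₁ X₂ Y ⌈(2 : ℝ) ^ ((n : ℝ) * R)⌉₊
      ⌈(2 : ℝ) ^ ((n : ℝ) * 0)⌉₊ n, c.StateFree₂ ∧ c.errorProb Q W ≤ ENNReal.ofReal ε := by
  classical
  set Ia := letterMean Q W P₂ K fun x u s _ _ => Real.log (stateRatio Q K x u s) with hIa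
  set Ib := letterMean Q W P₂ K fun x u _ _ y => Real.log (outRatio Q W P₂ K x u y) with hIb
  have hIa0 : 0 ≤ Ia := letterMean_log_stateRatio_nonneg Q W P₂ K
  rw [rate_inputLaw_eq, ← hIa, ← hIb] at hR
  have hlog2 : 0 < Real.log 2 := Real.log_pos one_lt_two
  -- A quarter of the gap: the auxiliary words get exponent E = Ia + δ, and the total exponent is E'
  -- = Ib - 3δ, so both means below are negative.
  set δ := (Ib - Ia - R * Real.log 2) / 4 with hδ
  have hδ0 : 0 < δ := by rw [hδ]; linarith
  set E := Ia + δ with hE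
  set E' := R * Real.log 2 + E with hE'
  have hE0 : 0 ≤ E := by linarith
  let p : X₂ × U × S × X₁ × Y → ℝ := fun z => letterLaw Q W P₂ K z.1 z.2.1 z.2.2.1 z.2.2.2.1 z.2.2.2.2
  have hsum : ∀ F : X₂ → U → S → X₁ → Y → ℝ, letterMean Q W P₂ K F =
      ∑ z : X₂ × U × S × X₁ × Y, p z * F z.1 z.2.1 z.2.2.1 z.2.2.2.1 z.2.2.2.2 := fun F => by
    simp only [Fintype.sum_prod_type]; rfl
  have hp1 : ∑ z, p z = 1 := by
    have := hsum fun _ _ _ _ _ => 1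
    simp only [mul_one] at this
    rw [← this, letterMean_one]
  have hca : ∑ z : X₂ × U × S × X₁ × Y,
      p z * (Real.log (stateRatio Q K z.1 z.2.1 z.2.2.1) - E) < 0 := by
    simp only [mul_sub, Finset.sum_sub_distrib, ← Finset.sum_mul, hp1, one_mul]
    rw [← hsum fun x u s _ _ => Real.log (stateRatio Q K x u s), ← hIa]
    linarith
  have hcb : ∑ z : X₂ × U × S × X₁ × Y,
      p z * (E' - Real.log (outRatio Q W P₂ K z.1 z.2.1 z.2.2.2.2)) < 0 := by
    simp only [mul_sub, Finset.sum_sub_distrib, ← Finset.sum_mul, hp1, one_mul]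
    rw [← hsum fun x u _ _ y => Real.log (outRatio Q W P₂ K x u y), ← hIb]
    linarith
  obtain ⟨τ, ⟨hγa, hγb⟩, hτ, hτ1⟩ := (((eventually_sum_mul_exp_lt_one hp1 hca).and
    (eventually_sum_mul_exp_lt_one hp1 hcb)).and (Ioo_mem_nhdsGT one_pos)).exists
  set γa := ∑ z : X₂ × U × S × X₁ × Y,
    p z * Real.exp (τ * (Real.log (stateRatio Q K z.1 z.2.1 z.2.2.1) - E)) with hγa'
  set γb := ∑ z : X₂ × U × S × X₁ × Y,
    p z * Real.exp (τ * (E' - Real.log (outRatio Q W P₂ K z.1 z.2.1 z.2.2.2.2))) with hγb'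
  have hp0 : ∀ z, 0 ≤ p z := fun z =>
    mul_nonneg (inputLaw_nonneg Q P₂ K _ _ _) ENNReal.toReal_nonneg
  have hγa0 : 0 ≤ γa := Finset.sum_nonneg fun z _ => mul_nonneg (hp0 z) (Real.exp_pos _).le
  have hγb0 : 0 ≤ γb := Finset.sum_nonneg fun z _ => mul_nonneg (hp0 z) (Real.exp_pos _).le
  -- The powers become exponentials of logarithms; where a ratio is not positive the joint law has
  -- no mass.
  have hma : (letterMean Q W P₂ K fun x u s _ _ => stateRatio Q K x u s ^ τ) =
      γa * Real.exp (τ * E) := by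
    rw [hsum, hγa', Finset.sum_mul]
    refine Finset.sum_congr rfl fun z _ => ?_
    rcases eq_or_ne (p z) 0 with h | h
    · simp [h]
    · rw [Real.rpow_def_of_pos (stateRatio_pos Q W P₂ K h), mul_assoc, ← Real.exp_add]
      congr 2; ring
  have hmb : (letterMean Q W P₂ K fun x u _ _ y => outRatio Q W P₂ K x u y ^ (-τ)) =
      γb * Real.exp (-(τ * E')) := by
    rw [hsum, hγb', Finset.sum_mul]
    refine Finset.sum_congr rfl fun z _ => ?_
    rcases eq_or_ne (p z) 0 with h | h
    · simp [h]
    · rw [Real.rpow_def_of_pos (outRatio_pos Q W P₂ K h), mul_assoc, ← Real.exp_add]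
      congr 2; ring
  -- The 4 pays for rounding up the numbers of messages and of auxiliary words, each at most
  -- doubled.
  have hlim : Filter.Tendsto (fun n : ℕ => γa ^ n + (4 : ℝ) ^ τ * γb ^ n) Filter.atTop (nhds 0) := by
    have h1 := tendsto_pow_atTop_nhds_zero_of_lt_one hγa0 hγa
    have h2 := (tendsto_pow_atTop_nhds_zero_of_lt_one hγb0 hγb).const_mul ((4 : ℝ) ^ τ)
    simpa using h1.add h2
  obtain ⟨n, hnε, hn⟩ := ((hlim.eventually (gt_mem_nhds hε)).and
    (Filter.eventually_gt_atTop 0)).exists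
  refine ⟨n, hn, ?_⟩
  have hMpos : ⌈(2 : ℝ) ^ ((n : ℝ) * R)⌉₊ ≠ 0 := (Nat.ceil_pos.2 (by positivity)).ne'
  have hM₁ : ⌈(2 : ℝ) ^ ((n : ℝ) * 0)⌉₊ = 1 := by simp
  generalize hM₁g : ⌈(2 : ℝ) ^ ((n : ℝ) * 0)⌉₊ = M₁ at hM₁ ⊢
  have h2R : (1 : ℝ) ≤ (2 : ℝ) ^ ((n : ℝ) * R) :=
    Real.one_le_rpow one_le_two (by positivity)
  have hM2 := natCeil_le_two_mul h2R
  generalize hMg : ⌈(2 : ℝ) ^ ((n : ℝ) * R)⌉₊ = M at hMpos hM2 ⊢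
  set J := ⌈Real.exp (n * E)⌉₊ with hJ
  have hJpos : J ≠ 0 := (Nat.ceil_pos.2 (Real.exp_pos _)).ne'
  have hJ1 : Real.exp (n * E) ≤ J := Nat.le_ceil _
  have hJ2 : (J : ℝ) ≤ 2 * Real.exp (n * E) :=
    natCeil_le_two_mul (Real.one_le_exp (by positivity))
  obtain ⟨f, e, d, hcode⟩ := exists_block_code (X₁ := X₁) hMpos hJpos n
    (P₂ := fun x => (P₂ x).toReal) (κ := meanAux Q K) (a := stateRatio Q K)
    (b := outRatio Q W P₂ K) (Q := fun s => (Q s).toReal)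
    (θ := fun x u s t => (K s x (u, t)).toReal / condAux K x u s)
    (W := fun t x s y => (W t x s y).toReal) (fun _ => ENNReal.toReal_nonneg) (PMF.sum_toReal P₂)
    (meanAux_nonneg Q K) (sum_meanAux Q K) (stateRatio_nonneg Q K)
    (sum_meanAux_mul_stateRatio_le Q K) (outRatio_nonneg Q W P₂ K) (sum_mul_outRatio_le Q W P₂ K)
    (fun _ => ENNReal.toReal_nonneg)
    (fun x u s t => div_nonneg ENNReal.toReal_nonneg (condAux_nonneg K x u s))
    (fun x u s => by rw [← Finset.sum_div]; exact div_self_le_one _)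
    (fun _ _ _ _ => ENNReal.toReal_nonneg) (letterLaw_eq Q W P₂ K)
    (by simpa [letterMean] using letterMean_one Q W P₂ K)
    (fun x u s t y h => by
      by_contra hcon
      exact (outRatio_pos Q W P₂ K hcon).ne' h) hτ hτ1.le
  obtain ⟨c, hfree, hcorrect⟩ := exists_code_of_maps hMpos hM₁ Q W f e d
  refine ⟨c, hfree, c.errorProb_le_of_correctProb Q W hMpos (by omega) ?_⟩
  rw [hcorrect]
  refine ENNReal.ofReal_le_ofReal (le_trans ?_ hcode)
  change _ ≤ 1 - (letterMean Q W P₂ K fun x u s _ _ => stateRatio Q K x u s ^ τ) ^ n / (J : ℝ) ^ τ -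
    (M * J : ℝ) ^ τ * (letterMean Q W P₂ K fun x u _ _ y => outRatio Q W P₂ K x u y ^ (-τ)) ^ n
  rw [hma, hmb, mul_pow, mul_pow, ← Real.exp_nat_mul, ← Real.exp_nat_mul]
  have h1 : γa ^ n * Real.exp (n * (τ * E)) / (J : ℝ) ^ τ ≤ γa ^ n := by
    have hJτ : Real.exp (n * (τ * E)) ≤ (J : ℝ) ^ τ := by
      rw [show (n : ℝ) * (τ * E) = n * E * τ by ring, Real.exp_mul]
      exact Real.rpow_le_rpow (Real.exp_pos _).le hJ1 hτ.le
    have hpos : 0 < (J : ℝ) ^ τ := (Real.exp_pos _).trans_le hJτ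
    rw [div_le_iff₀ hpos]
    exact mul_le_mul_of_nonneg_left hJτ (by positivity)
  have h2 : (M * J : ℝ) ^ τ * (γb ^ n * Real.exp (n * -(τ * E'))) ≤ (4 : ℝ) ^ τ * γb ^ n := by
    have h3 : (2 : ℝ) ^ ((n : ℝ) * R) = Real.exp (n * (R * Real.log 2)) := by
      rw [Real.rpow_def_of_pos two_pos]; congr 1; ring
    have h4 : (M * J : ℝ) ≤ 4 * Real.exp (n * E') := by
      rw [hE', mul_add, Real.exp_add, ← h3]
      have := mul_le_mul hM2 hJ2 (Nat.cast_nonneg J) (by positivity)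
      linarith
    have h5 : (M * J : ℝ) ^ τ ≤ 4 ^ τ * Real.exp (n * E' * τ) := by
      rw [Real.exp_mul, ← Real.mul_rpow (by norm_num) (Real.exp_pos _).le]
      exact Real.rpow_le_rpow (by positivity) h4 hτ.le
    calc (M * J : ℝ) ^ τ * (γb ^ n * Real.exp (n * -(τ * E')))
        ≤ (4 ^ τ * Real.exp (n * E' * τ)) * (γb ^ n * Real.exp (n * -(τ * E'))) :=
          mul_le_mul_of_nonneg_right h5 (by positivity)
      _ = 4 ^ τ * γb ^ n * (Real.exp (n * E' * τ) * Real.exp (n * -(τ * E'))) := by ring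
      _ = 4 ^ τ * γb ^ n := by
          rw [← Real.exp_add, show (n : ℝ) * E' * τ + n * -(τ * E') = 0 by ring, Real.exp_zero,
            mul_one]
  linarith

/-- At rate zero there is a single message pair, so decoding cannot fail. This settles the case of
capacity zero, where no nonnegative rate lies below capacity. -/
theorem isAchievableNoState₂_zero {Y : Type*} [Nonempty X₁] [Nonempty X₂] (Q : PMF S)
    (W : X₁ → X₂ → S → PMF Y) : IsAchievableNoState₂ Q W (0, 0) := by
  refine ⟨le_rfl, le_rfl, fun ε _ => ⟨1, one_pos, ?_⟩⟩
  have h1 : ⌈(2 : ℝ) ^ (((1 : ℕ) : ℝ) * ((0 : ℝ), (0 : ℝ)).1)⌉₊ = 1 := by simp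
  rw [h1]
  refine ⟨⟨fun _ _ _ _ => Classical.arbitrary X₁, fun _ _ _ => Classical.arbitrary X₂,
    fun _ => (0, 0)⟩, fun _ _ _ _ => rfl, ?_⟩
  refine le_of_eq_of_le ?_ zero_le
  rw [Code.errorProb]
  exact ENNReal.tsum_eq_zero.2 fun w => ENNReal.tsum_eq_zero.2 fun s =>
    ENNReal.tsum_eq_zero.2 fun y => if_pos (Subsingleton.elim (α := Fin 1 × Fin 1) _ _)

/-- The direct part: rates below `I(U,X₂;Y) - I(U;S|X₂)` are achievable without any state at
Encoder 2. -/
theorem isAchievableNoState₂_of_lt {Y : Type*} [Nonempty X₁] {Q : PMF S}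
    {W : X₁ → X₂ → S → PMF Y} {P₂ : PMF X₂} {K : S → X₂ → PMF (U × X₁)} {R : ℝ} (hR0 : 0 ≤ R)
    (hR : R < rateFunctional (jointLaw Q W P₂ K)) : IsAchievableNoState₂ Q W (R, 0) := by
  classical
  refine ⟨hR0, le_rfl, fun ε hε => ?_⟩
  rw [rateFunctional_jointLaw, lt_div_iff₀ (Real.log_pos one_lt_two)] at hR
  have htot : ∑ v, auxProb (inputLaw Q P₂ K) v = 1 := by
    rw [← (isTestLaw_inputLaw Q P₂ K).total, Finset.sum_comm]; rfl
  -- The slack in the rate pays for passing to a finite output alphabet; the code found there is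
  -- pulled back with the same error.
  obtain ⟨T, hT⟩ := exists_rate_quantize_gt Q W Prod.snd (inputLaw_nonneg Q P₂ K) htot hR
  obtain ⟨n, hn, c, hfree, hc⟩ := exists_code_of_lt_rate Q _ P₂ K hR0 hT hε
  refine ⟨n, hn, c.comap (quantize T), hfree, ?_⟩
  rw [c.errorProb_comap Q W _ (Nat.ceil_pos.2 (by positivity)).ne'
    (Nat.ceil_pos.2 (by positivity)).ne']
  exact hc

theorem IsAchievableNoState₂.isAchievable {S X₁ X₂ Y : Type*} {Q : PMF S}
    {W : X₁ → X₂ → S → PMF Y} {R : ℝ × ℝ} (h : IsAchievableNoState₂ Q W R) :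
    IsAchievable Q W R :=
  ⟨h.1, h.2.1, fun ε hε => by
    obtain ⟨n, hn, c, -, hc⟩ := h.2.2 ε hε
    exact ⟨n, hn, c, hc⟩⟩

end CodeExistence

/-! ### From achievable rates to the capacity -/

section Capacity

/-- If the achievable pairs have first coordinates in `[0, C]` and contain `(0, 0)` and all `(R, 0)`
with `0 ≤ R < C`, then `C` is the largest rate at individual rate zero. -/
theorem isGreatest_closure_and_isLUB {A : Set (ℝ × ℝ)} {C : ℝ} (h0 : ((0 : ℝ), (0 : ℝ)) ∈ A)
    (hle : ∀ R ∈ A, R.1 ≤ C) (hlt : ∀ R, 0 ≤ R → R < C → (R, (0 : ℝ)) ∈ A) :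
    IsGreatest {R : ℝ | (R, (0 : ℝ)) ∈ closure A} C ∧ IsLUB {R : ℝ | (R, (0 : ℝ)) ∈ A} C := by
  have hC : 0 ≤ C := hle _ h0
  have hub : ∀ R ∈ closure A, R.1 ≤ C := fun R hR =>
    closure_minimal (t := {R : ℝ × ℝ | R.1 ≤ C}) hle
      (isClosed_le continuous_fst continuous_const) hR
  refine ⟨⟨?_, fun R hR => hub _ hR⟩, fun R hR => hle _ hR, fun B hB => ?_⟩
  -- For C = 0 the interval [0, C) is empty and only the trivial pair is available.
  · rcases hC.eq_or_lt with h | h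
    · rw [← h]; exact subset_closure h0
    · have hmem : C ∈ closure (Set.Ico 0 C) := by
        rw [closure_Ico h.ne]; exact ⟨hC, le_rfl⟩
      have hcont : Continuous fun R : ℝ => (R, (0 : ℝ)) := by fun_prop
      have hmaps : Set.MapsTo (fun R : ℝ => (R, (0 : ℝ))) (Set.Ico 0 C) A :=
        fun R hR => hlt R hR.1 hR.2
      exact hmaps.closure hcont hmem
  · refine le_of_forall_lt fun x hx => ?_
    rcases hC.eq_or_lt with h | h
    · exact hx.trans_le (h ▸ hB h0)
    · obtain ⟨y, hy1, hy2⟩ := exists_between (max_lt hx h)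
      exact (lt_of_le_of_lt (le_max_left x 0) hy1).trans_le
        (hB (hlt y ((le_max_right x 0).trans hy1.le) hy2))

end Capacity

end StateMAC

end

theorem theorem3 {S X₁ X₂ Y : Type*} [Fintype S] [Fintype X₁] [Fintype X₂]
    [Nonempty X₁] [Nonempty X₂] (Q : PMF S) (W : X₁ → X₂ → S → PMF Y) :
    -- the common-message capacity is the largest common rate at individual rate 0 ...
    IsGreatest {R : ℝ | (R, 0) ∈ StateMAC.capacityRegion Q W}
      (StateMAC.commonMessageCapacity Q W) ∧
    -- ... also the supremum of the rates of codes without individual message ...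
    IsLUB {R : ℝ | StateMAC.IsAchievable Q W (R, 0)} (StateMAC.commonMessageCapacity Q W) ∧
    -- ... and it is the maximum of I(U,X₂;Y) - I(U;S|X₂), over all finite alphabets of U
    IsGreatest {r : ℝ | ∃ (k : ℕ) (P₂ : PMF X₂) (K : S → X₂ → PMF (Fin k × X₁)),
        r = StateMAC.rateFunctional (StateMAC.jointLaw Q W P₂ K)}
      (StateMAC.commonMessageCapacity Q W) ∧
    -- without any state at Encoder 2 the common-message capacity is the same
    IsGreatest {R : ℝ | (R, 0) ∈ StateMAC.capacityRegionNoState₂ Q W}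
      (StateMAC.commonMessageCapacity Q W) ∧
    IsLUB {R : ℝ | StateMAC.IsAchievableNoState₂ Q W (R, 0)}
      (StateMAC.commonMessageCapacity Q W) := by
  classical
  obtain ⟨k, P₂, K, hmax⟩ := StateMAC.exists_max_rateFunctional Q W
  set C := StateMAC.rateFunctional (StateMAC.jointLaw Q W P₂ K) with hC
  have h0 := StateMAC.isAchievableNoState₂_zero Q W
  -- The upper bound holds for the larger class of codes and the lower bound for the smaller, so one
  -- C serves both models.
  have hle : ∀ R, StateMAC.IsAchievable Q W R → R.1 ≤ C := fun R hR =>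
    hR.le_of_rateFunctional_le hmax
  have hlt : ∀ R, 0 ≤ R → R < C → StateMAC.IsAchievableNoState₂ Q W (R, 0) := fun R hR hRC =>
    StateMAC.isAchievableNoState₂_of_lt hR hRC
  have h1 := StateMAC.isGreatest_closure_and_isLUB (A := {R | StateMAC.IsAchievable Q W R})
    h0.isAchievable hle fun R hR hRC => (hlt R hR hRC).isAchievable
  have h2 := StateMAC.isGreatest_closure_and_isLUB (A := {R | StateMAC.IsAchievableNoState₂ Q W R})
    h0 (fun R hR => hle R hR.isAchievable) hlt
  have hcap : StateMAC.commonMessageCapacity Q W = C := h1.1.csSup_eq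
  rw [hcap]
  refine ⟨h1.1, h1.2, ⟨⟨k, P₂, K, rfl⟩, ?_⟩, h2.1, h2.2⟩
  rintro _ ⟨k', P₂', K', rfl⟩
  exact hmax k' P₂' K'
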